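/- Let $d\ge 1$. For a function $k:\mathbb{R}^d\times\mathbb{R}^d\to\mathbb{C}$ (values on the diagonal are irrelevant), measurable jointly and in $x$ for each $y$, put $$H(k)=\sup_{Q\ \mathrm{dyadic}}\ \sum_{j\ge1}\ \sup_{y\in Q}\Big(2^{jd}\ell(Q)^d\int_{2^j\ell(Q)\le|x-c_Q|\le2^{j+1}\ell(Q)}|k(x,y)-k(x,c_Q)|^2\,dx\Big)^{1/2},$$ where the supremum runs over the cubes $Q=2^{-n}\prod_{i=1}^d[a_i,a_i+1)$ with $n\in\mathbb{Z}$, $a\in\mathbb{Z}^d$, and $\ell(Q)$, $c_Q$ are the side length and the center of $Q$. Let $T_k:L_2(\mathbb{R}^d)\to L_2(\mathbb{R}^d)$ be a bounded linear operator (on complex-valued functions) with kernel $k$: for every bounded $f$ vanishing outside a compact set $K$ and almost every $x\notin K$, $T_kf(x)=\int_{\mathbb{R}^d} k(x,y)f(y)\,dy$, the integral being absolutely convergent. Assume $H(k)<\infty$. Then there is a constant $C_d$, depending only on $d$, such that $T_k$ (restricted to $L_1\cap L_2$) has exactly one linear extension from $L_1(\mathbb{R}^d)$ to the measurable functions modulo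 null sets, still denoted $T_k$, with the following property: for every $m$ and every integrable $f=(f_{ij}):\mathbb{R}^d\to M_m(\mathbb{C})$, the matrix-valued function $T_kf=(T_kf_{ij})$ satisfies $$\sup_{\lambda>0}\ \lambda\int_{\mathbb{R}^d}\mathrm{tr}\big\{|T_kf(x)|>\lambda\big\}\,dx\ \le\ C_d\,\big(\|T_k\|_{L_2\to L_2}+H(k)\big)\int_{\mathbb{R}^d}\mathrm{tr}\,|f(x)|\,dx .$$ Here $|A|=(A^*A)^{1/2}$, $\{|A|>\lambda\}$ is the spectral projection $\chi_{(\lambda,\infty)}(|A|)$ and $\mathrm{tr}$ is the usual trace on $M_m(\mathbb{C})$. The constant $C_d$ is independent of $m$, $T_k$, $k$ and $f$. -/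

import Mathlib

open MeasureTheory
open scoped ENNReal NNReal Matrix

noncomputable section

namespace MatrixCZ

/-- The Euclidean space `ℝ^d` (Euclidean norm, Lebesgue measure). -/
abbrev E (d : ℕ) : Type := EuclideanSpace ℝ (Fin d)

/-- Scalar `L_2(ℝ^d, dx)`. -/
abbrev L2 (d : ℕ) : Type := Lp ℂ 2 (volume : Measure (E d))

/-- Scalar `L_1(ℝ^d, dx)`. -/
abbrev L1 (d : ℕ) : Type := Lp ℂ 1 (volume : Measure (E d))

/-- Scalar measurable functions on `ℝ^d`, modulo equality almost everywhere. -/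
abbrev L0 (d : ℕ) : Type := E d →ₘ[(volume : Measure (E d))] ℂ

/-! ### Matrices: modulus, trace norm and trace of level projections -/

/-- The modulus `|A| = (A* A)^{1/2}` of a matrix. -/
def modulus {m : ℕ} (A : Matrix (Fin m) (Fin m) ℂ) : Matrix (Fin m) (Fin m) ℂ :=
  cfc Real.sqrt (Aᴴ * A)

/-- `tr |A|`, as an extended nonnegative real. -/
def trAbs {m : ℕ} (A : Matrix (Fin m) (Fin m) ℂ) : ℝ≥0∞ :=
  ENNReal.ofReal (modulus A).trace.re

/-- The spectral projection `{|A| > t} = χ_{(t, ∞)}(|A|)`. -/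
def levelProj {m : ℕ} (t : ℝ) (A : Matrix (Fin m) (Fin m) ℂ) : Matrix (Fin m) (Fin m) ℂ :=
  cfc (Set.indicator (Set.Ioi t) (fun _ => (1 : ℝ))) (modulus A)

/-- `tr {|A| > t}`, as an extended nonnegative real. -/
def trLevel {m : ℕ} (t : ℝ) (A : Matrix (Fin m) (Fin m) ℂ) : ℝ≥0∞ :=
  ENNReal.ofReal (levelProj t A).trace.re

/-! ### Dyadic cubes -/

/-- Side length `2^{-n}` of the dyadic cubes of generation `n ∈ ℤ`. -/
def sideLength (n : ℤ) : ℝ := (2 : ℝ) ^ (-n)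

/-- The dyadic cube `2^{-n} ([a_1, a_1 + 1) × ⋯ × [a_d, a_d + 1))`. -/
def dyadicCube {d : ℕ} (n : ℤ) (a : Fin d → ℤ) : Set (E d) :=
  {y | ∀ i, sideLength n * (a i : ℝ) ≤ y i ∧ y i < sideLength n * ((a i : ℝ) + 1)}

/-- The center of `dyadicCube n a`. -/
def cubeCenter {d : ℕ} (n : ℤ) (a : Fin d → ℤ) : E d :=
  WithLp.toLp 2 (fun i => sideLength n * ((a i : ℝ) + 1 / 2))

/-- The annulus `{x : 2^j ℓ ≤ |x - c| ≤ 2^{j+1} ℓ}`. -/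
def annulus {d : ℕ} (c : E d) (l : ℝ) (j : ℕ) : Set (E d) :=
  {x | 2 ^ j * l ≤ ‖x - c‖ ∧ ‖x - c‖ ≤ 2 ^ (j + 1) * l}

/-! ### Kernels and Calderón-Zygmund operators -/

/-- The `L_2`-Hörmander constant of a kernel: the supremum over dyadic cubes `Q` of the sum over
`j ≥ 1` of the supremum over `y ∈ Q` of
`(2^{jd} ℓ(Q)^d ∫_{2^j ℓ(Q) ≤ |x - c_Q| ≤ 2^{j+1} ℓ(Q)} |k(x,y) - k(x,c_Q)|^2 dx)^{1/2}`. -/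
def l2Hormander {d : ℕ} (k : E d → E d → ℂ) : ℝ≥0∞ :=
  ⨆ (n : ℤ) (a : Fin d → ℤ), ∑' j : {j : ℕ // 1 ≤ j}, ⨆ y ∈ dyadicCube n a,
    (ENNReal.ofReal ((2 : ℝ) ^ ((j : ℕ) * d) * sideLength n ^ d) *
      ∫⁻ x in annulus (cubeCenter n a) (sideLength n) j,
        ‖k x y - k x (cubeCenter n a)‖ₑ ^ 2) ^ (1 / 2 : ℝ)

/-- `T`, bounded on `L_2(ℝ^d)`, is a Calderón-Zygmund operator with the measurable kernel `k`: if
`f` is bounded and vanishes outside the compact set `K`, then for almost every `x ∉ K`,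
`T f (x) = ∫ k(x,y) f(y) dy` with an absolutely convergent integral. The values of `k` on the
diagonal play no role in this representation. -/
structure IsCZOperator {d : ℕ} (T : L2 d →L[ℂ] L2 d) (k : E d → E d → ℂ) : Prop where
  aestronglyMeasurable : AEStronglyMeasurable (Function.uncurry k)
    ((volume : Measure (E d)).prod (volume : Measure (E d)))
  aestronglyMeasurable_section : ∀ y : E d, AEStronglyMeasurable (fun x => k x y) volume
  representation : ∀ (f : L2 d) (K : Set (E d)), IsCompact K →
    (∃ M : ℝ, ∀ᵐ y, ‖f y‖ ≤ M) → (∀ᵐ y, y ∉ K → f y = 0) →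
    ∀ᵐ x, x ∉ K →
      Integrable (fun y => k x y * f y) volume ∧ T f x = ∫ y, k x y * f y

/-- `S`, defined on `L_1(ℝ^d)`, agrees with `T` on `L_1(ℝ^d) ∩ L_2(ℝ^d)`. -/
def Extends {d : ℕ} (S : L1 d →ₗ[ℂ] L0 d) (T : L2 d →L[ℂ] L2 d) : Prop :=
  ∀ (g : L1 d) (h : L2 d), (g : E d → ℂ) =ᵐ[volume] (h : E d → ℂ) →
    (S g : E d → ℂ) =ᵐ[volume] (T h : E d → ℂ)

/-- The weak type `(1,1)` inequality, with constant `A`, for the entrywise action of `S` on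
`M_m`-valued integrable functions `f`, that is, on `m × m` matrices of integrable functions:
`λ ∫ tr {|S f(x)| > λ} dx ≤ A ∫ tr |f(x)| dx` for every `λ > 0`. -/
def WeakTypeOneOne {d : ℕ} (m : ℕ) (S : L1 d →ₗ[ℂ] L0 d) (A : ℝ≥0∞) : Prop :=
  ∀ (f : Matrix (Fin m) (Fin m) (L1 d)) (t : ℝ), 0 < t →
    ENNReal.ofReal t * ∫⁻ x : E d, trLevel t (f.map fun g => (S g : E d → ℂ) x) ≤
      A * ∫⁻ x : E d, trAbs (f.map fun g => (g : E d → ℂ) x)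

end MatrixCZ

end

namespace MatrixCZ

open scoped ComplexOrder

/-! ### Matrices acting on Euclidean space -/

/-! This is a noncommutative Calderón-Zygmund decomposition in which the exceptional set of the
classical proof is replaced by a rank count. Fix a positive semidefinite dyadic step function f and
a height lam = t/A, where A dominates both the L_2 norm and the Hörmander constant. Along each
branch of the dyadic tree, with averages f_i, Cuculescu's construction gives decreasing projections
q_i with q_0 = 1: the difference p_i = q_i - q_{i+1} is the spectral projection of q_i f_{i+1} q_i
for (lam, ∞). Telescoping q_i f q_i, and using that p_i commutes with this compression, one gets
(`cz_decomposition`) f = [q_K f q_K + Σ p_i f_{i+1} p_i] + Σ p_i (f - f_{i+1}) q_i + Σ q_{i+1} (f -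
f_{i+1}) p_i.

The bracket is the good part. Its blocks are mutually orthogonal and bounded by 2^d lam, so its
Hilbert-Schmidt square is at most 2^d lam times the trace mass of f, and L_2 boundedness with
Chebyshev's inequality finishes (`good_estimate`).

A bad term belongs to a cube Q and a projection p; it has mean zero on Q and carries p on one side.
Near Q the image has rank at most tr p, whatever its size. Since tr{|X| > 0} is at most the rank and
the level counts are subadditive (`trLevel_add_le`, from Courant-Fischer), the nearby points cost at
most a constant times |Q| tr p. Far from Q the image is a product of p and a Hilbert-Schmidt factor.
Mean zero replaces k(x,y) by k(x,y) - k(x,c_Q), `hsSq_sum_smul_le` bounds the factor using only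
squares of the scalar coefficients, and Cauchy-Schwarz on dyadic annuli brings in the Hörmander
constant (`lintegral_farFrom_le`). Both contributions are summed by Cuculescu's inequality: lam Σ
|Q| tr p is at most the trace mass of f (`sum_trace_cucDiff_le`).

General step functions split into four positive ones without increasing the trace norm
(`weakType_step`). To pass to L_1, `StepLimit` describes the images that are limits in measure along
dyadic step functions. The inequality survives such limits with a constant independent of m, and its
scalar case makes these limits exist and be unique. Hence they define the linear extension, and
every admissible extension coincides with it. -/

/-- The Euclidean space on which `m × m` matrices act. -/
abbrev Vec (m : ℕ) : Type := EuclideanSpace ℂ (Fin m)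

/-- The operator on Euclidean space defined by a matrix. -/
noncomputable def act {m : ℕ} (A : Matrix (Fin m) (Fin m) ℂ) : Vec m →L[ℂ] Vec m :=
  Matrix.toEuclideanCLM (n := Fin m) (𝕜 := ℂ) A

/-- The square of the Hilbert-Schmidt norm. -/
noncomputable def hsSq {m : ℕ} (A : Matrix (Fin m) (Fin m) ℂ) : ℝ := ∑ i, ∑ j, ‖A i j‖ ^ 2

section

variable {m : ℕ}

lemma act_mul (A B : Matrix (Fin m) (Fin m) ℂ) (v : Vec m) :
    act (A * B) v = act A (act B v) := by
  simp [act, map_mul]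

lemma act_add (A B : Matrix (Fin m) (Fin m) ℂ) (v : Vec m) :
    act (A + B) v = act A v + act B v := by
  simp [act, map_add]

lemma act_sub (A B : Matrix (Fin m) (Fin m) ℂ) (v : Vec m) :
    act (A - B) v = act A v - act B v := by
  simp [act, map_sub]

lemma act_smul (c : ℂ) (A : Matrix (Fin m) (Fin m) ℂ) (v : Vec m) :
    act (c • A) v = c • act A v := by
  simp [act, map_smul]

lemma act_sum {ι : Type*} (s : Finset ι) (A : ι → Matrix (Fin m) (Fin m) ℂ) (v : Vec m) :
    act (∑ i ∈ s, A i) v = ∑ i ∈ s, act (A i) v := by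
  simp [act, map_sum]

lemma act_one (v : Vec m) : act (1 : Matrix (Fin m) (Fin m) ℂ) v = v := by
  simp [act]

lemma inner_act_right (A : Matrix (Fin m) (Fin m) ℂ) (u v : Vec m) :
    inner ℂ u (act A v) = inner ℂ (act Aᴴ u) v := by
  have : act Aᴴ = ContinuousLinearMap.adjoint (act A) := by
    rw [act, ← Matrix.star_eq_conjTranspose, map_star]; rfl
  rw [this, ContinuousLinearMap.adjoint_inner_left]

lemma inner_act_left (A : Matrix (Fin m) (Fin m) ℂ) (u v : Vec m) :
    inner ℂ (act A u) v = inner ℂ u (act Aᴴ v) := by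
  rw [inner_act_right, Matrix.conjTranspose_conjTranspose]

lemma act_basisFun (A : Matrix (Fin m) (Fin m) ℂ) (i j : Fin m) :
    act A (EuclideanSpace.basisFun (Fin m) ℂ j) i = A i j := by
  simp [act, EuclideanSpace.basisFun_apply]

lemma inner_basisFun_act (A : Matrix (Fin m) (Fin m) ℂ) (i j : Fin m) :
    inner ℂ (EuclideanSpace.basisFun (Fin m) ℂ i) (act A (EuclideanSpace.basisFun (Fin m) ℂ j))
      = A i j := by
  rw [← OrthonormalBasis.repr_apply_apply, EuclideanSpace.basisFun_repr, act_basisFun]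

lemma trace_eq_sum_inner (A : Matrix (Fin m) (Fin m) ℂ) :
    A.trace = ∑ i, inner ℂ (EuclideanSpace.basisFun (Fin m) ℂ i)
      (act A (EuclideanSpace.basisFun (Fin m) ℂ i)) := by
  simp_rw [inner_basisFun_act]; rfl

lemma hsSq_nonneg (A : Matrix (Fin m) (Fin m) ℂ) : 0 ≤ hsSq A := by
  unfold hsSq; positivity

lemma hsSq_conjTranspose (A : Matrix (Fin m) (Fin m) ℂ) : hsSq Aᴴ = hsSq A := by
  unfold hsSq
  rw [Finset.sum_comm]
  simp [Matrix.conjTranspose_apply]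

lemma hsSq_eq_sum_basisFun (A : Matrix (Fin m) (Fin m) ℂ) :
    hsSq A = ∑ j, ‖act A (EuclideanSpace.basisFun (Fin m) ℂ j)‖ ^ 2 := by
  simp_rw [EuclideanSpace.norm_sq_eq, act_basisFun]
  rw [Finset.sum_comm]; rfl

/-- Parseval in both bases turns the sum for A in one basis into the sum for its adjoint in another,
so the basis does not matter. -/
lemma hsSq_eq_sum (A : Matrix (Fin m) (Fin m) ℂ) {ι : Type*} [Fintype ι]
    (b : OrthonormalBasis ι ℂ (Vec m)) : hsSq A = ∑ i, ‖act A (b i)‖ ^ 2 := by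
  rw [← hsSq_conjTranspose, hsSq_eq_sum_basisFun]
  have h1 : ∀ j, ‖act Aᴴ (EuclideanSpace.basisFun (Fin m) ℂ j)‖ ^ 2 =
      ∑ i, ‖inner ℂ (b i) (act Aᴴ (EuclideanSpace.basisFun (Fin m) ℂ j))‖ ^ 2 := fun j =>
    (b.sum_sq_norm_inner_right _).symm
  have h2 : ∀ i, ‖act A (b i)‖ ^ 2 =
      ∑ j, ‖inner ℂ (EuclideanSpace.basisFun (Fin m) ℂ j) (act A (b i))‖ ^ 2 := fun i =>
    (OrthonormalBasis.sum_sq_norm_inner_right _ _).symm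
  simp_rw [h1, h2]
  rw [Finset.sum_comm]
  refine Finset.sum_congr rfl fun i _ => Finset.sum_congr rfl fun j _ => ?_
  rw [← inner_act_left, norm_inner_symm]

lemma hsSq_eq_trace (A : Matrix (Fin m) (Fin m) ℂ) : hsSq A = (Aᴴ * A).trace.re := by
  rw [hsSq_eq_sum_basisFun, trace_eq_sum_inner, Complex.re_sum]
  refine Finset.sum_congr rfl fun i _ => ?_
  rw [act_mul, ← inner_act_left, inner_self_eq_norm_sq_to_K]
  norm_cast

lemma norm_act_sq_le (A : Matrix (Fin m) (Fin m) ℂ) (v : Vec m) :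
    ‖act A v‖ ^ 2 ≤ hsSq A * ‖v‖ ^ 2 := by
  rw [← hsSq_conjTranspose, hsSq_eq_sum_basisFun,
    ← OrthonormalBasis.sum_sq_norm_inner_right (EuclideanSpace.basisFun (Fin m) ℂ), Finset.sum_mul]
  refine Finset.sum_le_sum fun i _ => ?_
  rw [inner_act_right, ← mul_pow]
  exact pow_le_pow_left₀ (norm_nonneg _) (norm_inner_le_norm _ _) 2

/-! ### Singular values -/

lemma trace_cfc {B : Matrix (Fin m) (Fin m) ℂ} (hB : B.IsHermitian) (f : ℝ → ℝ) :
    (cfc f B).trace = ∑ i, (f (hB.eigenvalues i) : ℂ) := by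
  rw [hB.cfc_eq, Matrix.IsHermitian.cfc, Matrix.trace_map']
  simp [Matrix.trace]

lemma act_eigenvectorBasis {B : Matrix (Fin m) (Fin m) ℂ} (hB : B.IsHermitian) (i : Fin m) :
    act B (hB.eigenvectorBasis i) = (hB.eigenvalues i : ℂ) • hB.eigenvectorBasis i := by
  ext j
  have := congrFun (hB.mulVec_eigenvectorBasis i) j
  simpa [act] using this

/-- Singular value decomposition, with the trace of the modulus and of its spectral projections
expressed through the singular values. -/
lemma exists_svd (A : Matrix (Fin m) (Fin m) ℂ) :
    ∃ (v w : OrthonormalBasis (Fin m) ℂ (Vec m)) (s : Fin m → ℝ), (∀ i, 0 ≤ s i) ∧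
      (∀ i, act A (v i) = (s i : ℂ) • w i) ∧ trAbs A = ENNReal.ofReal (∑ i, s i) ∧
      ∀ t, trLevel t A = ((Finset.univ.filter fun i => t < s i).card : ℝ≥0∞) := by
  have hB : (Aᴴ * A).IsHermitian := Matrix.isHermitian_conjTranspose_mul_self A
  have hpos : (Aᴴ * A).PosSemidef := Matrix.posSemidef_conjTranspose_mul_self A
  set μ := hB.eigenvalues with hμ
  have hμ0 : ∀ i, 0 ≤ μ i := hpos.eigenvalues_nonneg
  set v := hB.eigenvectorBasis
  have hv : ∀ i, act (Aᴴ * A) (v i) = (μ i : ℂ) • v i := act_eigenvectorBasis hB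
  have hinner : ∀ i j, inner ℂ (act A (v i)) (act A (v j)) = if i = j then (μ j : ℂ) else 0 := by
    intro i j
    rw [inner_act_left, ← act_mul, hv, inner_smul_right, OrthonormalBasis.inner_eq_ite]
    simp
  have hz : ∀ i, μ i = 0 → act A (v i) = 0 := by
    intro i hi
    have := hinner i i
    rw [if_pos rfl, hi] at this
    simpa using this
  -- The left singular vectors are the normalised images of the eigenvectors of A*A. They exist only
  -- where the eigenvalue is nonzero, and the family is completed to a basis arbitrarily.
  have hon : Orthonormal ℂ (({i | μ i ≠ 0} : Set (Fin m)).domRestrict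
      fun i => ((Real.sqrt (μ i))⁻¹ : ℂ) • act A (v i)) := by
    rw [orthonormal_iff_ite]
    rintro ⟨i, hi⟩ ⟨j, hj⟩
    simp only [Set.domRestrict_apply, inner_smul_left, inner_smul_right, hinner, Subtype.mk.injEq]
    split_ifs with h
    · subst h
      have h1 : ((Real.sqrt (μ i) : ℝ) : ℂ) ≠ 0 := by
        simpa [Real.sqrt_eq_zero (hμ0 i)] using hi
      have h2 : (μ i : ℂ) = (Real.sqrt (μ i) : ℂ) * (Real.sqrt (μ i) : ℂ) := by
        norm_cast; exact (Real.mul_self_sqrt (hμ0 i)).symm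
      rw [h2]
      simp only [map_inv₀, Complex.conj_ofReal]
      field_simp
    · simp
  obtain ⟨w, hw⟩ := hon.exists_orthonormalBasis_extension_of_card_eq (by simp)
  refine ⟨v, w, fun i => Real.sqrt (μ i), fun i => Real.sqrt_nonneg _, fun i => ?_, ?_, fun t => ?_⟩
  · by_cases hi : μ i = 0
    · simp [hz i hi, hi]
    · rw [hw i hi, smul_smul, mul_inv_cancel₀, one_smul]
      simpa [Real.sqrt_eq_zero (hμ0 i)] using hi
  · rw [trAbs, modulus, trace_cfc hB]
    norm_cast
  -- The spectrum is finite, so the discontinuous indicator is admissible in the composition rule of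
  -- the functional calculus.
  · have hfin : (Real.sqrt '' spectrum ℝ (Aᴴ * A)).Finite :=
      (Matrix.finite_real_spectrum (A := Aᴴ * A)).image _
    rw [trLevel, levelProj, modulus,
      ← cfc_comp ((Set.Ioi t).indicator fun _ => (1 : ℝ)) Real.sqrt (Aᴴ * A) hB.isSelfAdjoint
        (hfin.continuousOn _) ((Matrix.finite_real_spectrum (A := Aᴴ * A)).continuousOn _),
      trace_cfc hB]
    rw [← Complex.ofReal_sum, Complex.ofReal_re]
    simp only [Function.comp_apply, Set.indicator_apply, Set.mem_Ioi]
    rw [Finset.sum_ite, Finset.sum_const_zero, add_zero, Finset.sum_const, nsmul_eq_mul, mul_one,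
      ENNReal.ofReal_natCast]

/-- Courant-Fischer, upper bound. -/
lemma trLevel_add_finrank_le {A : Matrix (Fin m) (Fin m) ℂ} {t : ℝ} (ht : 0 ≤ t)
    (W : Submodule ℂ (Vec m)) (hW : ∀ x ∈ W, ‖act A x‖ ≤ t * ‖x‖) :
    trLevel t A + (Module.finrank ℂ W : ℝ≥0∞) ≤ m := by
  obtain ⟨v, w, s, hs, hA, -, hl⟩ := exists_svd A
  rw [hl]
  set I := Finset.univ.filter fun i => t < s i with hI
  set U : Submodule ℂ (Vec m) := Submodule.span ℂ (Set.range fun i : I => v i) with hU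
  have hUdim : Module.finrank ℂ U = I.card := by
    rw [hU, finrank_span_eq_card]
    · simp
    · exact v.orthonormal.linearIndependent.comp _ Subtype.val_injective
  -- On U only singular values above t occur. Comparing the expansions of ‖Ax‖² and t²‖x‖² termwise,
  -- equality is forced and every coefficient of x vanishes.
  have hdisj : Disjoint U W := by
    rw [Submodule.disjoint_def]
    intro x hxU hxW
    have hx0 : ∀ i ∉ I, inner ℂ (v i) x = 0 := by
      intro i hi
      have : U ≤ (ℂ ∙ v i)ᗮ := by
        rw [hU, Submodule.span_le]
        rintro _ ⟨j, rfl⟩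
        rw [SetLike.mem_coe, Submodule.mem_orthogonal_singleton_iff_inner_right]
        rw [OrthonormalBasis.inner_eq_ite, if_neg]
        rintro rfl
        exact hi j.2
      exact Submodule.mem_orthogonal_singleton_iff_inner_right.1 (this hxU)
    have hAx : ‖act A x‖ ^ 2 = ∑ i, s i ^ 2 * ‖inner ℂ (v i) x‖ ^ 2 := by
      rw [← OrthonormalBasis.sum_sq_norm_inner_right w]
      refine Finset.sum_congr rfl fun i _ => ?_
      conv_lhs => rw [← v.sum_repr' x]
      rw [map_sum, inner_sum]
      simp_rw [map_smul, hA, inner_smul_right, OrthonormalBasis.inner_eq_ite]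
      simp [mul_pow, mul_comm]
    have h1 := pow_le_pow_left₀ (norm_nonneg _) (hW x hxW) 2
    rw [hAx, mul_pow, ← OrthonormalBasis.sum_sq_norm_inner_right v, Finset.mul_sum] at h1
    have hterm : ∀ i, t ^ 2 * ‖inner ℂ (v i) x‖ ^ 2 ≤ s i ^ 2 * ‖inner ℂ (v i) x‖ ^ 2 := by
      intro i
      by_cases hi : i ∈ I
      · have : t < s i := (Finset.mem_filter.1 hi).2
        gcongr
      · simp [hx0 i hi]
    have heq := (Finset.sum_eq_sum_iff_of_le fun i _ => hterm i).1
      (le_antisymm (Finset.sum_le_sum fun i _ => hterm i) h1)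
    have hall : ∀ i, inner ℂ (v i) x = 0 := by
      intro i
      by_cases hi : i ∈ I
      · have h2 : t < s i := (Finset.mem_filter.1 hi).2
        have h3 := heq i (Finset.mem_univ _)
        by_contra h4
        have h5 : 0 < ‖inner ℂ (v i) x‖ ^ 2 := by positivity
        have h6 : t ^ 2 = s i ^ 2 := mul_right_cancel₀ h5.ne' h3
        nlinarith
      · exact hx0 i hi
    rw [← v.sum_repr' x]
    simp [hall]
  have := Submodule.finrank_add_finrank_le_of_disjoint hdisj
  rw [hUdim] at this
  simp only [finrank_euclideanSpace, Fintype.card_fin] at this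
  exact_mod_cast this

/-- Courant-Fischer: the upper bound is attained. -/
lemma exists_trLevel_add_finrank_eq (A : Matrix (Fin m) (Fin m) ℂ) {t : ℝ} :
    ∃ W : Submodule ℂ (Vec m), (∀ x ∈ W, ‖act A x‖ ≤ t * ‖x‖) ∧
      trLevel t A + (Module.finrank ℂ W : ℝ≥0∞) = m := by
  obtain ⟨v, w, s, hs, hA, -, hl⟩ := exists_svd A
  rw [hl]
  set I := Finset.univ.filter fun i => t < s i with hI
  set U : Submodule ℂ (Vec m) := Submodule.span ℂ (Set.range fun i : (Iᶜ : Finset _) => v i) with hU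
  have hUdim : Module.finrank ℂ U = (Iᶜ).card := by
    rw [hU, finrank_span_eq_card]
    · exact Fintype.card_coe _
    · exact v.orthonormal.linearIndependent.comp _ Subtype.val_injective
  refine ⟨U, fun x hxU => ?_, ?_⟩
  · have hx0 : ∀ i ∈ I, inner ℂ (v i) x = 0 := by
      intro i hi
      have : U ≤ (ℂ ∙ v i)ᗮ := by
        rw [hU, Submodule.span_le]
        rintro _ ⟨j, rfl⟩
        rw [SetLike.mem_coe, Submodule.mem_orthogonal_singleton_iff_inner_right]
        rw [OrthonormalBasis.inner_eq_ite, if_neg]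
        rintro rfl
        exact Finset.mem_compl.1 j.2 hi
      exact Submodule.mem_orthogonal_singleton_iff_inner_right.1 (this hxU)
    have hAx : ‖act A x‖ ^ 2 = ∑ i, s i ^ 2 * ‖inner ℂ (v i) x‖ ^ 2 := by
      rw [← OrthonormalBasis.sum_sq_norm_inner_right w]
      refine Finset.sum_congr rfl fun i _ => ?_
      conv_lhs => rw [← v.sum_repr' x]
      rw [map_sum, inner_sum]
      simp_rw [map_smul, hA, inner_smul_right, OrthonormalBasis.inner_eq_ite]
      simp [mul_pow, mul_comm]
    -- The sign of t is not assumed: an index outside I gives 0 ≤ s i₀ ≤ t, and without such an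
    -- index the space is zero.
    by_cases ht : ∃ i, i ∉ I
    · obtain ⟨i₀, hi₀⟩ := ht
      have ht0 : 0 ≤ t := by
        have : ¬ t < s i₀ := fun h => hi₀ (Finset.mem_filter.2 ⟨Finset.mem_univ _, h⟩)
        exact (hs i₀).trans (not_lt.1 this)
      refine le_of_sq_le_sq ?_ (by positivity)
      rw [hAx, mul_pow, ← OrthonormalBasis.sum_sq_norm_inner_right v, Finset.mul_sum]
      refine Finset.sum_le_sum fun i _ => ?_
      by_cases hi : i ∈ I
      · simp [hx0 i hi]
      · have : ¬ t < s i := fun h => hi (Finset.mem_filter.2 ⟨Finset.mem_univ _, h⟩)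
        have := hs i
        gcongr
        linarith
    · push Not at ht
      have : x = 0 := by
        rw [← v.sum_repr' x]
        simp [fun i => hx0 i (ht i)]
      simp [this]
  · have := Finset.card_add_card_compl I
    rw [Fintype.card_fin] at this
    rw [hUdim]
    exact_mod_cast this

lemma trLevel_le (A : Matrix (Fin m) (Fin m) ℂ) (t : ℝ) : trLevel t A ≤ m := by
  obtain ⟨W, -, h⟩ := exists_trLevel_add_finrank_eq A (t := t)
  exact h ▸ le_self_add

lemma trLevel_eq_zero {A : Matrix (Fin m) (Fin m) ℂ} {t : ℝ} (ht : 0 ≤ t)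
    (h : ∀ x, ‖act A x‖ ≤ t * ‖x‖) : trLevel t A = 0 := by
  have := trLevel_add_finrank_le ht ⊤ (fun x _ => h x)
  rw [finrank_top, finrank_euclideanSpace, Fintype.card_fin] at this
  have h2 : trLevel t A + (m : ℝ≥0∞) ≤ 0 + m := by simpa using this
  exact le_antisymm ((ENNReal.add_le_add_iff_right (by simp)).1 h2) zero_le

/-- On the intersection of the extremal subspaces of A and B the sum is bounded by s + t, and the
codimension of an intersection is at most the sum of the codimensions. -/
lemma trLevel_add_le (A B : Matrix (Fin m) (Fin m) ℂ) {s t : ℝ} (hs : 0 ≤ s) (ht : 0 ≤ t) :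
    trLevel (s + t) (A + B) ≤ trLevel s A + trLevel t B := by
  obtain ⟨W₁, h₁, e₁⟩ := exists_trLevel_add_finrank_eq A (t := s)
  obtain ⟨W₂, h₂, e₂⟩ := exists_trLevel_add_finrank_eq B (t := t)
  have h := trLevel_add_finrank_le (A := A + B) (add_nonneg hs ht) (W₁ ⊓ W₂) (fun x hx => by
    rw [act_add, add_mul]
    exact (norm_add_le _ _).trans (add_le_add (h₁ x hx.1) (h₂ x hx.2)))
  have hd := Submodule.finrank_sup_add_finrank_inf_eq W₁ W₂
  have hd' : Module.finrank ℂ ↥(W₁ ⊔ W₂) ≤ m := by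
    simpa using Submodule.finrank_le (W₁ ⊔ W₂)
  have hdim : (Module.finrank ℂ W₁ : ℝ≥0∞) + Module.finrank ℂ W₂ ≤
      m + Module.finrank ℂ ↥(W₁ ⊓ W₂) := by
    exact_mod_cast (by omega)
  have key : trLevel (s + t) (A + B) +
      ((Module.finrank ℂ W₁ : ℝ≥0∞) + Module.finrank ℂ W₂) ≤
      trLevel s A + trLevel t B + ((Module.finrank ℂ W₁ : ℝ≥0∞) + Module.finrank ℂ W₂) := by
    calc _ ≤ trLevel (s + t) (A + B) + (m + Module.finrank ℂ ↥(W₁ ⊓ W₂)) := by gcongr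
      _ = trLevel (s + t) (A + B) + Module.finrank ℂ ↥(W₁ ⊓ W₂) + m := by ring
      _ ≤ m + m := by gcongr
      _ = (trLevel s A + Module.finrank ℂ W₁) + (trLevel t B + Module.finrank ℂ W₂) := by
        rw [e₁, e₂]
      _ = _ := by ring
  exact (ENNReal.add_le_add_iff_right (by simp)).1 key

lemma finrank_range_act (A : Matrix (Fin m) (Fin m) ℂ) :
    Module.finrank ℂ (LinearMap.range (act A).toLinearMap) = A.rank := by
  rw [Matrix.rank_eq_finrank_range_toLin A (EuclideanSpace.basisFun (Fin m) ℂ).toBasis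
    (EuclideanSpace.basisFun (Fin m) ℂ).toBasis]
  rfl

/-- The kernel is the test subspace. This controls the terms near their cube, for which no bound on
the size is available. -/
lemma trLevel_zero_le_rank (A : Matrix (Fin m) (Fin m) ℂ) : trLevel 0 A ≤ A.rank := by
  have h := trLevel_add_finrank_le (A := A) le_rfl (LinearMap.ker (act A).toLinearMap)
    (fun x hx => by
      have : act A x = 0 := hx
      simp [this])
  have h2 := LinearMap.finrank_range_add_finrank_ker (act A).toLinearMap
  rw [finrank_range_act, finrank_euclideanSpace, Fintype.card_fin] at h2
  have h4 : trLevel 0 A + Module.finrank ℂ (LinearMap.ker (act A).toLinearMap) ≤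
      A.rank + Module.finrank ℂ (LinearMap.ker (act A).toLinearMap) := by
    refine h.trans ?_
    exact_mod_cast h2.ge
  exact (ENNReal.add_le_add_iff_right (by simp)).1 h4

lemma trLevel_smul {A : Matrix (Fin m) (Fin m) ℂ} {t : ℝ} (ht : 0 ≤ t) {c : ℂ} (hc : ‖c‖ = 1) :
    trLevel t (c • A) ≤ trLevel t A := by
  obtain ⟨W, h, e⟩ := exists_trLevel_add_finrank_eq A (t := t)
  have h2 := trLevel_add_finrank_le (A := c • A) ht W (fun x hx => by
    rw [act_smul, norm_smul, hc, one_mul]; exact h x hx)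
  rw [← e] at h2
  exact (ENNReal.add_le_add_iff_right (by simp)).1 h2

lemma sq_mul_trLevel_le (A : Matrix (Fin m) (Fin m) ℂ) {t : ℝ} (ht : 0 ≤ t) :
    ENNReal.ofReal (t ^ 2) * trLevel t A ≤ ENNReal.ofReal (hsSq A) := by
  obtain ⟨v, w, s, hs, hA, -, hl⟩ := exists_svd A
  rw [hl, hsSq_eq_sum A v, ← ENNReal.ofReal_natCast, ← ENNReal.ofReal_mul (by positivity)]
  refine ENNReal.ofReal_le_ofReal ?_
  calc t ^ 2 * ((Finset.univ.filter fun i => t < s i).card : ℝ)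
      = ∑ i ∈ Finset.univ.filter fun i => t < s i, t ^ 2 := by simp [mul_comm]
    _ ≤ ∑ i ∈ Finset.univ.filter fun i => t < s i, ‖act A (v i)‖ ^ 2 := by
        refine Finset.sum_le_sum fun i hi => ?_
        have : t < s i := (Finset.mem_filter.1 hi).2
        rw [hA, norm_smul, w.norm_eq_one, mul_one, Complex.norm_real, Real.norm_eq_abs, sq_abs]
        gcongr
    _ ≤ ∑ i, ‖act A (v i)‖ ^ 2 := Finset.sum_le_univ_sum_of_nonneg fun i => by positivity

/-! ### Trace-norm and rank bounds for sums of products -/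

lemma sum_norm_inner_act_mul_le (P Q : Matrix (Fin m) (Fin m) ℂ)
    (v w : OrthonormalBasis (Fin m) ℂ (Vec m)) :
    ∑ i, ‖inner ℂ (w i) (act (P * Q) (v i))‖ ≤ Real.sqrt (hsSq P) * Real.sqrt (hsSq Q) := by
  calc ∑ i, ‖inner ℂ (w i) (act (P * Q) (v i))‖ ≤ ∑ i, ‖act Pᴴ (w i)‖ * ‖act Q (v i)‖ := by
        refine Finset.sum_le_sum fun i _ => ?_
        rw [act_mul, inner_act_right]
        exact norm_inner_le_norm _ _
    _ ≤ _ := by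
        refine (Real.sum_mul_le_sqrt_mul_sqrt _ _ _).trans_eq ?_
        rw [← hsSq_eq_sum, ← hsSq_eq_sum, hsSq_conjTranspose]

/-- Chebyshev's inequality for the singular values; their sum is Σ ⟨w_i, A v_i⟩, which is linear in
A and so splits over the products, each handled by Cauchy-Schwarz. -/
lemma mul_trLevel_sum_le {ι : Type*} (τ : Finset ι) (P Q : ι → Matrix (Fin m) (Fin m) ℂ) {t : ℝ}
    (ht : 0 ≤ t) :
    ENNReal.ofReal t * trLevel t (∑ i ∈ τ, P i * Q i) ≤
      ∑ i ∈ τ, ENNReal.ofReal (Real.sqrt (hsSq (P i)) * Real.sqrt (hsSq (Q i))) := by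
  obtain ⟨v, w, s, hs, hA, -, hl⟩ := exists_svd (∑ i ∈ τ, P i * Q i)
  rw [hl, ← ENNReal.ofReal_natCast, ← ENNReal.ofReal_mul ht,
    ← ENNReal.ofReal_sum_of_nonneg fun i _ => by positivity]
  refine ENNReal.ofReal_le_ofReal ?_
  calc t * ((Finset.univ.filter fun i => t < s i).card : ℝ)
      = ∑ i ∈ Finset.univ.filter fun i => t < s i, t := by simp [mul_comm]
    _ ≤ ∑ i ∈ Finset.univ.filter fun i => t < s i, s i :=
        Finset.sum_le_sum fun i hi => (Finset.mem_filter.1 hi).2.le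
    _ ≤ ∑ i, s i := Finset.sum_le_univ_sum_of_nonneg hs
    _ = ∑ i, ‖inner ℂ (w i) (act (∑ i ∈ τ, P i * Q i) (v i))‖ := by
        refine Finset.sum_congr rfl fun i _ => ?_
        rw [hA, inner_smul_right, OrthonormalBasis.inner_eq_ite, if_pos rfl]
        simp [abs_of_nonneg (hs i)]
    _ ≤ ∑ i, ∑ j ∈ τ, ‖inner ℂ (w i) (act (P j * Q j) (v i))‖ := by
        refine Finset.sum_le_sum fun i _ => ?_
        rw [act_sum, inner_sum]
        exact norm_sum_le _ _
    _ ≤ _ := by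
        rw [Finset.sum_comm]
        exact Finset.sum_le_sum fun j _ => sum_norm_inner_act_mul_le _ _ _ _

lemma rank_add_le (A B : Matrix (Fin m) (Fin m) ℂ) : (A + B).rank ≤ A.rank + B.rank := by
  simp_rw [← finrank_range_act]
  refine le_trans (Submodule.finrank_mono ?_) (Submodule.finrank_add_le_finrank_add_finrank _ _)
  rintro _ ⟨x, rfl⟩
  exact Submodule.mem_sup.2 ⟨_, ⟨x, rfl⟩, _, ⟨x, rfl⟩, (act_add A B x).symm⟩

lemma rank_sum_le {ι : Type*} (τ : Finset ι) (P : ι → Matrix (Fin m) (Fin m) ℂ) :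
    (∑ i ∈ τ, P i).rank ≤ ∑ i ∈ τ, (P i).rank := by
  classical
  induction τ using Finset.induction_on with
  | empty => simp
  | insert a s ha ih =>
    rw [Finset.sum_insert ha, Finset.sum_insert ha]
    exact (rank_add_le _ _).trans (by gcongr)

/-- Level estimate for a sum of products, where some of the terms are only controlled by
their rank. -/
lemma trLevel_sum_le {ι : Type*} (τ : Finset ι) (near : ι → Prop) [DecidablePred near]
    (P Q : ι → Matrix (Fin m) (Fin m) ℂ) {t : ℝ} (ht : 0 < t) :
    trLevel t (∑ i ∈ τ, P i * Q i) ≤ ∑ i ∈ τ, if near i then ((P i * Q i).rank : ℝ≥0∞) else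
      (ENNReal.ofReal t)⁻¹ *
        ENNReal.ofReal (Real.sqrt (hsSq (P i)) * Real.sqrt (hsSq (Q i))) := by
  rw [Finset.sum_ite, ← Finset.sum_filter_add_sum_filter_not τ near, ← Finset.mul_sum]
  -- The near terms are counted at level 0, so the whole height t remains available for the far
  -- terms.
  have h := trLevel_add_le (∑ i ∈ τ.filter near, P i * Q i) (∑ i ∈ τ.filter fun i => ¬ near i, P i * Q i)
    le_rfl ht.le
  rw [zero_add] at h
  refine h.trans (add_le_add ?_ ?_)
  · refine (trLevel_zero_le_rank _).trans ?_
    exact_mod_cast rank_sum_le _ _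
  · rw [mul_comm, ← div_eq_mul_inv, ENNReal.le_div_iff_mul_le (by simp [ht]) (by simp), mul_comm]
    exact mul_trLevel_sum_le _ _ _ ht.le

/-! ### The trace norm -/

/-- One half of trace-norm duality: after expanding in singular vectors, each singular value is
multiplied by a sum of products of two unit sequences, at most 1 by Cauchy-Schwarz. It yields the
triangle inequality. -/
lemma sum_norm_inner_act_le_trAbs (A : Matrix (Fin m) (Fin m) ℂ)
    (v w : OrthonormalBasis (Fin m) ℂ (Vec m)) :
    ENNReal.ofReal (∑ i, ‖inner ℂ (w i) (act A (v i))‖) ≤ trAbs A := by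
  obtain ⟨v', w', s, hs, hA, htr, -⟩ := exists_svd A
  rw [htr]
  refine ENNReal.ofReal_le_ofReal ?_
  have hexp : ∀ i, inner ℂ (w i) (act A (v i)) =
      ∑ j, (s j : ℂ) * (inner ℂ (v' j) (v i) * inner ℂ (w i) (w' j)) := by
    intro i
    conv_lhs => rw [← v'.sum_repr' (v i)]
    rw [map_sum, inner_sum]
    refine Finset.sum_congr rfl fun j _ => ?_
    rw [map_smul, hA, inner_smul_right, inner_smul_right]; ring
  calc ∑ i, ‖inner ℂ (w i) (act A (v i))‖
      ≤ ∑ i, ∑ j, s j * (‖inner ℂ (v' j) (v i)‖ * ‖inner ℂ (w i) (w' j)‖) := by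
        refine Finset.sum_le_sum fun i _ => ?_
        rw [hexp]
        refine (norm_sum_le _ _).trans_eq (Finset.sum_congr rfl fun j _ => ?_)
        rw [norm_mul, norm_mul, Complex.norm_real, Real.norm_of_nonneg (hs j)]
    _ = ∑ j, s j * ∑ i, ‖inner ℂ (v' j) (v i)‖ * ‖inner ℂ (w i) (w' j)‖ := by
        rw [Finset.sum_comm]; simp_rw [Finset.mul_sum]
    _ ≤ ∑ j, s j * 1 := by
        gcongr with j _
        · exact hs j
        · refine (Real.sum_mul_le_sqrt_mul_sqrt _ _ _).trans_eq ?_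
          rw [OrthonormalBasis.sum_sq_norm_inner_right, OrthonormalBasis.sum_sq_norm_inner_left]
          simp
    _ = _ := by simp

lemma trAbs_add_le (A B : Matrix (Fin m) (Fin m) ℂ) :
    trAbs (A + B) ≤ trAbs A + trAbs B := by
  obtain ⟨v, w, s, hs, hA, htr, -⟩ := exists_svd (A + B)
  calc trAbs (A + B)
      = ENNReal.ofReal (∑ i, ‖inner ℂ (w i) (act (A + B) (v i))‖) := by
        rw [htr]; congr 1
        refine Finset.sum_congr rfl fun i _ => ?_
        rw [hA, inner_smul_right, OrthonormalBasis.inner_eq_ite, if_pos rfl]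
        simp [abs_of_nonneg (hs i)]
    _ ≤ ENNReal.ofReal (∑ i, ‖inner ℂ (w i) (act A (v i))‖ +
          ∑ i, ‖inner ℂ (w i) (act B (v i))‖) := by
        refine ENNReal.ofReal_le_ofReal ?_
        rw [← Finset.sum_add_distrib]
        refine Finset.sum_le_sum fun i _ => ?_
        rw [act_add, inner_add_right]
        exact norm_add_le _ _
    _ ≤ _ := by
        rw [ENNReal.ofReal_add (by positivity) (by positivity)]
        exact add_le_add (sum_norm_inner_act_le_trAbs A v w) (sum_norm_inner_act_le_trAbs B v w)

lemma trAbs_le_sum_entries (A : Matrix (Fin m) (Fin m) ℂ) :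
    trAbs A ≤ m * ∑ i, ∑ j, ‖A i j‖ₑ := by
  obtain ⟨v, w, s, hs, hA, htr, -⟩ := exists_svd A
  have hle : Real.sqrt (hsSq A) ≤ ∑ i, ∑ j, ‖A i j‖ := by
    refine Real.sqrt_le_iff.2 ⟨by positivity, ?_⟩
    unfold hsSq
    refine (Finset.sum_le_sum fun i _ =>
      Finset.sum_sq_le_sq_sum_of_nonneg fun j _ => norm_nonneg _).trans ?_
    exact Finset.sum_sq_le_sq_sum_of_nonneg fun j _ => by positivity
  have hsi : ∀ i, s i ≤ ∑ i, ∑ j, ‖A i j‖ := by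
    intro i
    refine le_trans ?_ hle
    refine Real.le_sqrt_of_sq_le ?_
    have := norm_act_sq_le A (v i)
    rwa [hA, norm_smul, w.norm_eq_one, v.norm_eq_one, mul_one, one_pow, mul_one, Complex.norm_real,
      Real.norm_eq_abs, sq_abs] at this
  rw [htr]
  calc ENNReal.ofReal (∑ i, s i) ≤ ENNReal.ofReal (∑ _i : Fin m, ∑ i, ∑ j, ‖A i j‖) :=
        ENNReal.ofReal_le_ofReal (Finset.sum_le_sum fun i _ => hsi i)
    _ = _ := by
        rw [Finset.sum_const, Finset.card_univ, Fintype.card_fin, nsmul_eq_mul,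
          ENNReal.ofReal_mul (by positivity), ENNReal.ofReal_natCast,
          ENNReal.ofReal_sum_of_nonneg fun i _ => by positivity]
        congr 1
        refine Finset.sum_congr rfl fun i _ => ?_
        rw [ENNReal.ofReal_sum_of_nonneg fun i _ => by positivity]
        simp

lemma trLevel_eq_zero_of_entries {A : Matrix (Fin m) (Fin m) ℂ} {t : ℝ} (ht : 0 ≤ t)
    (h : ∀ i j, ‖A i j‖ ≤ t / m) : trLevel t A = 0 := by
  refine trLevel_eq_zero ht fun x => ?_
  refine le_of_sq_le_sq ?_ (by positivity)
  refine (norm_act_sq_le A x).trans ?_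
  rw [mul_pow]
  gcongr
  unfold hsSq
  calc ∑ i, ∑ j, ‖A i j‖ ^ 2 ≤ ∑ _i : Fin m, ∑ _j : Fin m, (t / m) ^ 2 := by
        gcongr with i _ j _; exact h i j
    _ ≤ t ^ 2 := by
        rcases Nat.eq_zero_or_pos m with rfl | hm
        · simp; positivity
        · have : (m : ℝ) ≠ 0 := by positivity
          simp only [Finset.sum_const, Finset.card_univ, Fintype.card_fin, nsmul_eq_mul]
          apply le_of_eq
          field_simp

/-- Every matrix is a combination of four positive semidefinite ones of no larger trace norm. -/
lemma exists_posSemidef_decomposition (A : Matrix (Fin m) (Fin m) ℂ) :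
    ∃ P : Fin 4 → Matrix (Fin m) (Fin m) ℂ, (∀ k, (P k).PosSemidef) ∧
      A = ∑ k : Fin 4, Complex.I ^ (k : ℕ) • P k ∧
      ∀ k, ENNReal.ofReal (P k).trace.re ≤ trAbs A := by
  obtain ⟨v, w, s, hs, hA, htr, -⟩ := exists_svd A
  -- Polarisation: 4 w v* = Σ_k i^k (w + i^k v)(w + i^k v)*. The factor 1/4 offsets ‖w + i^k v‖² ≤ 4
  -- in the trace bound.
  let z : Fin 4 → Fin m → Fin m → ℂ := fun k i => (w i).ofLp + Complex.I ^ (k : ℕ) • (v i).ofLp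
  let P : Fin 4 → Matrix (Fin m) (Fin m) ℂ := fun k =>
    ∑ i, (s i / 4) • Matrix.vecMulVec (z k i) (star (z k i))
  have hAeq : A = ∑ i, (s i) • Matrix.vecMulVec (w i).ofLp (star (v i).ofLp) := by
    have : act A = act (∑ i, (s i) • Matrix.vecMulVec (w i).ofLp (star (v i).ofLp)) := by
      ext1 x
      conv_lhs => rw [← v.sum_repr' x]
      rw [map_sum, act_sum]
      refine Finset.sum_congr rfl fun i _ => ?_
      rw [map_smul, hA]
      ext j
      simp [act, Matrix.smul_mulVec, Matrix.vecMulVec_mulVec, EuclideanSpace.inner_eq_star_dotProduct,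
        dotProduct_comm]
      ring
    exact (Matrix.toEuclideanCLM (n := Fin m) (𝕜 := ℂ)).injective this
  refine ⟨P, fun k => ?_, ?_, fun k => ?_⟩
  · refine Matrix.posSemidef_sum _ fun i _ => ?_
    refine (Matrix.posSemidef_vecMulVec_self_star (z k i)).smul ?_
    have := hs i
    positivity
  · conv_lhs => rw [hAeq]
    simp only [P, Finset.smul_sum]
    rw [Finset.sum_comm]
    refine Finset.sum_congr rfl fun i _ => ?_
    ext a b
    simp only [Fin.sum_univ_four, z, Matrix.add_apply, Matrix.smul_apply, Matrix.vecMulVec_apply,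
      Pi.add_apply, Pi.smul_apply, Pi.star_apply, star_add, star_smul, smul_eq_mul,
      Complex.real_smul, Fin.val_zero, Fin.val_one, Fin.val_two]
    have h3 : ((3 : Fin 4) : ℕ) = 3 := rfl
    have hI2 : Complex.I ^ 2 = -1 := Complex.I_sq
    have hI3 : Complex.I ^ 3 = -Complex.I := Complex.I_pow_three
    rw [h3, hI2, hI3]
    simp only [pow_zero, pow_one, star_neg, star_one, RCLike.star_def, Complex.conj_I]
    push_cast
    ring_nf
    rw [hI2]
    ring
  · rw [htr]
    refine ENNReal.ofReal_le_ofReal ?_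
    simp only [P, Matrix.trace_sum, Complex.re_sum]
    refine Finset.sum_le_sum fun i _ => ?_
    rw [Matrix.trace_smul, Matrix.trace_vecMulVec, Complex.smul_re]
    have h1 : (z k i ⬝ᵥ star (z k i)).re = ‖w i + Complex.I ^ (k : ℕ) • v i‖ ^ 2 := by
      rw [← Complex.ofReal_re (‖w i + Complex.I ^ (k : ℕ) • v i‖ ^ 2), Complex.ofReal_pow]
      have := inner_self_eq_norm_sq_to_K (𝕜 := ℂ) (w i + Complex.I ^ (k : ℕ) • v i)
      rw [EuclideanSpace.inner_eq_star_dotProduct] at this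
      simp only [Complex.coe_algebraMap] at this
      rw [← this]; rfl
    rw [h1]
    have h2 : ‖w i + Complex.I ^ (k : ℕ) • v i‖ ≤ 2 := by
      refine (norm_add_le _ _).trans ?_
      rw [norm_smul, w.norm_eq_one, v.norm_eq_one]
      simp
      norm_num
    have h3 := hs i
    have h4 : ‖w i + Complex.I ^ (k : ℕ) • v i‖ ^ 2 ≤ 4 := by nlinarith [norm_nonneg (w i + Complex.I ^ (k : ℕ) • v i)]
    rw [smul_eq_mul]
    nlinarith

end

/-! ### One by one matrices -/

section Scalar

lemma singular_value_one_by_one (A : Matrix (Fin 1) (Fin 1) ℂ) (x : Vec 1) :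
    ‖act A x‖ = ‖A 0 0‖ * ‖x‖ := by
  simp [act, EuclideanSpace.norm_eq, Matrix.mulVec, dotProduct, Real.sqrt_sq_eq_abs]

lemma trAbs_one_by_one (A : Matrix (Fin 1) (Fin 1) ℂ) : trAbs A = ‖A 0 0‖ₑ := by
  obtain ⟨v, w, s, hs, hA, htr, -⟩ := exists_svd A
  rw [htr, Fin.sum_univ_one, ← ofReal_norm]
  congr 1
  have := singular_value_one_by_one A (v 0)
  rwa [hA, norm_smul, w.norm_eq_one, v.norm_eq_one, mul_one, mul_one, Complex.norm_real,
    Real.norm_of_nonneg (hs 0)] at this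

lemma trLevel_one_by_one (A : Matrix (Fin 1) (Fin 1) ℂ) (t : ℝ) :
    trLevel t A = if t < ‖A 0 0‖ then 1 else 0 := by
  obtain ⟨v, w, s, hs, hA, -, hl⟩ := exists_svd A
  have := singular_value_one_by_one A (v 0)
  rw [hA, norm_smul, w.norm_eq_one, v.norm_eq_one, mul_one, mul_one, Complex.norm_real,
    Real.norm_of_nonneg (hs 0)] at this
  rw [hl, ← this, Finset.card_filter, Fin.sum_univ_one]
  split_ifs <;> simp

end Scalar

/-! ### Quadratic forms -/

/-- The quadratic form of a matrix. -/
noncomputable def qf {m : ℕ} (A : Matrix (Fin m) (Fin m) ℂ) (v : Vec m) : ℝ :=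
  (inner ℂ v (act A v)).re

section

variable {m : ℕ}

lemma qf_add (A B : Matrix (Fin m) (Fin m) ℂ) (v : Vec m) : qf (A + B) v = qf A v + qf B v := by
  simp [qf, act_add]

lemma qf_sub (A B : Matrix (Fin m) (Fin m) ℂ) (v : Vec m) : qf (A - B) v = qf A v - qf B v := by
  simp [qf, act_sub]

lemma qf_sum {ι : Type*} (s : Finset ι) (A : ι → Matrix (Fin m) (Fin m) ℂ) (v : Vec m) :
    qf (∑ i ∈ s, A i) v = ∑ i ∈ s, qf (A i) v := by
  simp [qf, act_sum]

lemma qf_smul (c : ℝ) (A : Matrix (Fin m) (Fin m) ℂ) (v : Vec m) :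
    qf ((c : ℂ) • A) v = c * qf A v := by
  rw [qf, act_smul, inner_smul_right, Complex.re_ofReal_mul, qf]

lemma qf_one (v : Vec m) : qf 1 v = ‖v‖ ^ 2 := by
  rw [qf, act_one, inner_self_eq_norm_sq_to_K]
  norm_cast

lemma qf_conj {p : Matrix (Fin m) (Fin m) ℂ} (hp : pᴴ = p) (A : Matrix (Fin m) (Fin m) ℂ)
    (v : Vec m) : qf (p * A * p) v = qf A (act p v) := by
  rw [qf, qf, mul_assoc, act_mul, inner_act_right, hp, act_mul]

lemma trace_re_eq_sum_qf (A : Matrix (Fin m) (Fin m) ℂ) :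
    A.trace.re = ∑ i, qf A (EuclideanSpace.basisFun (Fin m) ℂ i) := by
  rw [trace_eq_sum_inner, Complex.re_sum]; rfl

open scoped MatrixOrder in
lemma exists_inner_act_eq {G : Matrix (Fin m) (Fin m) ℂ} (hG : G.PosSemidef) :
    ∃ C : Matrix (Fin m) (Fin m) ℂ, G = Cᴴ * C ∧
      ∀ u v, inner ℂ u (act G v) = inner ℂ (act C u) (act C v) := by
  obtain ⟨C, rfl⟩ := CStarAlgebra.nonneg_iff_eq_star_mul_self.1 hG.nonneg
  refine ⟨C, rfl, fun u v => ?_⟩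
  rw [Matrix.star_eq_conjTranspose, act_mul, inner_act_right, Matrix.conjTranspose_conjTranspose]

lemma qf_nonneg {G : Matrix (Fin m) (Fin m) ℂ} (hG : G.PosSemidef) (v : Vec m) : 0 ≤ qf G v := by
  obtain ⟨C, -, hC⟩ := exists_inner_act_eq hG
  rw [qf, hC, inner_self_eq_norm_sq_to_K, ← RCLike.ofReal_pow]
  exact sq_nonneg ‖act C v‖

lemma norm_inner_act_le {G : Matrix (Fin m) (Fin m) ℂ} (hG : G.PosSemidef) (u v : Vec m) :
    ‖inner ℂ u (act G v)‖ ≤ Real.sqrt (qf G u) * Real.sqrt (qf G v) := by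
  obtain ⟨C, -, hC⟩ := exists_inner_act_eq hG
  have h : ∀ u, qf G u = ‖act C u‖ ^ 2 := fun u => by
    rw [qf, hC, inner_self_eq_norm_sq_to_K]; norm_cast
  rw [hC, h, h, Real.sqrt_sq (norm_nonneg _), Real.sqrt_sq (norm_nonneg _)]
  exact norm_inner_le_norm _ _

/-- Cauchy-Schwarz for F and for G, then for the resulting two-term sum. It makes f minus its
average, which has no sign, tractable through the positive form of f plus its average. -/
lemma norm_inner_act_sub_le {F G : Matrix (Fin m) (Fin m) ℂ} (hF : F.PosSemidef)
    (hG : G.PosSemidef) (u v : Vec m) :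
    ‖inner ℂ u (act (F - G) v)‖ ≤ Real.sqrt (qf (F + G) u) * Real.sqrt (qf (F + G) v) := by
  rw [act_sub, inner_sub_right, qf_add, qf_add]
  refine (norm_sub_le _ _).trans
    ((add_le_add (norm_inner_act_le hF u v) (norm_inner_act_le hG u v)).trans ?_)
  rw [← Real.sqrt_mul (add_nonneg (qf_nonneg hF u) (qf_nonneg hG u))]
  refine Real.le_sqrt_of_sq_le ?_
  have h1 := Real.sq_sqrt (qf_nonneg hF u)
  have h2 := Real.sq_sqrt (qf_nonneg hF v)
  have h3 := Real.sq_sqrt (qf_nonneg hG u)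
  have h4 := Real.sq_sqrt (qf_nonneg hG v)
  rw [← h1, ← h2, ← h3, ← h4]
  simp only [Real.sqrt_sq (Real.sqrt_nonneg _)]
  nlinarith [sq_nonneg (Real.sqrt (qf F u) * Real.sqrt (qf G v) -
    Real.sqrt (qf G u) * Real.sqrt (qf F v))]

/-- Hilbert-Schmidt bound for a combination of compressions `p B r`: the scalar coefficients are
absorbed on the side of `p`, the other side only enters through an operator bound. -/
lemma hsSq_sum_smul_le {ι : Type*} (s : Finset ι) (κ : ι → ℂ)
    (B G : ι → Matrix (Fin m) (Fin m) ℂ)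
    (hBG : ∀ b ∈ s, ∀ u v, ‖inner ℂ u (act (B b) v)‖ ≤
      Real.sqrt (qf (G b) u) * Real.sqrt (qf (G b) v))
    (hG : ∀ b ∈ s, (G b).PosSemidef) {p r : Matrix (Fin m) (Fin m) ℂ} (hp : pᴴ = p) {M : ℝ}
    (hM : ∀ v, ∑ b ∈ s, qf (G b) (act r v) ≤ M * ‖v‖ ^ 2) (hM0 : 0 ≤ M) :
    hsSq (∑ b ∈ s, κ b • (p * B b * r)) ≤ ∑ b ∈ s, M * (p * G b * p).trace.re * ‖κ b‖ ^ 2 := by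
  set X := ∑ b ∈ s, κ b • (p * B b * r) with hX
  have key : ∀ u, ‖act Xᴴ u‖ ^ 2 ≤ ∑ b ∈ s, M * qf (G b) (act p u) * ‖κ b‖ ^ 2 := by
    intro u
    set v := act Xᴴ u with hv
    set S := ∑ b ∈ s, (‖κ b‖ * Real.sqrt (qf (G b) (act p u))) ^ 2 with hS
    -- Test X*u against itself. Cauchy-Schwarz in b leaves the coefficients with the vector p u,
    -- while the factor with r v is absorbed by the operator bound M; dividing by ‖v‖ then gives the
    -- claim.
    have h1 : ‖v‖ ^ 2 ≤ Real.sqrt S * (Real.sqrt M * ‖v‖) := by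
      calc ‖v‖ ^ 2 = ‖inner ℂ v v‖ := by rw [inner_self_eq_norm_sq_to_K]; simp
        _ = ‖∑ b ∈ s, κ b * inner ℂ (act p u) (act (B b) (act r v))‖ := by
            conv_lhs => rw [hv, inner_act_left, Matrix.conjTranspose_conjTranspose, ← hv]
            rw [hX, act_sum, inner_sum]
            congr 1
            refine Finset.sum_congr rfl fun b _ => ?_
            rw [act_smul, inner_smul_right, mul_assoc, act_mul, inner_act_right, hp, act_mul]
        _ ≤ ∑ b ∈ s, ‖κ b‖ * (Real.sqrt (qf (G b) (act p u)) *
              Real.sqrt (qf (G b) (act r v))) := by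
            refine (norm_sum_le _ _).trans (Finset.sum_le_sum fun b hb => ?_)
            rw [norm_mul]
            gcongr
            exact hBG b hb _ _
        _ ≤ Real.sqrt S * Real.sqrt (∑ b ∈ s, Real.sqrt (qf (G b) (act r v)) ^ 2) := by
            simp_rw [← mul_assoc]
            exact Real.sum_mul_le_sqrt_mul_sqrt _ _ _
        _ ≤ _ := by
            gcongr
            rw [← Real.sqrt_sq (norm_nonneg v), ← Real.sqrt_mul hM0]
            refine Real.sqrt_le_sqrt ?_
            refine le_trans (le_of_eq ?_) (hM v)
            exact Finset.sum_congr rfl fun b hb => Real.sq_sqrt (qf_nonneg (hG b hb) _)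
    have hS0 : 0 ≤ S := by positivity
    have hSM : S * M = ∑ b ∈ s, M * qf (G b) (act p u) * ‖κ b‖ ^ 2 := by
      rw [hS, Finset.sum_mul]
      refine Finset.sum_congr rfl fun b hb => ?_
      rw [mul_pow, Real.sq_sqrt (qf_nonneg (hG b hb) _)]; ring
    rw [← hSM]
    rcases (norm_nonneg v).eq_or_lt with h0 | h0
    · rw [← h0, zero_pow two_ne_zero]; exact mul_nonneg hS0 hM0
    · have h2 : ‖v‖ ≤ Real.sqrt S * Real.sqrt M := by
        refine le_of_mul_le_mul_right ?_ h0
        nlinarith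
      calc ‖v‖ ^ 2 ≤ (Real.sqrt S * Real.sqrt M) ^ 2 := by gcongr
        _ = S * M := by rw [mul_pow, Real.sq_sqrt hS0, Real.sq_sqrt hM0]
  rw [← hsSq_conjTranspose, hsSq_eq_sum_basisFun]
  refine (Finset.sum_le_sum fun i _ => key _).trans_eq ?_
  rw [Finset.sum_comm]
  refine Finset.sum_congr rfl fun b _ => ?_
  rw [trace_re_eq_sum_qf, Finset.mul_sum, Finset.sum_mul]
  simp_rw [qf_conj hp]

/-- The Hilbert-Schmidt norm and the form hypothesis are invariant under adjoints, so the projection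
carrying the coefficients may stand on the right. -/
lemma hsSq_sum_smul_le' {ι : Type*} (s : Finset ι) (κ : ι → ℂ)
    (B G : ι → Matrix (Fin m) (Fin m) ℂ)
    (hBG : ∀ b ∈ s, ∀ u v, ‖inner ℂ u (act (B b) v)‖ ≤
      Real.sqrt (qf (G b) u) * Real.sqrt (qf (G b) v))
    (hG : ∀ b ∈ s, (G b).PosSemidef) {p r : Matrix (Fin m) (Fin m) ℂ} (hp : pᴴ = p) (hr : rᴴ = r)
    {M : ℝ} (hM : ∀ v, ∑ b ∈ s, qf (G b) (act r v) ≤ M * ‖v‖ ^ 2) (hM0 : 0 ≤ M) :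
    hsSq (∑ b ∈ s, κ b • (r * B b * p)) ≤ ∑ b ∈ s, M * (p * G b * p).trace.re * ‖κ b‖ ^ 2 := by
  have h := hsSq_sum_smul_le s (fun b => star (κ b)) (fun b => (B b)ᴴ) G
    (fun b hb u v => by
      rw [← inner_act_left, norm_inner_symm, mul_comm]
      exact hBG b hb v u) hG hp hM hM0
  rw [← hsSq_conjTranspose, Matrix.conjTranspose_sum]
  simpa [Matrix.conjTranspose_mul, hp, hr, mul_assoc] using h

/-! ### Projections -/

/-- Orthogonal projections, as matrices. -/
structure IsProjection (p : Matrix (Fin m) (Fin m) ℂ) : Prop where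
  conjTranspose_eq : pᴴ = p
  mul_self : p * p = p

lemma isProjection_one : IsProjection (1 : Matrix (Fin m) (Fin m) ℂ) :=
  ⟨Matrix.conjTranspose_one, one_mul 1⟩

lemma IsProjection.hsSq_eq {p : Matrix (Fin m) (Fin m) ℂ} (hp : IsProjection p) :
    hsSq p = p.trace.re := by
  rw [hsSq_eq_trace, hp.1, hp.2]

lemma IsProjection.trace_nonneg {p : Matrix (Fin m) (Fin m) ℂ} (hp : IsProjection p) :
    0 ≤ p.trace.re := by
  rw [← hp.hsSq_eq]; exact hsSq_nonneg p

lemma IsProjection.rank_eq {p : Matrix (Fin m) (Fin m) ℂ} (hp : IsProjection p) :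
    (p.rank : ℝ≥0∞) = ENNReal.ofReal p.trace.re := by
  have h : IsIdempotentElem (Matrix.toLin' p) := by
    rw [IsIdempotentElem, Module.End.mul_eq_comp, ← Matrix.toLin'_mul, hp.2]
  have h2 := (LinearMap.IsIdempotentElem.isProj_range _ h).trace
  rw [Matrix.trace_toLin'_eq] at h2
  rw [h2, Complex.natCast_re, ENNReal.ofReal_natCast]
  rfl

lemma IsProjection.norm_act_le {p : Matrix (Fin m) (Fin m) ℂ} (hp : IsProjection p) (v : Vec m) :
    ‖act p v‖ ≤ ‖v‖ := by
  have h : ‖act p v‖ ^ 2 ≤ ‖v‖ * ‖act p v‖ := by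
    calc ‖act p v‖ ^ 2 = ‖inner ℂ (act p v) (act p v)‖ := by
          rw [inner_self_eq_norm_sq_to_K]; simp
      _ = ‖inner ℂ v (act p v)‖ := by
          rw [inner_act_left, hp.1, ← act_mul, hp.2]
      _ ≤ _ := norm_inner_le_norm _ _
  rcases (norm_nonneg (act p v)).eq_or_lt with h0 | h0
  · rw [← h0]; exact norm_nonneg v
  · nlinarith

lemma IsProjection.trace_conj {p : Matrix (Fin m) (Fin m) ℂ} (hp : IsProjection p)
    (A : Matrix (Fin m) (Fin m) ℂ) : (p * A * p).trace = (p * A).trace := by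
  rw [Matrix.trace_mul_comm, ← mul_assoc, hp.2]

lemma IsProjection.trace_mul_nonneg {p A : Matrix (Fin m) (Fin m) ℂ} (hp : IsProjection p)
    (hA : A.PosSemidef) : 0 ≤ (p * A).trace.re := by
  rw [← hp.trace_conj, trace_re_eq_sum_qf]
  refine Finset.sum_nonneg fun i _ => ?_
  rw [qf_conj hp.1]
  exact qf_nonneg hA _

lemma IsProjection.trace_conj_le {p A : Matrix (Fin m) (Fin m) ℂ} (hp : IsProjection p) {c : ℝ}
    (h : ∀ v, qf A (act p v) ≤ c * ‖v‖ ^ 2) : (p * A * p).trace.re ≤ c * p.trace.re := by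
  rw [← hp.hsSq_eq, hsSq_eq_sum_basisFun, trace_re_eq_sum_qf, Finset.mul_sum]
  refine Finset.sum_le_sum fun i _ => ?_
  rw [qf_conj hp.1]
  conv_lhs => rw [← hp.2, act_mul]
  exact h _

/-- From 0 ≤ pAp ≤ c follows (pAp)² ≤ c pAp; take traces. -/
lemma IsProjection.hsSq_conj_le {p A : Matrix (Fin m) (Fin m) ℂ} (hp : IsProjection p)
    (hA : A.PosSemidef) {c : ℝ} (hc : 0 ≤ c) (h : ∀ v, qf A (act p v) ≤ c * ‖v‖ ^ 2) :
    hsSq (p * A * p) ≤ c * (p * A).trace.re := by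
  rw [← hp.trace_conj, hsSq_eq_sum_basisFun, trace_re_eq_sum_qf, Finset.mul_sum]
  refine Finset.sum_le_sum fun i _ => ?_
  generalize EuclideanSpace.basisFun (Fin m) ℂ i = v
  set w := act (p * A * p) v with hw
  have h1 : ‖w‖ ^ 2 ≤ Real.sqrt c * ‖w‖ * Real.sqrt (qf (p * A * p) v) := by
    calc ‖w‖ ^ 2 = ‖inner ℂ w w‖ := by rw [inner_self_eq_norm_sq_to_K]; simp
      _ = ‖inner ℂ (act p w) (act A (act p v))‖ := by
          have h2 : inner ℂ w w = inner ℂ w (act (p * A * p) v) := rfl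
          rw [h2, mul_assoc, act_mul, inner_act_right, hp.1, act_mul]
      _ ≤ Real.sqrt (qf A (act p w)) * Real.sqrt (qf A (act p v)) := norm_inner_act_le hA _ _
      _ ≤ _ := by
          rw [qf_conj hp.1]
          gcongr
          rw [← Real.sqrt_sq (norm_nonneg w), ← Real.sqrt_mul hc]
          exact Real.sqrt_le_sqrt (h w)
  have h0 : 0 ≤ qf (p * A * p) v := by rw [qf_conj hp.1]; exact qf_nonneg hA _
  rcases (norm_nonneg w).eq_or_lt with hw0 | hw0
  · rw [← hw0, zero_pow two_ne_zero]; exact mul_nonneg hc h0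
  · have h2 : ‖w‖ ≤ Real.sqrt c * Real.sqrt (qf (p * A * p) v) := by
      refine le_of_mul_le_mul_right ?_ hw0
      nlinarith
    calc ‖w‖ ^ 2 ≤ (Real.sqrt c * Real.sqrt (qf (p * A * p) v)) ^ 2 := by gcongr
      _ = _ := by rw [mul_pow, Real.sq_sqrt hc, Real.sq_sqrt h0]

/-! ### Cuculescu's construction -/

/-- The spectral projection `χ_{(lam, ∞)}(q A q)`. -/
noncomputable def cucProj (lam : ℝ) (q A : Matrix (Fin m) (Fin m) ℂ) : Matrix (Fin m) (Fin m) ℂ :=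
  cfc ((Set.Ioi lam).indicator fun _ => (1 : ℝ)) (q * A * q)

section Step

variable {lam : ℝ} {q A : Matrix (Fin m) (Fin m) ℂ}

lemma continuousOn_spectrum (B : Matrix (Fin m) (Fin m) ℂ) (f : ℝ → ℝ) :
    ContinuousOn f (spectrum ℝ B) :=
  (Matrix.finite_real_spectrum (A := B)).continuousOn _

lemma isProjection_cucProj : IsProjection (cucProj lam q A) := by
  refine ⟨cfc_predicate ((Set.Ioi lam).indicator fun _ => (1 : ℝ)) (q * A * q), ?_⟩
  rw [cucProj, ← cfc_mul _ _ _ (continuousOn_spectrum _ _) (continuousOn_spectrum _ _)]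
  congr 1
  ext x
  by_cases hx : x ∈ Set.Ioi lam <;> simp [hx]

variable (hlam : 0 ≤ lam) (hq : IsProjection q) (hA : A.PosSemidef)

include hq hA in
lemma isSelfAdjoint_compression : IsSelfAdjoint (q * A * q) := by
  rw [IsSelfAdjoint, Matrix.star_eq_conjTranspose, Matrix.conjTranspose_mul,
    Matrix.conjTranspose_mul, hq.1, hA.1, mul_assoc]

include hlam hq hA in
-- Since lam ≥ 0, the indicator of (lam, ∞) equals x times a function, so the spectral projection
-- factors through qAq and lies under q.
lemma mul_cucProj : q * cucProj lam q A = cucProj lam q A := by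
  have hB := isSelfAdjoint_compression hq hA
  have h : cucProj lam q A = (q * A * q) *
      cfc (fun x => ((Set.Ioi lam).indicator (fun _ => (1 : ℝ)) x) / x) (q * A * q) := by
    conv_rhs => enter [1]; rw [← cfc_id' ℝ (q * A * q) hB]
    rw [← cfc_mul _ _ _ (continuousOn_spectrum _ _) (continuousOn_spectrum _ _), cucProj]
    congr 1
    ext x
    by_cases hx : x ∈ Set.Ioi lam
    · have : x ≠ 0 := (hlam.trans_lt hx).ne'
      simp [hx, this]
    · simp [hx]
  rw [h, ← mul_assoc, ← mul_assoc, ← mul_assoc, hq.2]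

include hlam hq hA in
lemma cucProj_mul : cucProj lam q A * q = cucProj lam q A := by
  have := congrArg Matrix.conjTranspose (mul_cucProj hlam hq hA)
  rwa [Matrix.conjTranspose_mul, hq.1, isProjection_cucProj.1] at this

include hlam hq hA in
lemma isProjection_sub_cucProj : IsProjection (q - cucProj lam q A) := by
  constructor
  · rw [Matrix.conjTranspose_sub, hq.1, isProjection_cucProj.1]
  · rw [sub_mul, mul_sub, mul_sub, hq.2, mul_cucProj hlam hq hA, cucProj_mul hlam hq hA,
      isProjection_cucProj.2]
    abel

include hq hA in
lemma cucProj_mul_compression : cucProj lam q A * (q * A * q) =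
    cfc (fun x => (Set.Ioi lam).indicator (fun _ => (1 : ℝ)) x * x) (q * A * q) := by
  have hB := isSelfAdjoint_compression hq hA
  conv_lhs => enter [2]; rw [← cfc_id' ℝ (q * A * q) hB]
  rw [cucProj, ← cfc_mul _ _ _ (continuousOn_spectrum _ _) (continuousOn_spectrum _ _)]

include hq hA in
lemma compression_mul_cucProj : (q * A * q) * cucProj lam q A =
    cucProj lam q A * (q * A * q) := by
  have h := congrArg star (cucProj_mul_compression (lam := lam) hq hA)
  rw [(cfc_predicate _ _ : IsSelfAdjoint (cfc _ (q * A * q))).star_eq,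
    ← cucProj_mul_compression hq hA, star_mul, (isSelfAdjoint_compression hq hA).star_eq] at h
  rw [← h, Matrix.star_eq_conjTranspose, isProjection_cucProj.1]

include hlam hq hA in
-- Chebyshev's inequality: the trace of the projection against A equals that against qAq, whose
-- retained eigenvalues all exceed lam.
lemma trace_cucProj_le :
    lam * (cucProj lam q A).trace.re ≤ (cucProj lam q A * A).trace.re := by
  have hB := isSelfAdjoint_compression hq hA
  set p := cucProj lam q A with hp
  have h1 : (p * A).trace = (p * (q * A * q)).trace := by
    calc (p * A).trace = (p * A * p).trace := (isProjection_cucProj.trace_conj A).symm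
      _ = ((p * q) * A * (q * p)).trace := by
          rw [cucProj_mul hlam hq hA, mul_cucProj hlam hq hA]
      _ = (p * (q * A * q) * p).trace := by simp only [mul_assoc]
      _ = _ := isProjection_cucProj.trace_conj _
  have h2 : p.trace = _ := trace_cfc (B := q * A * q) hB _
  rw [h1, cucProj_mul_compression hq hA, h2, trace_cfc (B := q * A * q) hB,
    ← Complex.ofReal_sum, ← Complex.ofReal_sum, Complex.ofReal_re, Complex.ofReal_re,
    Finset.mul_sum]
  refine Finset.sum_le_sum fun i _ => ?_
  by_cases hx : Matrix.IsHermitian.eigenvalues hB i ∈ Set.Ioi lam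
  · simpa [hx] using le_of_lt hx
  · simp [hx]

include hlam hq hA in
-- A spectral projection of qAq commutes with qAq, so qAq has no block between it and its complement
-- in q. This keeps averages out of the off-diagonal parts of the decomposition.
lemma sub_cucProj_mul_mul_cucProj : (q - cucProj lam q A) * A * cucProj lam q A = 0 := by
  have h1 : (q - cucProj lam q A) * A * cucProj lam q A =
      (q * A * q) * cucProj lam q A - cucProj lam q A * (q * A * q) * cucProj lam q A := by
    calc (q - cucProj lam q A) * A * cucProj lam q A
        = (q - cucProj lam q A * q) * A * (q * cucProj lam q A) := by
          rw [mul_cucProj hlam hq hA, cucProj_mul hlam hq hA]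
      _ = _ := by noncomm_ring
  rw [h1, mul_assoc (cucProj lam q A), compression_mul_cucProj hq hA,
    ← mul_assoc (cucProj lam q A) (cucProj lam q A), isProjection_cucProj.2, sub_self]

include hlam hq hA in
lemma cucProj_mul_mul_eq :
    cucProj lam q A * A * q = cucProj lam q A * A * cucProj lam q A := by
  have h := congrArg Matrix.conjTranspose (sub_cucProj_mul_mul_cucProj hlam hq hA)
  rw [Matrix.conjTranspose_mul, Matrix.conjTranspose_mul, Matrix.conjTranspose_sub, hq.1, hA.1,
    isProjection_cucProj.1, Matrix.conjTranspose_zero, ← mul_assoc, mul_sub] at h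
  exact sub_eq_zero.1 h

include hlam hq hA in
-- The compression of A to the remaining projection is the function x·1_{x ≤ lam} of qAq.
-- Subtracting it from lam leaves a nonnegative function, hence the square of a self-adjoint matrix.
lemma qf_sub_cucProj_le (v : Vec m) :
    qf A (act (q - cucProj lam q A) v) ≤ lam * ‖v‖ ^ 2 := by
  have hB := isSelfAdjoint_compression hq hA
  have hq' := isProjection_sub_cucProj hlam hq hA
  set g : ℝ → ℝ := fun x => x - (Set.Ioi lam).indicator (fun _ => (1 : ℝ)) x * x with hg
  have h1 : (q - cucProj lam q A) * A * (q - cucProj lam q A) = cfc g (q * A * q) := by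
    have e1 : cfc g (q * A * q) = (q * A * q) - cucProj lam q A * (q * A * q) := by
      rw [hg, cfc_sub _ _ _ (continuousOn_spectrum _ _) (continuousOn_spectrum _ _),
        cfc_id' ℝ _ hB, cucProj_mul_compression hq hA]
    rw [e1, mul_sub (_ * A), sub_cucProj_mul_mul_cucProj hlam hq hA, sub_zero, sub_mul, sub_mul]
    simp only [← mul_assoc]
    rw [cucProj_mul hlam hq hA]
  set h : ℝ → ℝ := fun x => Real.sqrt (lam - g x) with hh
  have h2 : (lam : ℂ) • (1 : Matrix (Fin m) (Fin m) ℂ) - cfc g (q * A * q) =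
      cfc h (q * A * q) * cfc h (q * A * q) := by
    have e2 : (lam : ℂ) • (1 : Matrix (Fin m) (Fin m) ℂ) = cfc (fun _ => lam) (q * A * q) := by
      rw [cfc_const _ _ hB, Algebra.algebraMap_eq_smul_one]
      ext i j
      simp
    rw [e2, ← cfc_sub _ _ _ (continuousOn_spectrum _ _) (continuousOn_spectrum _ _),
      ← cfc_mul _ _ _ (continuousOn_spectrum _ _) (continuousOn_spectrum _ _)]
    congr 1
    ext x
    rw [hh]
    dsimp only
    rw [Real.mul_self_sqrt]
    by_cases hx : x ∈ Set.Ioi lam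
    · simpa [hg, hx] using hlam
    · simpa [hg, hx] using not_lt.1 hx
  have h3 : 0 ≤ qf ((lam : ℂ) • (1 : Matrix (Fin m) (Fin m) ℂ) - cfc g (q * A * q)) v := by
    rw [h2, qf, act_mul, inner_act_right,
      show (cfc h (q * A * q))ᴴ = cfc h (q * A * q) from cfc_predicate h (q * A * q),
      inner_self_eq_norm_sq_to_K, ← RCLike.ofReal_pow]
    exact sq_nonneg ‖act (cfc h (q * A * q)) v‖
  rw [qf_sub, qf_smul, qf_one, ← h1, qf_conj hq'.1] at h3
  linarith

end Step

/-- Cuculescu's decreasing sequence of projections at height `lam` along a sequence of positive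
matrices. -/
noncomputable def cucSeq (lam : ℝ) (A : ℕ → Matrix (Fin m) (Fin m) ℂ) :
    ℕ → Matrix (Fin m) (Fin m) ℂ
  -- The matrix A 0 is never cut; the bounds below assume instead that it is at most lam.
  | 0 => 1
  | i + 1 => cucSeq lam A i - cucProj lam (cucSeq lam A i) (A (i + 1))

/-- The differences of Cuculescu's projections. -/
noncomputable def cucDiff (lam : ℝ) (A : ℕ → Matrix (Fin m) (Fin m) ℂ) (i : ℕ) :
    Matrix (Fin m) (Fin m) ℂ :=
  cucProj lam (cucSeq lam A i) (A (i + 1))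

/-- Adaptedness: only the averages down to generation i enter, so along the tree the projection is
constant on each cube of that generation. -/
lemma cucSeq_congr {lam : ℝ} {A B : ℕ → Matrix (Fin m) (Fin m) ℂ} {i : ℕ}
    (h : ∀ j ≤ i, A j = B j) : cucSeq lam A i = cucSeq lam B i := by
  induction i with
  | zero => rfl
  | succ i ih =>
    rw [cucSeq, cucSeq, ih fun j hj => h j (by omega), h (i + 1) le_rfl]

lemma cucDiff_congr {lam : ℝ} {A B : ℕ → Matrix (Fin m) (Fin m) ℂ} {i : ℕ}
    (h : ∀ j ≤ i + 1, A j = B j) : cucDiff lam A i = cucDiff lam B i := by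
  rw [cucDiff, cucDiff, cucSeq_congr fun j hj => h j (by omega), h (i + 1) le_rfl]

/-! ### Estimates and decomposition along one branch -/

section Seq

variable {lam : ℝ} (hlam : 0 ≤ lam) {A : ℕ → Matrix (Fin m) (Fin m) ℂ}
  (hA : ∀ i, (A i).PosSemidef)

lemma isProjection_cucDiff (i : ℕ) : IsProjection (cucDiff lam A i) := isProjection_cucProj

include hlam hA

lemma isProjection_cucSeq (i : ℕ) : IsProjection (cucSeq lam A i) := by
  induction i with
  | zero => exact isProjection_one
  | succ i ih => exact isProjection_sub_cucProj hlam ih (hA _)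

lemma cucSeq_mul_cucDiff (i : ℕ) : cucSeq lam A i * cucDiff lam A i = cucDiff lam A i :=
  mul_cucProj hlam (isProjection_cucSeq hlam hA i) (hA _)

omit hlam hA in
lemma cucSeq_succ (i : ℕ) : cucSeq lam A (i + 1) = cucSeq lam A i - cucDiff lam A i := rfl

lemma qf_cucSeq_le (h0 : ∀ v, qf (A 0) v ≤ lam * ‖v‖ ^ 2) (i : ℕ) (v : Vec m) :
    qf (A i) (act (cucSeq lam A i) v) ≤ lam * ‖v‖ ^ 2 := by
  cases i with
  | zero => rw [cucSeq, act_one]; exact h0 v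
  | succ i => exact qf_sub_cucProj_le hlam (isProjection_cucSeq hlam hA i) (hA _) v

/-- Consecutive averages grow by at most D (2^d on the tree), so the bound lam at one generation
survives one step further with the factor D. -/
lemma qf_succ_cucSeq_le (h0 : ∀ v, qf (A 0) v ≤ lam * ‖v‖ ^ 2) {D : ℝ} (hD : 0 ≤ D)
    (hgrow : ∀ i v, qf (A (i + 1)) v ≤ D * qf (A i) v) (i : ℕ) (v : Vec m) :
    qf (A (i + 1)) (act (cucSeq lam A i) v) ≤ D * lam * ‖v‖ ^ 2 := by
  rw [mul_assoc]
  exact (hgrow i _).trans (mul_le_mul_of_nonneg_left (qf_cucSeq_le hlam hA h0 i v) hD)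

lemma qf_succ_cucDiff_le (h0 : ∀ v, qf (A 0) v ≤ lam * ‖v‖ ^ 2) {D : ℝ} (hD : 0 ≤ D)
    (hgrow : ∀ i v, qf (A (i + 1)) v ≤ D * qf (A i) v) (i : ℕ) (v : Vec m) :
    qf (A (i + 1)) (act (cucDiff lam A i) v) ≤ D * lam * ‖v‖ ^ 2 := by
  rw [← cucSeq_mul_cucDiff hlam hA, act_mul]
  refine (qf_succ_cucSeq_le hlam hA h0 hD hgrow i _).trans ?_
  have := (isProjection_cucDiff (lam := lam) (A := A) i).norm_act_le v
  gcongr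

omit hlam hA in
-- Telescoping of q_i f q_i - q_{i+1} f q_{i+1} = p_i f q_i + q_{i+1} f p_i, with q_0 = 1.
lemma sum_cucDiff_compress_eq (f : Matrix (Fin m) (Fin m) ℂ) (K : ℕ) :
    f = cucSeq lam A K * f * cucSeq lam A K + ∑ i ∈ Finset.range K,
      (cucDiff lam A i * f * cucSeq lam A i + cucSeq lam A (i + 1) * f * cucDiff lam A i) := by
  induction K with
  | zero => simp [cucSeq]
  | succ K ih =>
    rw [Finset.sum_range_succ, cucSeq_succ]
    conv_lhs => rw [ih]
    noncomm_ring

/-- The Calderón-Zygmund decomposition along one branch of the dyadic tree. -/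
lemma cz_decomposition (f : Matrix (Fin m) (Fin m) ℂ) (K : ℕ) :
    f = (cucSeq lam A K * f * cucSeq lam A K +
        ∑ i ∈ Finset.range K, cucDiff lam A i * A (i + 1) * cucDiff lam A i) +
      (∑ i ∈ Finset.range K, cucDiff lam A i * (f - A (i + 1)) * cucSeq lam A i +
        ∑ i ∈ Finset.range K, cucSeq lam A (i + 1) * (f - A (i + 1)) * cucDiff lam A i) := by
  conv_lhs => rw [sum_cucDiff_compress_eq (lam := lam) (A := A) f K]
  rw [add_assoc, ← Finset.sum_add_distrib, ← Finset.sum_add_distrib]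
  congr 1
  refine Finset.sum_congr rfl fun i _ => ?_
  -- Of the two subtracted averages, the first reduces to its diagonal block, which moves into the
  -- good part, and the second vanishes.
  have h1 : cucDiff lam A i * A (i + 1) * cucSeq lam A i =
      cucDiff lam A i * A (i + 1) * cucDiff lam A i :=
    cucProj_mul_mul_eq hlam (isProjection_cucSeq hlam hA i) (hA _)
  have h2 : cucSeq lam A (i + 1) * A (i + 1) * cucDiff lam A i = 0 :=
    sub_cucProj_mul_mul_cucProj hlam (isProjection_cucSeq hlam hA i) (hA _)
  rw [mul_sub, mul_sub, sub_mul, sub_mul, h1, h2]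
  abel

omit hlam hA in
lemma hsSq_add_of_conjTranspose_mul_eq_zero {X Y : Matrix (Fin m) (Fin m) ℂ} (h : Xᴴ * Y = 0) :
    hsSq (X + Y) = hsSq X + hsSq Y := by
  have h' : Yᴴ * X = 0 := by
    have := congrArg Matrix.conjTranspose h
    simpa using this
  simp only [hsSq_eq_trace, Matrix.conjTranspose_add, add_mul, mul_add, h, h', Matrix.trace_add,
    Complex.add_re, Matrix.trace_zero, Complex.zero_re]
  ring

omit hlam hA in
lemma conjTranspose_compression {p B : Matrix (Fin m) (Fin m) ℂ} (hp : IsProjection p)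
    (hB : B.PosSemidef) : (p * B * p)ᴴ = p * B * p := by
  rw [Matrix.conjTranspose_mul, Matrix.conjTranspose_mul, hp.1, hB.1, mul_assoc]

/-- Each q_K is orthogonal to all earlier differences p_i, so the blocks of the good part have
orthogonal ranges. -/
lemma cucSeq_mul_sum_eq_zero (K : ℕ) : cucSeq lam A K *
    ∑ i ∈ Finset.range K, cucDiff lam A i * A (i + 1) * cucDiff lam A i = 0 := by
  have hdec : ∀ K, cucSeq lam A (K + 1) * cucSeq lam A K = cucSeq lam A (K + 1) := fun K => by
    rw [cucSeq_succ, sub_mul, (isProjection_cucSeq hlam hA K).2]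
    congr 1
    exact cucProj_mul hlam (isProjection_cucSeq hlam hA K) (hA _)
  induction K with
  | zero => simp
  | succ K ih =>
    rw [Finset.sum_range_succ, mul_add, ← hdec, mul_assoc, ih, mul_zero, zero_add, hdec,
      ← mul_assoc, ← mul_assoc, cucSeq_succ, sub_mul, cucSeq_mul_cucDiff hlam hA,
      (isProjection_cucDiff K).2, sub_self, zero_mul, zero_mul]

/-- The Hilbert-Schmidt squares of orthogonal blocks add up, and a positive block bounded by D·lam
has Hilbert-Schmidt square at most D·lam times its trace. -/
lemma hsSq_good_le (h0 : ∀ v, qf (A 0) v ≤ lam * ‖v‖ ^ 2) {D : ℝ} (hD : 1 ≤ D)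
    (hgrow : ∀ i v, qf (A (i + 1)) v ≤ D * qf (A i) v) (K : ℕ) :
    hsSq (cucSeq lam A K * A K * cucSeq lam A K +
        ∑ i ∈ Finset.range K, cucDiff lam A i * A (i + 1) * cucDiff lam A i) ≤
      D * lam * ((cucSeq lam A K * A K).trace.re +
        ∑ i ∈ Finset.range K, (cucDiff lam A i * A (i + 1)).trace.re) := by
  have hD0 : 0 ≤ D := zero_le_one.trans hD
  have hsum : ∀ K, (∑ i ∈ Finset.range K, cucDiff lam A i * A (i + 1) * cucDiff lam A i)ᴴ =
      ∑ i ∈ Finset.range K, cucDiff lam A i * A (i + 1) * cucDiff lam A i := fun K => by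
    rw [Matrix.conjTranspose_sum]
    exact Finset.sum_congr rfl fun i _ => conjTranspose_compression (isProjection_cucDiff i) (hA _)
  have hbad : ∀ K, hsSq (∑ i ∈ Finset.range K, cucDiff lam A i * A (i + 1) * cucDiff lam A i) ≤
      D * lam * ∑ i ∈ Finset.range K, (cucDiff lam A i * A (i + 1)).trace.re := by
    intro K
    induction K with
    | zero => simp [hsSq]
    | succ K ih =>
      rw [Finset.sum_range_succ, Finset.sum_range_succ, hsSq_add_of_conjTranspose_mul_eq_zero,
        mul_add]
      · refine add_le_add ih ?_
        exact (isProjection_cucDiff K).hsSq_conj_le (hA _) (by positivity)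
          (qf_succ_cucDiff_le hlam hA h0 hD0 hgrow K)
      · have h1 := congrArg Matrix.conjTranspose (cucSeq_mul_sum_eq_zero hlam hA K)
        rw [Matrix.conjTranspose_mul, hsum, (isProjection_cucSeq hlam hA K).1,
          Matrix.conjTranspose_zero] at h1
        rw [hsum, ← cucSeq_mul_cucDiff hlam hA K]
        simp only [← mul_assoc]
        rw [h1]
        simp
  rw [hsSq_add_of_conjTranspose_mul_eq_zero, mul_add]
  · refine add_le_add ?_ (hbad K)
    refine (isProjection_cucSeq hlam hA K).hsSq_conj_le (hA _) (by positivity) fun v => ?_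
    refine (qf_cucSeq_le hlam hA h0 K v).trans ?_
    have : lam ≤ D * lam := le_mul_of_one_le_left hlam hD
    gcongr
  · rw [conjTranspose_compression (isProjection_cucSeq hlam hA K) (hA _), mul_assoc,
      cucSeq_mul_sum_eq_zero hlam hA, mul_zero]

omit hlam hA in
lemma trace_cucSeq_add_sum (f : Matrix (Fin m) (Fin m) ℂ) (K : ℕ) :
    (cucSeq lam A K * f).trace.re + ∑ i ∈ Finset.range K, (cucDiff lam A i * f).trace.re =
      f.trace.re := by
  induction K with
  | zero => simp [cucSeq]
  | succ K ih =>
    rw [← ih, Finset.sum_range_succ, cucSeq_succ, sub_mul, Matrix.trace_sub,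
      Complex.sub_re]
    ring

lemma mul_trace_cucDiff_le (i : ℕ) :
    lam * (cucDiff lam A i).trace.re ≤ (cucDiff lam A i * A (i + 1)).trace.re :=
  trace_cucProj_le hlam (isProjection_cucSeq hlam hA i) (hA _)

end Seq

end

/-! ### The tree of dyadic indices -/

/-- The index of the `k`-th ancestor of a dyadic cube. -/
def anc {d : ℕ} (k : ℕ) (a : Fin d → ℤ) : Fin d → ℤ := fun i => a i / 2 ^ k

/-- The indices of the `k`-th generation descendants of a dyadic cube. -/
noncomputable def descendants {d : ℕ} (k : ℕ) (J : Fin d → ℤ) : Finset (Fin d → ℤ) :=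
  Fintype.piFinset fun i => Finset.Ico (2 ^ k * J i) (2 ^ k * J i + 2 ^ k)

section Tree

variable {d : ℕ}

lemma mem_descendants {k : ℕ} {J b : Fin d → ℤ} : b ∈ descendants k J ↔ anc k b = J := by
  have h2 : (0 : ℤ) < 2 ^ k := by positivity
  rw [descendants, Fintype.mem_piFinset, funext_iff]
  refine forall_congr' fun i => ?_
  rw [Finset.mem_Ico, anc]
  constructor
  · rintro ⟨h1, h3⟩
    refine le_antisymm ?_ ?_
    · exact Int.lt_add_one_iff.1 (Int.ediv_lt_of_lt_mul h2 (by linarith [mul_comm (2 ^ k) (J i)]))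
    · exact (Int.le_ediv_iff_mul_le h2).2 (by linarith)
  · intro h
    rw [← h]
    exact ⟨Int.mul_ediv_self_le h2.ne', Int.lt_mul_ediv_self_add h2⟩

lemma card_descendants (k : ℕ) (J : Fin d → ℤ) : (descendants k J).card = 2 ^ (k * d) := by
  rw [descendants, Fintype.card_piFinset]
  have h : ((2 : ℤ) ^ k).toNat = 2 ^ k := by
    rw [show (2 : ℤ) ^ k = ((2 ^ k : ℕ) : ℤ) by push_cast; rfl, Int.toNat_natCast]
  simp [pow_mul, h]

lemma self_mem_descendants (k : ℕ) (a : Fin d → ℤ) : a ∈ descendants k (anc k a) :=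
  mem_descendants.2 rfl

lemma anc_zero (a : Fin d → ℤ) : anc 0 a = a := by
  ext i; simp [anc]

lemma anc_anc (j k : ℕ) (a : Fin d → ℤ) : anc j (anc k a) = anc (k + j) a := by
  ext i
  rw [anc, anc, anc, pow_add, Int.ediv_ediv_of_nonneg (by positivity)]

lemma anc_eq_of_le {j k : ℕ} (h : j ≤ k) {a b : Fin d → ℤ} (hab : anc j a = anc j b) :
    anc k a = anc k b := by
  obtain ⟨l, rfl⟩ := Nat.exists_eq_add_of_le h
  rw [← anc_anc, ← anc_anc, hab]

lemma descendants_zero (a : Fin d → ℤ) : descendants 0 a = {a} := by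
  ext b
  rw [mem_descendants, anc_zero, Finset.mem_singleton]

/-- A canonical descendant. -/
def corner (k : ℕ) (J : Fin d → ℤ) : Fin d → ℤ := fun i => 2 ^ k * J i

lemma anc_corner (k : ℕ) (J : Fin d → ℤ) : anc k (corner k J) = J := by
  ext i
  simp [anc, corner]

/-- A set of indices which is a union of families of `K`-th generation descendants. -/
def Saturated (K : ℕ) (s : Finset (Fin d → ℤ)) : Prop :=
  ∀ a ∈ s, ∀ b, anc K b = anc K a → b ∈ s

lemma Saturated.sum_eq {K : ℕ} {s : Finset (Fin d → ℤ)} (hs : Saturated K s) {k : ℕ} (hk : k ≤ K)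
    {M : Type*} [AddCommMonoid M] (F : (Fin d → ℤ) → M) :
    ∑ a ∈ s, F a = ∑ J ∈ s.image (anc k), ∑ a ∈ descendants k J, F a := by
  rw [← Finset.sum_fiberwise_of_maps_to (fun a ha => Finset.mem_image_of_mem (anc k) ha)]
  refine Finset.sum_congr rfl fun J hJ => Finset.sum_congr ?_ fun _ _ => rfl
  obtain ⟨a, ha, rfl⟩ := Finset.mem_image.1 hJ
  ext b
  rw [Finset.mem_filter, mem_descendants]
  exact ⟨fun h => h.2, fun h => ⟨hs a ha b (anc_eq_of_le hk h), h⟩⟩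

lemma exists_saturated (K : ℕ) (s : Finset (Fin d → ℤ)) :
    ∃ s', s ⊆ s' ∧ Saturated K s' := by
  refine ⟨(s.image (anc K)).biUnion (descendants K), fun a ha => ?_, fun a ha b hb => ?_⟩
  · exact Finset.mem_biUnion.2 ⟨_, Finset.mem_image_of_mem _ ha, self_mem_descendants K a⟩
  · obtain ⟨J, hJ, haJ⟩ := Finset.mem_biUnion.1 ha
    refine Finset.mem_biUnion.2 ⟨J, hJ, mem_descendants.2 ?_⟩
    rw [hb, mem_descendants.1 haJ]

/-! ### Averages over dyadic cubes -/

variable {m : ℕ}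

/-- The average of `f` over the `k`-th generation descendants of the `k`-th ancestor of `a`. -/
noncomputable def avg (k : ℕ) (f : (Fin d → ℤ) → Matrix (Fin m) (Fin m) ℂ) (a : Fin d → ℤ) :
    Matrix (Fin m) (Fin m) ℂ :=
  (((2 ^ (k * d) : ℝ)⁻¹ : ℝ) : ℂ) • ∑ b ∈ descendants k (anc k a), f b

lemma avg_zero (f : (Fin d → ℤ) → Matrix (Fin m) (Fin m) ℂ) (a : Fin d → ℤ) :
    avg 0 f a = f a := by
  simp [avg, anc_zero, descendants_zero]

lemma avg_congr {k : ℕ} (f : (Fin d → ℤ) → Matrix (Fin m) (Fin m) ℂ) {a b : Fin d → ℤ}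
    (h : anc k a = anc k b) : avg k f a = avg k f b := by
  rw [avg, avg, h]

lemma sum_descendants_eq_smul_avg (k : ℕ) (f : (Fin d → ℤ) → Matrix (Fin m) (Fin m) ℂ)
    (a : Fin d → ℤ) :
    ∑ b ∈ descendants k (anc k a), f b = ((2 ^ (k * d) : ℝ) : ℂ) • avg k f a := by
  rw [avg, smul_smul, ← Complex.ofReal_mul, mul_inv_cancel₀ (by positivity), Complex.ofReal_one,
    one_smul]

variable {f : (Fin d → ℤ) → Matrix (Fin m) (Fin m) ℂ}

lemma qf_avg (k : ℕ) (a : Fin d → ℤ) (v : Vec m) :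
    qf (avg k f a) v = (2 ^ (k * d) : ℝ)⁻¹ * ∑ b ∈ descendants k (anc k a), qf (f b) v := by
  rw [avg, qf_smul, qf_sum]

lemma posSemidef_avg (hf : ∀ a, (f a).PosSemidef) (k : ℕ) (a : Fin d → ℤ) :
    (avg k f a).PosSemidef := by
  refine (Matrix.posSemidef_sum _ fun b _ => hf b).smul ?_
  rw [Complex.zero_le_real]
  positivity

/-- A cube is part of its parent and f is positive; only the normalisations differ, by 2^d. -/
lemma qf_avg_le (hf : ∀ a, (f a).PosSemidef) (k : ℕ) (a : Fin d → ℤ) (v : Vec m) :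
    qf (avg k f a) v ≤ 2 ^ d * qf (avg (k + 1) f a) v := by
  rw [qf_avg, qf_avg, ← mul_assoc, show ((2 : ℝ) ^ d * (2 ^ ((k + 1) * d))⁻¹) = (2 ^ (k * d))⁻¹ by
    rw [add_mul, one_mul, pow_add]; field_simp]
  refine mul_le_mul_of_nonneg_left ?_ (by positivity)
  refine Finset.sum_le_sum_of_subset_of_nonneg (fun b hb => ?_) fun b _ _ => qf_nonneg (hf b) v
  rw [mem_descendants] at hb ⊢
  exact anc_eq_of_le (by omega) hb

/-- Averaging is a conditional expectation: against a P constant on the family, the average and f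
have the same total trace. -/
lemma sum_trace_mul_avg (k : ℕ) (J : Fin d → ℤ)
    {P : (Fin d → ℤ) → Matrix (Fin m) (Fin m) ℂ}
    (hP : ∀ a b, anc k a = anc k b → P a = P b) :
    ∑ b ∈ descendants k J, (P b * avg k f b).trace.re =
      ∑ b ∈ descendants k J, (P b * f b).trace.re := by
  have h1 : ∀ b ∈ descendants k J, P b = P (corner k J) := fun b hb =>
    hP _ _ ((mem_descendants.1 hb).trans (anc_corner k J).symm)
  have h2 : ∀ b ∈ descendants k J, avg k f b = avg k f (corner k J) := fun b hb =>
    avg_congr f ((mem_descendants.1 hb).trans (anc_corner k J).symm)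
  have h3 : ∑ b ∈ descendants k J, (P b * f b).trace.re =
      (P (corner k J) * ∑ b ∈ descendants k J, f b).trace.re := by
    rw [Finset.mul_sum, Matrix.trace_sum, Complex.re_sum]
    exact Finset.sum_congr rfl fun b hb => by rw [h1 b hb]
  have h4 : ∑ b ∈ descendants k J, (P b * avg k f b).trace.re =
      ∑ b ∈ descendants k J, (P (corner k J) * avg k f (corner k J)).trace.re :=
    Finset.sum_congr rfl fun b hb => by rw [h1 b hb, h2 b hb]
  have h5 := sum_descendants_eq_smul_avg k f (corner k J)
  rw [anc_corner] at h5
  rw [h3, h4, h5, Finset.sum_const, card_descendants, Matrix.mul_smul, Matrix.trace_smul,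
    smul_eq_mul, Complex.re_ofReal_mul, nsmul_eq_mul]
  push_cast
  rfl

/-! ### Cuculescu's projections along the dyadic tree -/

/-- The averages of `f` along the branch through `a`, starting `K` generations above. -/
noncomputable def branch (K : ℕ) (f : (Fin d → ℤ) → Matrix (Fin m) (Fin m) ℂ) (a : Fin d → ℤ)
    (i : ℕ) : Matrix (Fin m) (Fin m) ℂ :=
  avg (K - i) f a

lemma branch_self (K : ℕ) (f : (Fin d → ℤ) → Matrix (Fin m) (Fin m) ℂ) (a : Fin d → ℤ) :
    branch K f a K = f a := by
  rw [branch, Nat.sub_self, avg_zero]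

lemma posSemidef_branch (hf : ∀ a, (f a).PosSemidef) (K : ℕ) (a : Fin d → ℤ) (i : ℕ) :
    (branch K f a i).PosSemidef := posSemidef_avg hf _ _

/-- Beyond i = K the truncated subtraction makes the branch constant, so the growth bound holds for
all i. -/
lemma qf_branch_succ_le (hf : ∀ a, (f a).PosSemidef) (K : ℕ) (a : Fin d → ℤ) (i : ℕ) (v : Vec m) :
    qf (branch K f a (i + 1)) v ≤ 2 ^ d * qf (branch K f a i) v := by
  rcases le_or_gt K i with h | h
  · rw [branch, branch, Nat.sub_eq_zero_of_le h, Nat.sub_eq_zero_of_le (h.trans i.le_succ)]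
    exact le_mul_of_one_le_left (qf_nonneg (posSemidef_avg hf _ _) v) (one_le_pow₀ one_le_two)
  · rw [branch, branch, show K - i = K - (i + 1) + 1 by omega]
    exact qf_avg_le hf _ _ _

lemma branch_congr {K i j : ℕ} (hj : j ≤ i) {a b : Fin d → ℤ} (h : anc (K - i) a = anc (K - i) b) :
    branch K f a j = branch K f b j :=
  avg_congr f (anc_eq_of_le (by omega) h)

lemma cucSeq_branch_congr {lam : ℝ} {K i : ℕ} {a b : Fin d → ℤ}
    (h : anc (K - i) a = anc (K - i) b) :
    cucSeq lam (branch K f a) i = cucSeq lam (branch K f b) i :=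
  cucSeq_congr fun _ hj => branch_congr hj h

lemma cucDiff_branch_congr {lam : ℝ} {K i : ℕ} {a b : Fin d → ℤ}
    (h : anc (K - (i + 1)) a = anc (K - (i + 1)) b) :
    cucDiff lam (branch K f a) i = cucDiff lam (branch K f b) i :=
  cucDiff_congr fun _ hj => branch_congr hj h

lemma Saturated.sum_trace_cucDiff_mul_branch {K : ℕ} {s : Finset (Fin d → ℤ)} (hs : Saturated K s)
    (lam : ℝ) (i : ℕ) :
    ∑ a ∈ s, (cucDiff lam (branch K f a) i * branch K f a (i + 1)).trace.re =
      ∑ a ∈ s, (cucDiff lam (branch K f a) i * f a).trace.re := by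
  rw [hs.sum_eq (Nat.sub_le K (i + 1)), hs.sum_eq (Nat.sub_le K (i + 1))]
  exact Finset.sum_congr rfl fun J _ =>
    sum_trace_mul_avg _ J (P := fun a => cucDiff lam (branch K f a) i)
      fun a b h => cucDiff_branch_congr h

/-- The good part of the Calderón-Zygmund decomposition. -/
noncomputable def goodPart (lam : ℝ) (K : ℕ) (f : (Fin d → ℤ) → Matrix (Fin m) (Fin m) ℂ)
    (a : Fin d → ℤ) : Matrix (Fin m) (Fin m) ℂ :=
  cucSeq lam (branch K f a) K * f a * cucSeq lam (branch K f a) K +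
    ∑ i ∈ Finset.range K, cucDiff lam (branch K f a) i * branch K f a (i + 1) *
      cucDiff lam (branch K f a) i

variable {lam : ℝ} (hlam : 0 ≤ lam) (hf : ∀ a, (f a).PosSemidef) {K : ℕ}
  {s : Finset (Fin d → ℤ)} (hs : Saturated K s)

include hlam hf hs

/-- Cuculescu's weak type maximal inequality: apply Chebyshev to each difference, replace averages
by f through conditional expectation, and use that the differences sum to at most the identity. -/
lemma sum_trace_cucDiff_le :
    lam * ∑ i ∈ Finset.range K, ∑ a ∈ s, (cucDiff lam (branch K f a) i).trace.re ≤
      ∑ a ∈ s, (f a).trace.re := by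
  calc lam * ∑ i ∈ Finset.range K, ∑ a ∈ s, (cucDiff lam (branch K f a) i).trace.re
      ≤ ∑ i ∈ Finset.range K, ∑ a ∈ s,
          (cucDiff lam (branch K f a) i * branch K f a (i + 1)).trace.re := by
        simp_rw [Finset.mul_sum]
        exact Finset.sum_le_sum fun i _ => Finset.sum_le_sum fun a _ =>
          mul_trace_cucDiff_le hlam (posSemidef_branch hf K a) i
    _ = ∑ a ∈ s, ∑ i ∈ Finset.range K, (cucDiff lam (branch K f a) i * f a).trace.re := by
        conv_rhs => rw [Finset.sum_comm]
        exact Finset.sum_congr rfl fun i _ => hs.sum_trace_cucDiff_mul_branch lam i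
    _ ≤ ∑ a ∈ s, (f a).trace.re := by
        refine Finset.sum_le_sum fun a _ => ?_
        rw [← trace_cucSeq_add_sum (lam := lam) (A := branch K f a) (f a) K]
        have := (isProjection_cucSeq hlam (posSemidef_branch hf K a) K).trace_mul_nonneg (hf a)
        linarith

lemma sum_hsSq_goodPart_le (h0 : ∀ a ∈ s, ∀ v, qf (branch K f a 0) v ≤ lam * ‖v‖ ^ 2) :
    ∑ a ∈ s, hsSq (goodPart lam K f a) ≤ 2 ^ d * lam * ∑ a ∈ s, (f a).trace.re := by
  calc ∑ a ∈ s, hsSq (goodPart lam K f a)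
      ≤ ∑ a ∈ s, 2 ^ d * lam * ((cucSeq lam (branch K f a) K * f a).trace.re +
          ∑ i ∈ Finset.range K,
            (cucDiff lam (branch K f a) i * branch K f a (i + 1)).trace.re) := by
        refine Finset.sum_le_sum fun a ha => ?_
        have := hsSq_good_le hlam (posSemidef_branch hf K a) (h0 a ha)
          (one_le_pow₀ one_le_two) (qf_branch_succ_le hf K a) K
        rwa [branch_self] at this
    _ = 2 ^ d * lam * ∑ a ∈ s, ((cucSeq lam (branch K f a) K * f a).trace.re +
          ∑ i ∈ Finset.range K, (cucDiff lam (branch K f a) i * f a).trace.re) := by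
        have h := Finset.sum_congr (s₁ := Finset.range K) rfl
          fun i _ => hs.sum_trace_cucDiff_mul_branch (f := f) lam i
        rw [Finset.sum_comm, Finset.sum_comm (t := s)] at h
        rw [← Finset.mul_sum, Finset.sum_add_distrib, Finset.sum_add_distrib, h]
    _ = _ := by
        congr 1
        exact Finset.sum_congr rfl fun a _ => trace_cucSeq_add_sum (f a) K

end Tree

/-- The finite total mass of f is spread over 2^(K d) cubes, so the average tends to zero as K grows
when d > 0. This starts Cuculescu's construction below height lam. -/
lemma exists_forall_qf_branch_zero_le {d m : ℕ} (hd : 0 < d)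
    {f : (Fin d → ℤ) → Matrix (Fin m) (Fin m) ℂ} (hf : ∀ a, (f a).PosSemidef)
    {s : Finset (Fin d → ℤ)} (hs : ∀ a ∉ s, f a = 0) {lam : ℝ} (hlam : 0 < lam) :
    ∃ K, ∀ a v, qf (branch K f a 0) v ≤ lam * ‖v‖ ^ 2 := by
  set C := ∑ b ∈ s, Real.sqrt (hsSq (f b)) with hC
  have hC0 : 0 ≤ C := by positivity
  obtain ⟨K, hK⟩ := pow_unbounded_of_one_lt (C / lam) one_lt_two
  refine ⟨K, fun a v => ?_⟩
  have hqf : ∀ b, qf (f b) v ≤ Real.sqrt (hsSq (f b)) * ‖v‖ ^ 2 := fun b => by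
    calc qf (f b) v ≤ ‖inner ℂ v (act (f b) v)‖ := Complex.re_le_norm _
      _ ≤ ‖v‖ * ‖act (f b) v‖ := norm_inner_le_norm _ _
      _ ≤ ‖v‖ * (Real.sqrt (hsSq (f b)) * ‖v‖) := by
          gcongr
          rw [← Real.sqrt_sq (norm_nonneg v), ← Real.sqrt_mul (hsSq_nonneg _)]
          exact Real.le_sqrt_of_sq_le (norm_act_sq_le _ _)
      _ = _ := by ring
  have hsum : ∑ b ∈ descendants K (anc K a), qf (f b) v ≤ C * ‖v‖ ^ 2 := by
    calc ∑ b ∈ descendants K (anc K a), qf (f b) v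
        ≤ ∑ b ∈ descendants K (anc K a) ∪ s, qf (f b) v :=
          Finset.sum_le_sum_of_subset_of_nonneg Finset.subset_union_left
            fun b _ _ => qf_nonneg (hf b) v
      _ = ∑ b ∈ s, qf (f b) v := by
          refine (Finset.sum_subset Finset.subset_union_right fun b _ hb => ?_).symm
          rw [hs b hb]; simp [qf, act]
      _ ≤ _ := by
          rw [hC, Finset.sum_mul]
          exact Finset.sum_le_sum fun b _ => hqf b
  have hKd : (2 : ℝ) ^ K ≤ 2 ^ (K * d) := pow_le_pow_right₀ one_le_two (Nat.le_mul_of_pos_right K hd)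
  have h2 : C ≤ lam * 2 ^ (K * d) := by
    rw [div_lt_iff₀ hlam] at hK
    nlinarith
  rw [branch, Nat.sub_zero, qf_avg, inv_mul_le_iff₀ (by positivity)]
  calc _ ≤ C * ‖v‖ ^ 2 := hsum
    _ ≤ lam * 2 ^ (K * d) * ‖v‖ ^ 2 := by gcongr
    _ = _ := by ring

/-! ### Geometry of dyadic cubes -/

section Geometry

variable {d : ℕ}

/-- The index of the dyadic cube of generation `n` containing a point. -/
noncomputable def cubeIndex (n : ℤ) (x : E d) : Fin d → ℤ := fun i => ⌊(2 : ℝ) ^ n * x i⌋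

lemma sideLength_pos (n : ℤ) : 0 < sideLength n := by unfold sideLength; positivity

lemma sideLength_sub (n : ℤ) (k : ℕ) : sideLength (n - k) = 2 ^ k * sideLength n := by
  rw [sideLength, sideLength, neg_sub, sub_eq_add_neg, zpow_add₀ two_ne_zero, zpow_natCast]

lemma mem_dyadicCube {n : ℤ} {a : Fin d → ℤ} {x : E d} :
    x ∈ dyadicCube n a ↔ cubeIndex n x = a := by
  have h2 : (0 : ℝ) < 2 ^ n := by positivity
  rw [dyadicCube, Set.mem_ofPred_eq, funext_iff]
  refine forall_congr' fun i => ?_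
  rw [cubeIndex, Int.floor_eq_iff, sideLength, zpow_neg, inv_mul_le_iff₀ h2,
    ← div_eq_inv_mul, lt_div_iff₀ h2, mul_comm (x i)]

lemma measurable_cubeIndex (n : ℤ) : Measurable (cubeIndex n : E d → Fin d → ℤ) := by
  refine measurable_pi_lambda _ fun i => ?_
  have : Measurable fun x : E d => (2 : ℝ) ^ n * x i := by fun_prop
  exact Int.measurable_floor.comp this

lemma measurableSet_dyadicCube (n : ℤ) (a : Fin d → ℤ) : MeasurableSet (dyadicCube n a) := by
  have : dyadicCube n a = cubeIndex n ⁻¹' {a} := by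
    ext x; exact mem_dyadicCube
  rw [this]
  exact measurable_cubeIndex n (measurableSet_singleton a)

lemma volume_dyadicCube (n : ℤ) (a : Fin d → ℤ) :
    volume (dyadicCube n a) = ENNReal.ofReal (sideLength n ^ d) := by
  have h1 : dyadicCube n a = (WithLp.ofLp : E d → Fin d → ℝ) ⁻¹' Set.univ.pi fun i =>
      Set.Ico (sideLength n * (a i : ℝ)) (sideLength n * ((a i : ℝ) + 1)) := by
    ext x; simp [dyadicCube]
  rw [h1, (PiLp.volume_preserving_ofLp (Fin d)).measure_preimage
    (MeasurableSet.univ_pi fun i => measurableSet_Ico).nullMeasurableSet, volume_pi_pi]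
  simp only [Real.volume_Ico]
  rw [← ENNReal.ofReal_prod_of_nonneg (fun i _ => by have := sideLength_pos n; nlinarith)]
  congr 1
  rw [Finset.prod_congr rfl fun i _ => show _ = sideLength n by ring]
  simp

lemma volume_dyadicCube_ne_top (n : ℤ) (a : Fin d → ℤ) : volume (dyadicCube n a) ≠ ∞ := by
  rw [volume_dyadicCube]; exact ENNReal.ofReal_ne_top

lemma dyadicCube_subset_anc (n : ℤ) (k : ℕ) (b : Fin d → ℤ) :
    dyadicCube n b ⊆ dyadicCube (n - k) (anc k b) := by
  intro x hx i
  have h2 : (0 : ℤ) < 2 ^ k := by positivity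
  have hl := sideLength_pos n
  rw [sideLength_sub, mul_right_comm, mul_right_comm _ _ ((anc k b i : ℝ) + 1),
    mul_comm _ (sideLength n), mul_comm _ (sideLength n)]
  have h3 : (2 : ℝ) ^ k * (anc k b i : ℝ) ≤ b i := by
    exact_mod_cast (Int.mul_ediv_self_le h2.ne' : 2 ^ k * (b i / 2 ^ k) ≤ b i)
  have h4 : (b i : ℝ) + 1 ≤ 2 ^ k * ((anc k b i : ℝ) + 1) := by
    have : b i + 1 ≤ 2 ^ k * (b i / 2 ^ k + 1) := by
      have := Int.lt_mul_ediv_self_add (x := b i) h2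
      linarith
    exact_mod_cast this
  exact ⟨(mul_le_mul_of_nonneg_left h3 hl.le).trans (hx i).1,
    (hx i).2.trans_le (mul_le_mul_of_nonneg_left h4 hl.le)⟩

/-- The crude factor d suffices: `farFrom` starts at radius 2^d times the side length, and d < 2^d.
-/
lemma norm_sub_cubeCenter_le {n : ℤ} {a : Fin d → ℤ} {x : E d} (hx : x ∈ dyadicCube n a) :
    ‖x - cubeCenter n a‖ ≤ d * sideLength n := by
  have hl := sideLength_pos n
  refine le_of_sq_le_sq ?_ (by positivity)
  rw [EuclideanSpace.norm_sq_eq]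
  calc ∑ i, ‖(x - cubeCenter n a) i‖ ^ 2 ≤ ∑ _i : Fin d, sideLength n ^ 2 := by
        refine Finset.sum_le_sum fun i _ => ?_
        rw [Real.norm_eq_abs, sq_abs, sq_le_sq, abs_of_pos hl, abs_le]
        have := hx i
        simp only [cubeCenter, PiLp.sub_apply]
        constructor <;> nlinarith
    _ = d * sideLength n ^ 2 := by simp
    _ ≤ (d * sideLength n) ^ 2 := by
        rw [mul_pow]
        gcongr
        exact_mod_cast Nat.le_self_pow two_ne_zero d

/-- The volume of the Euclidean unit ball. -/
noncomputable def unitVol (d : ℕ) : ℝ≥0∞ := volume (Metric.ball (0 : E d) 1)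

lemma unitVol_ne_top (d : ℕ) : unitVol d ≠ ∞ := measure_ball_lt_top.ne

lemma volume_closedBall_eq (c : E d) {r : ℝ} (hr : 0 ≤ r) :
    volume (Metric.closedBall c r) = ENNReal.ofReal (r ^ d) * unitVol d := by
  rw [Measure.addHaar_closedBall _ _ hr, finrank_euclideanSpace, Fintype.card_fin, unitVol]

lemma volume_annulus_le (c : E d) {l : ℝ} (hl : 0 ≤ l) (j : ℕ) :
    volume (annulus c l j) ≤
      ENNReal.ofReal (2 ^ d) * unitVol d * ENNReal.ofReal (2 ^ (j * d) * l ^ d) := by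
  calc volume (annulus c l j) ≤ volume (Metric.closedBall c (2 ^ (j + 1) * l)) := by
        refine measure_mono fun x hx => ?_
        rw [Metric.mem_closedBall, dist_eq_norm]
        exact hx.2
    _ = _ := by
        rw [volume_closedBall_eq _ (by positivity), mul_right_comm,
          ← ENNReal.ofReal_mul (by positivity)]
        congr 2
        rw [mul_pow, ← pow_mul, add_mul, one_mul, pow_add]
        ring

/-- The points far away from a cube are covered by the dyadic annuli around its center. -/
lemma exists_mem_annulus {c x : E d} {l : ℝ} (hl : 0 < l) {j₀ : ℕ} (h : 2 ^ j₀ * l ≤ ‖x - c‖) :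
    ∃ j, j₀ ≤ j ∧ x ∈ annulus c l j := by
  have h1 : 1 ≤ ‖x - c‖ / l := by
    rw [le_div_iff₀ hl, one_mul]
    refine le_trans ?_ h
    exact le_mul_of_one_le_left hl.le (one_le_pow₀ one_le_two)
  obtain ⟨j, hj1, hj2⟩ := exists_nat_pow_near h1 one_lt_two
  rw [le_div_iff₀ hl] at hj1
  rw [div_lt_iff₀ hl] at hj2
  refine ⟨j, ?_, hj1, hj2.le⟩
  by_contra hlt
  have : (2 : ℝ) ^ (j + 1) ≤ 2 ^ j₀ := pow_le_pow_right₀ one_le_two (by omega)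
  nlinarith

end Geometry

/-! ### Cauchy-Schwarz inequalities for integrals -/

section CauchySchwarz

variable {α : Type*} [MeasurableSpace α] {μ : Measure α}

lemma lintegral_le_sqrt_mul_sqrt {h : α → ℝ≥0∞} (hh : AEMeasurable h μ) :
    ∫⁻ x, h x ∂μ ≤ μ Set.univ ^ (1 / 2 : ℝ) * (∫⁻ x, h x ^ 2 ∂μ) ^ (1 / 2 : ℝ) := by
  have := ENNReal.lintegral_mul_le_Lp_mul_Lq μ Real.HolderConjugate.two_two
    (f := fun _ => 1) (g := h) aemeasurable_const hh
  simpa using this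

lemma lintegral_sqrt_le {h : α → ℝ≥0∞} (hh : AEMeasurable h μ) :
    ∫⁻ x, h x ^ (1 / 2 : ℝ) ∂μ ≤ μ Set.univ ^ (1 / 2 : ℝ) * (∫⁻ x, h x ∂μ) ^ (1 / 2 : ℝ) := by
  refine (lintegral_le_sqrt_mul_sqrt (hh.pow_const _)).trans_eq ?_
  congr 3
  ext x
  rw [← ENNReal.rpow_natCast, ← ENNReal.rpow_mul]
  norm_num

/-- No integrability is needed, because the Bochner integral of a nonintegrable function is 0. -/
lemma enorm_integral_sq_le {F : Type*} [NormedAddCommGroup F] [NormedSpace ℝ F] (g : α → F) :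
    ‖∫ x, g x ∂μ‖ₑ ^ 2 ≤ μ Set.univ * ∫⁻ x, ‖g x‖ₑ ^ 2 ∂μ := by
  by_cases hg : Integrable g μ
  · calc ‖∫ x, g x ∂μ‖ₑ ^ 2 ≤ (∫⁻ x, ‖g x‖ₑ ∂μ) ^ 2 := by
          gcongr; exact enorm_integral_le_lintegral_enorm g
      _ ≤ (μ Set.univ ^ (1 / 2 : ℝ) * (∫⁻ x, ‖g x‖ₑ ^ 2 ∂μ) ^ (1 / 2 : ℝ)) ^ 2 := by
          gcongr; exact lintegral_le_sqrt_mul_sqrt hg.aestronglyMeasurable.enorm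
      _ = _ := by
          rw [mul_pow, ← ENNReal.rpow_natCast, ← ENNReal.rpow_natCast, ← ENNReal.rpow_mul,
            ← ENNReal.rpow_mul]
          norm_num
  · rw [integral_undef hg]; simp

lemma enorm_sq_eq_lintegral (g : Lp ℂ 2 μ) : ‖g‖ₑ ^ 2 = ∫⁻ x, ‖g x‖ₑ ^ 2 ∂μ := by
  have := eLpNorm_nnreal_pow_eq_lintegral (f := (g : α → ℂ)) (μ := μ) (p := 2) two_ne_zero
  rw [Lp.enorm_def]
  simpa using this

lemma coeFn_sum_smul {p : ℝ≥0∞} {ι : Type*} (s : Finset ι) (c : ι → ℂ) (g : ι → Lp ℂ p μ) :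
    (↑(∑ i ∈ s, c i • g i) : α → ℂ) =ᵐ[μ] fun x => ∑ i ∈ s, c i * g i x := by
  classical
  induction s using Finset.induction_on with
  | empty => exact Lp.coeFn_zero ℂ p μ
  | insert a s ha ih =>
    rw [Finset.sum_insert ha]
    filter_upwards [Lp.coeFn_add (c a • g a) (∑ i ∈ s, c i • g i), Lp.coeFn_smul (c a) (g a), ih]
      with x h1 h2 h3
    rw [h1, Pi.add_apply, h2, h3, Finset.sum_insert ha, Pi.smul_apply, smul_eq_mul]

end CauchySchwarz

/-! ### Dyadic step functions -/

section Step

variable {d : ℕ}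

/-- The indicator function of a dyadic cube, as an element of `L_2`. -/
noncomputable def cubeL2 (n : ℤ) (a : Fin d → ℤ) : L2 d :=
  indicatorConstLp 2 (measurableSet_dyadicCube n a) (volume_dyadicCube_ne_top n a) (1 : ℂ)

lemma coeFn_cubeL2 (n : ℤ) (a : Fin d → ℤ) :
    (cubeL2 n a : E d → ℂ) =ᵐ[volume] (dyadicCube n a).indicator fun _ => (1 : ℂ) :=
  indicatorConstLp_coeFn

lemma sum_mul_indicator_dyadicCube (n : ℤ) (s : Finset (Fin d → ℤ)) (c : (Fin d → ℤ) → ℂ)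
    (x : E d) : ∑ a ∈ s, c a * (dyadicCube n a).indicator (fun _ => (1 : ℂ)) x =
      if cubeIndex n x ∈ s then c (cubeIndex n x) else 0 := by
  classical
  have : ∀ a, c a * (dyadicCube n a).indicator (fun _ => (1 : ℂ)) x =
      if cubeIndex n x = a then c a else 0 := fun a => by
    rw [Set.indicator_apply, mem_dyadicCube]
    split_ifs <;> simp
  simp_rw [this]
  exact Finset.sum_ite_eq _ _ _

lemma lintegral_comp_cubeIndex (n : ℤ) (s : Finset (Fin d → ℤ)) (F : (Fin d → ℤ) → ℝ≥0∞) :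
    ∫⁻ x : E d, (if cubeIndex n x ∈ s then F (cubeIndex n x) else 0) =
      ENNReal.ofReal (sideLength n ^ d) * ∑ a ∈ s, F a := by
  classical
  have h : ∀ x : E d, (if cubeIndex n x ∈ s then F (cubeIndex n x) else 0) =
      ∑ a ∈ s, (dyadicCube n a).indicator (fun _ => F a) x := fun x => by
    simp_rw [Set.indicator_apply, mem_dyadicCube]
    exact (Finset.sum_ite_eq _ _ _).symm
  simp_rw [h]
  rw [lintegral_finsetSum _ fun a _ => measurable_const.indicator (measurableSet_dyadicCube n a),
    Finset.mul_sum]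
  refine Finset.sum_congr rfl fun a _ => ?_
  rw [lintegral_indicator_const (measurableSet_dyadicCube n a), volume_dyadicCube, mul_comm]

lemma lintegral_enorm_sum_sq_le (T : L2 d →L[ℂ] L2 d) (n : ℤ) (s : Finset (Fin d → ℤ))
    (c : (Fin d → ℤ) → ℂ) :
    ∫⁻ x, ‖∑ a ∈ s, c a * T (cubeL2 n a) x‖ₑ ^ 2 ≤
      ‖T‖ₑ ^ 2 * (ENNReal.ofReal (sideLength n ^ d) * ∑ a ∈ s, ‖c a‖ₑ ^ 2) := by
  set g : L2 d := ∑ a ∈ s, c a • cubeL2 n a with hg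
  have h1 : ∫⁻ x, ‖∑ a ∈ s, c a * T (cubeL2 n a) x‖ₑ ^ 2 = ‖T g‖ₑ ^ 2 := by
    rw [enorm_sq_eq_lintegral]
    refine lintegral_congr_ae ?_
    have := coeFn_sum_smul s c fun a => T (cubeL2 n a)
    rw [hg, map_sum]
    simp_rw [map_smul]
    filter_upwards [this] with x hx
    rw [hx]
  have h2 : ‖g‖ₑ ^ 2 = ENNReal.ofReal (sideLength n ^ d) * ∑ a ∈ s, ‖c a‖ₑ ^ 2 := by
    rw [enorm_sq_eq_lintegral, ← lintegral_comp_cubeIndex]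
    refine lintegral_congr_ae ?_
    filter_upwards [coeFn_sum_smul s c fun a => cubeL2 n a,
      (eventually_countable_forall.2 fun a : Fin d → ℤ => coeFn_cubeL2 n a)] with x h1 h2
    rw [h1]
    simp_rw [h2]
    rw [sum_mul_indicator_dyadicCube]
    split_ifs <;> simp
  rw [h1, ← h2, ← mul_pow]
  gcongr
  exact T.le_opENorm g

/-- Kernel representation of `T` applied to indicators of dyadic cubes. -/
lemma ae_eq_setIntegral {T : L2 d →L[ℂ] L2 d} {k : E d → E d → ℂ} (hT : IsCZOperator T k) (n : ℤ)
    (b : Fin d → ℤ) {K : Set (E d)} (hK : IsCompact K) (hbK : dyadicCube n b ⊆ K) :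
    ∀ᵐ x, x ∉ K → IntegrableOn (k x) (dyadicCube n b) ∧
      T (cubeL2 n b) x = ∫ y in dyadicCube n b, k x y := by
  classical
  have h1 : ∃ M : ℝ, ∀ᵐ y, ‖(cubeL2 n b : E d → ℂ) y‖ ≤ M := by
    refine ⟨1, ?_⟩
    filter_upwards [coeFn_cubeL2 n b] with y hy
    rw [hy, Set.indicator_apply]
    split_ifs <;> simp
  have h2 : ∀ᵐ y, y ∉ K → (cubeL2 n b : E d → ℂ) y = 0 := by
    filter_upwards [coeFn_cubeL2 n b] with y hy hyK
    rw [hy, Set.indicator_of_notMem fun h => hyK (hbK h)]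
  filter_upwards [hT.representation _ K hK h1 h2] with x hx hxK
  have h3 : (fun y => k x y * (cubeL2 n b : E d → ℂ) y) =ᵐ[volume]
      (dyadicCube n b).indicator (k x) := by
    filter_upwards [coeFn_cubeL2 n b] with y hy
    rw [hy, Set.indicator_apply, Set.indicator_apply]
    split_ifs <;> simp
  obtain ⟨h4, h5⟩ := hx hxK
  refine ⟨(integrable_indicator_iff (measurableSet_dyadicCube n b)).1 (h4.congr h3), ?_⟩
  rw [h5, integral_congr_ae h3, integral_indicator (measurableSet_dyadicCube n b)]

end Step

/-! ### Integrals of the kernel away from a cube -/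

section Far

variable {d : ℕ}

/-- The square mean of `k(x, ·) - k(x, c)` over a dyadic cube (not normalized). -/
noncomputable def kernelSq (k : E d → E d → ℂ) (n : ℤ) (b : Fin d → ℤ) (c x : E d) : ℝ≥0∞ :=
  ∫⁻ y in dyadicCube n b, ‖k x y - k x c‖ₑ ^ 2

/-- The points far away from a dyadic cube. -/
def farFrom (n : ℤ) (J : Fin d → ℤ) : Set (E d) := {x | 2 ^ d * sideLength n ≤ ‖x - cubeCenter n J‖}

lemma measurableSet_farFrom (n : ℤ) (J : Fin d → ℤ) : MeasurableSet (farFrom n J) := by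
  have h : Measurable fun x : E d => ‖x - cubeCenter n J‖ := by fun_prop
  exact measurableSet_le measurable_const h

lemma volume_compl_farFrom_le (n : ℤ) (J : Fin d → ℤ) :
    volume (farFrom n J)ᶜ ≤
      ENNReal.ofReal (2 ^ (d * d)) * unitVol d * ENNReal.ofReal (sideLength n ^ d) := by
  have hl := sideLength_pos n
  calc volume (farFrom n J)ᶜ
      ≤ volume (Metric.closedBall (cubeCenter n J) (2 ^ d * sideLength n)) := by
        refine measure_mono fun x hx => ?_
        rw [Metric.mem_closedBall, dist_eq_norm]
        exact (not_le.1 (show ¬ 2 ^ d * sideLength n ≤ ‖x - cubeCenter n J‖ from hx)).le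
    _ = _ := by
        rw [volume_closedBall_eq _ (by positivity), mul_right_comm,
          ← ENNReal.ofReal_mul (by positivity), mul_pow, ← pow_mul]

lemma notMem_closedBall_of_mem_farFrom {n : ℤ} {J : Fin d → ℤ} {x : E d} (hx : x ∈ farFrom n J) :
    x ∉ Metric.closedBall (cubeCenter n J) (d * sideLength n) := by
  rw [Metric.mem_closedBall, dist_eq_norm, not_le]
  refine lt_of_lt_of_le ?_ hx
  have : (d : ℝ) < 2 ^ d := by exact_mod_cast Nat.lt_two_pow_self
  have := sideLength_pos n
  gcongr

variable {k : E d → E d → ℂ}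
  (hk : AEStronglyMeasurable (Function.uncurry k)
    ((volume : Measure (E d)).prod (volume : Measure (E d))))
  (hk' : ∀ y : E d, AEStronglyMeasurable (fun x => k x y) volume)

include hk hk'

lemma aemeasurable_enorm_sub_sq (c : E d) :
    AEMeasurable (fun z : E d × E d => ‖k z.1 z.2 - k z.1 c‖ₑ ^ 2)
      ((volume : Measure (E d)).prod (volume : Measure (E d))) := by
  have h : AEStronglyMeasurable (fun z : E d × E d => k z.1 c)
      ((volume : Measure (E d)).prod (volume : Measure (E d))) := (hk' c).comp_fst
  exact (hk.sub h).enorm.pow_const 2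

lemma aemeasurable_kernelSq (n : ℤ) (b : Fin d → ℤ) (c : E d) :
    AEMeasurable (kernelSq k n b c) volume := by
  refine AEMeasurable.lintegral_prod_right' (f := fun z : E d × E d => ‖k z.1 z.2 - k z.1 c‖ₑ ^ 2) ?_
  refine (aemeasurable_enorm_sub_sq hk hk' c).mono_measure ?_
  have := Measure.prod_restrict (μ := (volume : Measure (E d))) (ν := (volume : Measure (E d)))
    Set.univ (dyadicCube n b)
  rw [Measure.restrict_univ] at this
  rw [this]
  exact Measure.restrict_le_self

lemma lintegral_annulus_kernelSq (n : ℤ) (b : Fin d → ℤ) (c : E d) (S : Set (E d)) :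
    ∫⁻ x in S, kernelSq k n b c x =
      ∫⁻ y in dyadicCube n b, ∫⁻ x in S, ‖k x y - k x c‖ₑ ^ 2 := by
  refine lintegral_lintegral_swap (f := fun x y => ‖k x y - k x c‖ₑ ^ 2) ?_
  refine (aemeasurable_enorm_sub_sq hk hk' c).mono_measure ?_
  rw [Measure.prod_restrict]
  exact Measure.restrict_le_self

/-- The contribution of a single dyadic cube away from itself. -/
lemma lintegral_farFrom_le (hd : 0 < d) (N : ℤ) (l : ℕ) (J : Fin d → ℤ)
    (w : (Fin d → ℤ) → ℝ≥0∞) (hw : ∀ b, w b ≠ ∞) :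
    ∫⁻ x in farFrom (N - l) J, (ENNReal.ofReal (sideLength N ^ d) *
        ∑ b ∈ descendants l J, w b * kernelSq k N b (cubeCenter (N - l) J) x) ^ (1 / 2 : ℝ) ≤
      (ENNReal.ofReal (2 ^ d) * unitVol d) ^ (1 / 2 : ℝ) * (ENNReal.ofReal (sideLength N ^ d) *
        ((∑ b ∈ descendants l J, w b) ^ (1 / 2 : ℝ) * l2Hormander k)) := by
  set n := N - l with hn
  set c := cubeCenter n J with hc
  set δ := ENNReal.ofReal (sideLength N ^ d) with hδ
  have hln := sideLength_pos n
  have hδtop : δ ≠ ∞ := ENNReal.ofReal_ne_top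
  set Φ : E d → ℝ≥0∞ := fun x => δ * ∑ b ∈ descendants l J, w b * kernelSq k N b c x with hΦ
  have hmeas : AEMeasurable Φ volume :=
    (Finset.aemeasurable_fun_sum _ fun b _ =>
      (aemeasurable_kernelSq hk hk' N b c).const_mul _).const_mul _
  set S : {j : ℕ // 1 ≤ j} → ℝ≥0∞ := fun j => ⨆ y ∈ dyadicCube n J,
    (ENNReal.ofReal ((2 : ℝ) ^ ((j : ℕ) * d) * sideLength n ^ d) *
      ∫⁻ x in annulus (cubeCenter n J) (sideLength n) j,
        ‖k x y - k x (cubeCenter n J)‖ₑ ^ 2) ^ (1 / 2 : ℝ) with hS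
  have hSH : ∑' j, S j ≤ l2Hormander k :=
    le_iSup₂ (f := fun (n : ℤ) (a : Fin d → ℤ) => ∑' j : {j : ℕ // 1 ≤ j}, ⨆ y ∈ dyadicCube n a,
    (ENNReal.ofReal ((2 : ℝ) ^ ((j : ℕ) * d) * sideLength n ^ d) *
      ∫⁻ x in annulus (cubeCenter n a) (sideLength n) j,
        ‖k x y - k x (cubeCenter n a)‖ₑ ^ 2) ^ (1 / 2 : ℝ)) n J
  -- The small cube b lies in J, so after exchanging integrals the Hörmander supremum over y in J
  -- bounds the inner integral, and δ is the volume of b.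
  have hann : ∀ j : {j : ℕ // 1 ≤ j}, ∀ b ∈ descendants l J,
      ENNReal.ofReal ((2 : ℝ) ^ ((j : ℕ) * d) * sideLength n ^ d) *
        ∫⁻ x in annulus c (sideLength n) j, kernelSq k N b c x ≤ δ * S j ^ 2 := by
    intro j b hb
    rw [lintegral_annulus_kernelSq hk hk', ← lintegral_const_mul' _ _ ENNReal.ofReal_ne_top]
    calc _ ≤ ∫⁻ y in dyadicCube N b, S j ^ 2 := by
          refine setLIntegral_mono' (measurableSet_dyadicCube N b) fun y hy => ?_
          have hyJ : y ∈ dyadicCube n J := by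
            have := dyadicCube_subset_anc N l b hy
            rwa [mem_descendants.1 hb] at this
          have h1 := le_iSup₂ (f := fun y (_ : y ∈ dyadicCube n J) =>
            (ENNReal.ofReal ((2 : ℝ) ^ ((j : ℕ) * d) * sideLength n ^ d) *
              ∫⁻ x in annulus (cubeCenter n J) (sideLength n) j,
                ‖k x y - k x (cubeCenter n J)‖ₑ ^ 2) ^ (1 / 2 : ℝ)) y hyJ
          have h2 := pow_le_pow_left' h1 2
          rw [← ENNReal.rpow_natCast, ← ENNReal.rpow_mul,
            show (1 / 2 : ℝ) * ((2 : ℕ) : ℝ) = 1 by norm_num, ENNReal.rpow_one] at h2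
          exact h2
      _ = δ * S j ^ 2 := by
          rw [setLIntegral_const, volume_dyadicCube, mul_comm]
  -- The radius 2^d·ℓ makes every annulus index at least d ≥ 1, as the Hörmander sum requires.
  have hcover : farFrom n J ⊆ ⋃ j : {j : ℕ // 1 ≤ j}, annulus c (sideLength n) j := by
    intro x hx
    obtain ⟨j, hj, hxj⟩ := exists_mem_annulus hln hx
    exact Set.mem_iUnion.2 ⟨⟨j, by omega⟩, hxj⟩
  calc ∫⁻ x in farFrom n J, Φ x ^ (1 / 2 : ℝ)
      ≤ ∫⁻ x in ⋃ j : {j : ℕ // 1 ≤ j}, annulus c (sideLength n) j, Φ x ^ (1 / 2 : ℝ) :=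
        lintegral_mono_set hcover
    _ ≤ ∑' j : {j : ℕ // 1 ≤ j}, ∫⁻ x in annulus c (sideLength n) j, Φ x ^ (1 / 2 : ℝ) :=
        lintegral_iUnion_le _ _
    _ ≤ ∑' j, (ENNReal.ofReal (2 ^ d) * unitVol d) ^ (1 / 2 : ℝ) *
          (δ * ((∑ b ∈ descendants l J, w b) ^ (1 / 2 : ℝ) * S j)) := by
        refine ENNReal.tsum_le_tsum fun j => ?_
        set W := ENNReal.ofReal ((2 : ℝ) ^ ((j : ℕ) * d) * sideLength n ^ d) with hW
        have hint : W * ∫⁻ x in annulus c (sideLength n) j, Φ x ≤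
            (δ * S j) ^ 2 * ∑ b ∈ descendants l J, w b := by
          have e1 : ∫⁻ x in annulus c (sideLength n) j, Φ x =
              δ * ∑ b ∈ descendants l J,
                w b * ∫⁻ x in annulus c (sideLength n) j, kernelSq k N b c x := by
            rw [hΦ, lintegral_const_mul' _ _ hδtop, lintegral_finsetSum' _ fun b _ =>
              ((aemeasurable_kernelSq hk hk' N b c).const_mul _).restrict]
            congr 1
            refine Finset.sum_congr rfl fun b _ => lintegral_const_mul' _ _ (hw b)
          rw [e1, mul_left_comm, Finset.mul_sum, Finset.mul_sum, Finset.mul_sum]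
          refine Finset.sum_le_sum fun b hb => ?_
          calc δ * (W * (w b * ∫⁻ x in annulus c (sideLength n) j, kernelSq k N b c x))
              = δ * w b * (W * ∫⁻ x in annulus c (sideLength n) j, kernelSq k N b c x) := by ring
            _ ≤ δ * w b * (δ * S j ^ 2) := mul_le_mul' le_rfl (hann j b hb)
            _ = _ := by ring
        -- Cauchy-Schwarz on one annulus: its volume is at most a dimensional constant times W,
        -- exactly the weight in the Hörmander condition.
        calc ∫⁻ x in annulus c (sideLength n) j, Φ x ^ (1 / 2 : ℝ)
            ≤ (volume (annulus c (sideLength n) j)) ^ (1 / 2 : ℝ) *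
                (∫⁻ x in annulus c (sideLength n) j, Φ x) ^ (1 / 2 : ℝ) := by
              have := lintegral_sqrt_le (μ := volume.restrict (annulus c (sideLength n) j))
                hmeas.restrict
              rwa [Measure.restrict_apply_univ] at this
          _ ≤ (ENNReal.ofReal (2 ^ d) * unitVol d * W) ^ (1 / 2 : ℝ) *
                (∫⁻ x in annulus c (sideLength n) j, Φ x) ^ (1 / 2 : ℝ) := by
              gcongr
              exact volume_annulus_le c hln.le j
          _ = (ENNReal.ofReal (2 ^ d) * unitVol d) ^ (1 / 2 : ℝ) *
                (W * ∫⁻ x in annulus c (sideLength n) j, Φ x) ^ (1 / 2 : ℝ) := by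
              rw [ENNReal.mul_rpow_of_nonneg _ W (by norm_num),
                ENNReal.mul_rpow_of_nonneg W _ (by norm_num), mul_assoc]
          _ ≤ (ENNReal.ofReal (2 ^ d) * unitVol d) ^ (1 / 2 : ℝ) *
                ((δ * S j) ^ 2 * ∑ b ∈ descendants l J, w b) ^ (1 / 2 : ℝ) := by gcongr
          _ = _ := by
              rw [ENNReal.mul_rpow_of_nonneg ((δ * S j) ^ 2) _ (by norm_num),
                ← ENNReal.rpow_natCast (δ * S j), ← ENNReal.rpow_mul]
              norm_num
              ring
    _ ≤ _ := by
        rw [ENNReal.tsum_mul_left, ENNReal.tsum_mul_left, ENNReal.tsum_mul_left]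
        gcongr

end Far

/-! ### The weak type estimate for positive step functions -/

section Core

variable {d m : ℕ} {k : E d → E d → ℂ}

/-- Cancellation: a mean zero combination of images of cubes is controlled by the variation of the
kernel. -/
lemma ofReal_sqrt_hsSq_le (N : ℤ) (D : Finset (Fin d → ℤ))
    (Z : (Fin d → ℤ) → Matrix (Fin m) (Fin m) ℂ) (w : (Fin d → ℤ) → ℝ) (hw : ∀ b ∈ D, 0 ≤ w b)
    (hZ : ∀ κ : (Fin d → ℤ) → ℂ, hsSq (∑ b ∈ D, κ b • Z b) ≤ ∑ b ∈ D, w b * ‖κ b‖ ^ 2)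
    (hZ0 : ∑ b ∈ D, Z b = 0) (u : (Fin d → ℤ) → ℂ) (x c : E d)
    (hu : ∀ b ∈ D, IntegrableOn (k x) (dyadicCube N b) ∧
      u b = ∫ y in dyadicCube N b, k x y) :
    ENNReal.ofReal (Real.sqrt (hsSq (∑ b ∈ D, u b • Z b))) ≤
      (ENNReal.ofReal (sideLength N ^ d) *
        ∑ b ∈ D, ENNReal.ofReal (w b) * kernelSq k N b c x) ^ (1 / 2 : ℝ) := by
  set κ : (Fin d → ℤ) → ℂ := fun b => ∫ y in dyadicCube N b, (k x y - k x c) with hκ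
  have h1 : ∑ b ∈ D, u b • Z b = ∑ b ∈ D, κ b • Z b := by
    -- All cubes of generation N have the same volume, so subtracting k(x,c) changes every
    -- coefficient by the same scalar, which the mean-zero condition removes.
    have h2 : ∀ b ∈ D, κ b • Z b = u b • Z b - ((sideLength N ^ d : ℝ) * k x c) • Z b := by
      intro b hb
      obtain ⟨hi, he⟩ := hu b hb
      have hl := sideLength_pos N
      rw [← sub_smul]
      congr 1
      have hc : IntegrableOn (fun _ : E d => k x c) (dyadicCube N b) volume :=
        integrableOn_const (volume_dyadicCube_ne_top N b)
      change ∫ y in dyadicCube N b, (k x y - k x c) = _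
      rw [integral_sub hi hc, ← he,
        setIntegral_const, Measure.real, volume_dyadicCube, ENNReal.toReal_ofReal (by positivity),
        Complex.real_smul]
    rw [Finset.sum_congr rfl h2, Finset.sum_sub_distrib, ← Finset.smul_sum, hZ0, smul_zero,
      sub_zero]
  have h3 : ENNReal.ofReal (hsSq (∑ b ∈ D, κ b • Z b)) ≤
      ENNReal.ofReal (sideLength N ^ d) *
        ∑ b ∈ D, ENNReal.ofReal (w b) * kernelSq k N b c x := by
    refine (ENNReal.ofReal_le_ofReal (hZ κ)).trans ?_
    rw [ENNReal.ofReal_sum_of_nonneg fun b hb => mul_nonneg (hw b hb) (by positivity),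
      Finset.mul_sum]
    refine Finset.sum_le_sum fun b hb => ?_
    rw [ENNReal.ofReal_mul (hw b hb), mul_left_comm]
    refine mul_le_mul' le_rfl ?_
    rw [ENNReal.ofReal_pow (norm_nonneg _), ofReal_norm]
    have := enorm_integral_sq_le (μ := volume.restrict (dyadicCube N b)) fun y => k x y - k x c
    rwa [Measure.restrict_apply_univ, volume_dyadicCube] at this
  rw [h1, Real.sqrt_eq_rpow, ← ENNReal.ofReal_rpow_of_nonneg (hsSq_nonneg _) (by norm_num)]
  gcongr

/-- A constant, depending only on the dimension, for the bad part. -/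
noncomputable def badConst (d : ℕ) : ℝ≥0∞ := (ENNReal.ofReal (2 ^ d) * unitVol d) ^ (1 / 2 : ℝ)

/-- Weak type estimate for a sum of contributions of dyadic cubes, each of which has small rank,
and small Hilbert-Schmidt norm away from the cube. -/
lemma bad_estimate (hd : 0 < d)
    (hk : AEStronglyMeasurable (Function.uncurry k)
      ((volume : Measure (E d)).prod (volume : Measure (E d))))
    (hk' : ∀ y : E d, AEStronglyMeasurable (fun x => k x y) volume)
    (N : ℤ) {ι : Type*} (τ : Finset ι) (l : ι → ℕ) (J : ι → Fin d → ℤ) (tr : ι → ℝ)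
    (htr : ∀ i, 0 ≤ tr i) (w : ι → (Fin d → ℤ) → ℝ) {β : ℝ} (hβ : 0 ≤ β)
    (hw0 : ∀ i ∈ τ, ∀ b ∈ descendants (l i) (J i), 0 ≤ w i b)
    (hw : ∀ i ∈ τ, ∑ b ∈ descendants (l i) (J i), w i b ≤ (2 ^ (l i * d) * β) ^ 2 * tr i)
    (X : ι → E d → Matrix (Fin m) (Fin m) ℂ)
    (hX : ∀ᵐ x, ∀ i ∈ τ, ∃ P Q, X i x = P * Q ∧ ((P * Q).rank : ℝ≥0∞) ≤ ENNReal.ofReal (tr i) ∧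
      (x ∈ farFrom (N - l i) (J i) →
        ENNReal.ofReal (Real.sqrt (hsSq P) * Real.sqrt (hsSq Q)) ≤
          ENNReal.ofReal (Real.sqrt (tr i)) * (ENNReal.ofReal (sideLength N ^ d) *
            ∑ b ∈ descendants (l i) (J i), ENNReal.ofReal (w i b) *
              kernelSq k N b (cubeCenter (N - l i) (J i)) x) ^ (1 / 2 : ℝ)))
    {t : ℝ} (ht : 0 < t) :
    ∃ Φ : E d → ℝ≥0∞, AEMeasurable Φ volume ∧ (∀ᵐ x, trLevel t (∑ i ∈ τ, X i x) ≤ Φ x) ∧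
      ∫⁻ x, Φ x ≤ ENNReal.ofReal (sideLength N ^ d) *
        (∑ i ∈ τ, ENNReal.ofReal (2 ^ (l i * d) * tr i)) *
        (ENNReal.ofReal (2 ^ (d * d)) * unitVol d +
          (ENNReal.ofReal t)⁻¹ * (badConst d * (ENNReal.ofReal β * l2Hormander k))) := by
  classical
  set Ψ : ι → E d → ℝ≥0∞ := fun i x => (ENNReal.ofReal (sideLength N ^ d) *
    ∑ b ∈ descendants (l i) (J i), ENNReal.ofReal (w i b) *
      kernelSq k N b (cubeCenter (N - l i) (J i)) x) ^ (1 / 2 : ℝ) with hΨ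
  have hΨm : ∀ i, AEMeasurable (Ψ i) volume := fun i =>
    ((Finset.aemeasurable_fun_sum _ fun b _ =>
      (aemeasurable_kernelSq hk hk' N b _).const_mul _).const_mul _).pow_const _
  -- The majorant charges the rank bound tr i near the cube and the trace-norm bound divided by t
  -- away from it. Only this majorant is integrated, so the level function need not be shown
  -- measurable.
  set F : ι → E d → ℝ≥0∞ := fun i x =>
    (farFrom (N - l i) (J i))ᶜ.indicator (fun _ => ENNReal.ofReal (tr i)) x +
    (farFrom (N - l i) (J i)).indicator
      (fun x => (ENNReal.ofReal t)⁻¹ * (ENNReal.ofReal (Real.sqrt (tr i)) * Ψ i x)) x with hF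
  have hFm1 : ∀ i, AEMeasurable (fun x =>
      (farFrom (N - l i) (J i))ᶜ.indicator (fun _ => ENNReal.ofReal (tr i)) x) volume := fun i =>
    aemeasurable_const.indicator (measurableSet_farFrom _ _).compl
  have hFm : ∀ i, AEMeasurable (F i) volume := fun i =>
    (hFm1 i).add ((((hΨm i).const_mul _).const_mul _).indicator (measurableSet_farFrom _ _))
  refine ⟨fun x => ∑ i ∈ τ, F i x, Finset.aemeasurable_fun_sum _ fun i _ => hFm i, ?_, ?_⟩
  · filter_upwards [hX] with x hx
    choose! P Q h1 h2 h3 using hx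
    rw [Finset.sum_congr rfl h1]
    refine (trLevel_sum_le τ (fun i => x ∉ farFrom (N - l i) (J i)) P Q ht).trans ?_
    refine Finset.sum_le_sum fun i hi => ?_
    rw [hF]
    by_cases hxi : x ∈ farFrom (N - l i) (J i)
    · simp only [hxi, not_true_eq_false, if_false, Set.mem_compl_iff, not_false_eq_true,
        Set.indicator_of_notMem, Set.indicator_of_mem, zero_add]
      gcongr
      exact h3 i hi hxi
    · simp only [hxi, not_false_eq_true, if_true, Set.mem_compl_iff,
        Set.indicator_of_notMem, Set.indicator_of_mem, add_zero]
      exact h2 i hi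
  · rw [lintegral_finsetSum' _ fun i _ => hFm i, Finset.mul_sum, Finset.sum_mul]
    refine Finset.sum_le_sum fun i hi => ?_
    have hl := sideLength_pos N
    rw [hF, lintegral_add_left' (hFm1 i), mul_add]
    refine add_le_add ?_ ?_
    · rw [lintegral_indicator_const (measurableSet_farFrom _ _).compl]
      calc _ ≤ ENNReal.ofReal (tr i) * (ENNReal.ofReal (2 ^ (d * d)) * unitVol d *
            ENNReal.ofReal (sideLength (N - l i) ^ d)) :=
            mul_le_mul' le_rfl (volume_compl_farFrom_le _ _)
        _ = _ := by
            rw [sideLength_sub, mul_pow, ← pow_mul, ENNReal.ofReal_mul (by positivity),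
              ENNReal.ofReal_mul (p := 2 ^ (l i * d)) (by positivity)]
            ring
    · rw [lintegral_indicator (measurableSet_farFrom _ _),
        lintegral_const_mul' _ _ (by simp [ht]), lintegral_const_mul' _ _ ENNReal.ofReal_ne_top]
      have h1 := lintegral_farFrom_le hk hk' hd N (l i) (J i) (fun b => ENNReal.ofReal (w i b))
        fun b => ENNReal.ofReal_ne_top
      have h2 : (∑ b ∈ descendants (l i) (J i), ENNReal.ofReal (w i b)) ^ (1 / 2 : ℝ) ≤
          ENNReal.ofReal (2 ^ (l i * d) * β * Real.sqrt (tr i)) := by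
        rw [← ENNReal.ofReal_sum_of_nonneg (hw0 i hi)]
        calc _ ≤ ENNReal.ofReal ((2 ^ (l i * d) * β) ^ 2 * tr i) ^ (1 / 2 : ℝ) := by
              gcongr; exact hw i hi
          _ = _ := by
              have := htr i
              rw [ENNReal.ofReal_rpow_of_nonneg (by positivity) (by norm_num),
                ← Real.sqrt_eq_rpow, Real.sqrt_mul (by positivity), Real.sqrt_sq (by positivity)]
      -- One factor √(tr i) comes from the Hilbert-Schmidt norm of the projection and one from the
      -- sum of the weights; together they are linear in tr i, which can be summed.
      calc (ENNReal.ofReal t)⁻¹ * (ENNReal.ofReal (Real.sqrt (tr i)) *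
            ∫⁻ x in farFrom (N - l i) (J i), Ψ i x)
          ≤ (ENNReal.ofReal t)⁻¹ * (ENNReal.ofReal (Real.sqrt (tr i)) * (badConst d *
              (ENNReal.ofReal (sideLength N ^ d) *
                (ENNReal.ofReal (2 ^ (l i * d) * β * Real.sqrt (tr i)) * l2Hormander k)))) := by
            gcongr
            refine h1.trans ?_
            rw [badConst]
            gcongr
        _ = (ENNReal.ofReal t)⁻¹ * badConst d * ENNReal.ofReal (sideLength N ^ d) * l2Hormander k *
              (ENNReal.ofReal (Real.sqrt (tr i)) *
                ENNReal.ofReal (2 ^ (l i * d) * β * Real.sqrt (tr i))) := by ring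
        _ = (ENNReal.ofReal t)⁻¹ * badConst d * ENNReal.ofReal (sideLength N ^ d) * l2Hormander k *
              (ENNReal.ofReal (2 ^ (l i * d) * tr i) * ENNReal.ofReal β) := by
            rw [← ENNReal.ofReal_mul (Real.sqrt_nonneg _), ← ENNReal.ofReal_mul' hβ]
            congr 2
            have := Real.mul_self_sqrt (htr i)
            linear_combination 2 ^ (l i * d) * β * this
        _ = _ := by ring

/-- The constant in the weak type estimate for positive step functions. -/
noncomputable def coreConst (d : ℕ) : ℝ≥0∞ :=
  -- The first term is for the good part; each of the two off-diagonal parts contributes a near term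
  -- and a far term.
  ENNReal.ofReal (2 ^ d) + 2 * (ENNReal.ofReal (2 ^ (d * d)) * unitVol d +
    badConst d * ENNReal.ofReal (2 ^ (d + 1)))

lemma coreConst_ne_top (d : ℕ) : coreConst d ≠ ∞ := by
  have h1 := unitVol_ne_top d
  have h2 : badConst d ≠ ∞ :=
    ENNReal.rpow_ne_top_of_nonneg (by norm_num) (ENNReal.mul_ne_top ENNReal.ofReal_ne_top h1)
  unfold coreConst
  finiteness

/-- Writing F for the average, the matrices f_b + F sum to 2·2^(l d) F, and the bound c on the
compression of F by p turns this into a second copy of the factor 2^(l d)·2c. The square is what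
survives the root in `lintegral_farFrom_le`. -/
lemma sum_trace_weights_le {f : (Fin d → ℤ) → Matrix (Fin m) (Fin m) ℂ} (l : ℕ)
    (J : Fin d → ℤ) {p : Matrix (Fin m) (Fin m) ℂ} (hp : IsProjection p) {c : ℝ} (hc : 0 ≤ c)
    (hpF : ∀ v, qf (avg l f (corner l J)) (act p v) ≤ c * ‖v‖ ^ 2) :
    ∑ b ∈ descendants l J, 2 ^ (l * d) * (2 * c) *
      (p * (f b + avg l f (corner l J)) * p).trace.re ≤
      (2 ^ (l * d) * (2 * c)) ^ 2 * p.trace.re := by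
  have h5 := sum_descendants_eq_smul_avg l f (corner l J)
  rw [anc_corner] at h5
  have h6 : ∑ b ∈ descendants l J, (p * (f b + avg l f (corner l J)) * p).trace.re =
      2 ^ (l * d) * 2 * (p * avg l f (corner l J) * p).trace.re := by
    rw [← Complex.re_sum, ← Matrix.trace_sum, ← Finset.sum_mul, ← Finset.mul_sum,
      Finset.sum_add_distrib, h5, Finset.sum_const, card_descendants, ← Nat.cast_smul_eq_nsmul ℂ]
    push_cast
    rw [← add_smul, Matrix.mul_smul, Matrix.smul_mul, Matrix.trace_smul, smul_eq_mul,
      show (2 : ℂ) ^ (l * d) + 2 ^ (l * d) = ((2 ^ (l * d) * 2 : ℝ) : ℂ) by push_cast; ring,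
      Complex.re_ofReal_mul]
  rw [← Finset.mul_sum, h6]
  have := hp.trace_conj_le hpF
  calc 2 ^ (l * d) * (2 * c) * (2 ^ (l * d) * 2 * (p * avg l f (corner l J) * p).trace.re)
      ≤ 2 ^ (l * d) * (2 * c) * (2 ^ (l * d) * 2 * (c * p.trace.re)) := by gcongr
    _ = _ := by ring

lemma sum_qf_weights_le {f : (Fin d → ℤ) → Matrix (Fin m) (Fin m) ℂ} (l : ℕ)
    (J : Fin d → ℤ) {r : Matrix (Fin m) (Fin m) ℂ} {c : ℝ}
    (hrF : ∀ v, qf (avg l f (corner l J)) (act r v) ≤ c * ‖v‖ ^ 2) (v : Vec m) :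
    ∑ b ∈ descendants l J, qf (f b + avg l f (corner l J)) (act r v) ≤
      2 ^ (l * d) * (2 * c) * ‖v‖ ^ 2 := by
  have h5 := sum_descendants_eq_smul_avg l f (corner l J)
  rw [anc_corner] at h5
  simp_rw [qf_add]
  rw [Finset.sum_add_distrib, ← qf_sum, h5, qf_smul, Finset.sum_const, card_descendants,
    nsmul_eq_mul]
  push_cast
  have := hrF v
  calc _ = 2 ^ (l * d) * 2 * qf (avg l f (corner l J)) (act r v) := by ring
    _ ≤ 2 ^ (l * d) * 2 * (c * ‖v‖ ^ 2) := by gcongr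
    _ = _ := by ring

lemma sum_sub_avg_eq_zero (f : (Fin d → ℤ) → Matrix (Fin m) (Fin m) ℂ) (l : ℕ)
    (J : Fin d → ℤ) : ∑ b ∈ descendants l J, (f b - avg l f (corner l J)) = 0 := by
  have h5 := sum_descendants_eq_smul_avg l f (corner l J)
  rw [anc_corner] at h5
  rw [Finset.sum_sub_distrib, h5, Finset.sum_const, card_descendants, ← Nat.cast_smul_eq_nsmul ℂ]
  push_cast
  exact sub_self _

end Core

/-! ### Good and bad estimates for positive step functions -/

section CorePositive

variable {d m : ℕ} {k : E d → E d → ℂ}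

/-- Since p stands on the same side of every Z_b, it factors out of the whole sum: it bounds the
rank at every point and supplies a Hilbert-Schmidt factor √(tr p) far away. -/
lemma exists_factorization (N : ℤ) (D : Finset (Fin d → ℤ))
    (Z : (Fin d → ℤ) → Matrix (Fin m) (Fin m) ℂ) (w : (Fin d → ℤ) → ℝ) (hw : ∀ b ∈ D, 0 ≤ w b)
    (hZ : ∀ κ : (Fin d → ℤ) → ℂ, hsSq (∑ b ∈ D, κ b • Z b) ≤ ∑ b ∈ D, w b * ‖κ b‖ ^ 2)
    (hZ0 : ∑ b ∈ D, Z b = 0) {p : Matrix (Fin m) (Fin m) ℂ} (hp : IsProjection p)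
    (hside : (∀ b ∈ D, p * Z b = Z b) ∨ ∀ b ∈ D, Z b * p = Z b)
    (u : (Fin d → ℤ) → ℂ) (x c : E d) {far : Prop}
    (hu : far → ∀ b ∈ D, IntegrableOn (k x) (dyadicCube N b) ∧
      u b = ∫ y in dyadicCube N b, k x y) :
    ∃ P Q, ∑ b ∈ D, u b • Z b = P * Q ∧ ((P * Q).rank : ℝ≥0∞) ≤ ENNReal.ofReal p.trace.re ∧
      (far → ENNReal.ofReal (Real.sqrt (hsSq P) * Real.sqrt (hsSq Q)) ≤
        ENNReal.ofReal (Real.sqrt p.trace.re) * (ENNReal.ofReal (sideLength N ^ d) *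
          ∑ b ∈ D, ENNReal.ofReal (w b) * kernelSq k N b c x) ^ (1 / 2 : ℝ)) := by
  have hfar : far → ENNReal.ofReal (Real.sqrt p.trace.re) *
      ENNReal.ofReal (Real.sqrt (hsSq (∑ b ∈ D, u b • Z b))) ≤
        ENNReal.ofReal (Real.sqrt p.trace.re) * (ENNReal.ofReal (sideLength N ^ d) *
          ∑ b ∈ D, ENNReal.ofReal (w b) * kernelSq k N b c x) ^ (1 / 2 : ℝ) := fun h =>
    mul_le_mul' le_rfl (ofReal_sqrt_hsSq_le N D Z w hw hZ hZ0 u x c (hu h))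
  rw [← hp.rank_eq]
  rcases hside with h | h
  · refine ⟨p, ∑ b ∈ D, u b • Z b, ?_, ?_, fun hf => ?_⟩
    · rw [Finset.mul_sum]
      exact Finset.sum_congr rfl fun b hb => by rw [Matrix.mul_smul, h b hb]
    · exact_mod_cast Matrix.rank_mul_le_left _ _
    · rw [hp.hsSq_eq, ENNReal.ofReal_mul (Real.sqrt_nonneg _)]
      exact hfar hf
  · refine ⟨∑ b ∈ D, u b • Z b, p, ?_, ?_, fun hf => ?_⟩
    · rw [Finset.sum_mul]
      exact Finset.sum_congr rfl fun b hb => by rw [Matrix.smul_mul, h b hb]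
    · exact_mod_cast Matrix.rank_mul_le_right _ _
    · rw [hp.hsSq_eq, mul_comm, ENNReal.ofReal_mul (Real.sqrt_nonneg _)]
      exact hfar hf

/-- The value at a point of the image of a step function. -/
noncomputable def stepImage (T : L2 d →L[ℂ] L2 d) (N : ℤ) (s : Finset (Fin d → ℤ))
    (f : (Fin d → ℤ) → Matrix (Fin m) (Fin m) ℂ) (x : E d) : Matrix (Fin m) (Fin m) ℂ :=
  ∑ a ∈ s, (T (cubeL2 N a) : E d → ℂ) x • f a

lemma stepImage_add (T : L2 d →L[ℂ] L2 d) (N : ℤ) (s : Finset (Fin d → ℤ))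
    (f g : (Fin d → ℤ) → Matrix (Fin m) (Fin m) ℂ) (x : E d) :
    stepImage T N s (fun a => f a + g a) x = stepImage T N s f x + stepImage T N s g x := by
  simp [stepImage, smul_add, Finset.sum_add_distrib]

/-- The `L_2` estimate for step functions. -/
lemma good_estimate (T : L2 d →L[ℂ] L2 d) (N : ℤ) (s : Finset (Fin d → ℤ))
    (g : (Fin d → ℤ) → Matrix (Fin m) (Fin m) ℂ) {t : ℝ} (ht : 0 < t) :
    ∃ Φ : E d → ℝ≥0∞, AEMeasurable Φ volume ∧ (∀ x, trLevel t (stepImage T N s g x) ≤ Φ x) ∧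
      ∫⁻ x, Φ x ≤ (ENNReal.ofReal (t ^ 2))⁻¹ * (‖T‖ₑ ^ 2 * (ENNReal.ofReal (sideLength N ^ d) *
        ENNReal.ofReal (∑ a ∈ s, hsSq (g a)))) := by
  have hmeas : ∀ i j, AEMeasurable (fun x =>
      ‖∑ a ∈ s, g a i j * T (cubeL2 N a) x‖ₑ ^ 2) volume := fun i j => by
    refine AEMeasurable.pow_const (AEMeasurable.enorm ?_) 2
    exact Finset.aemeasurable_fun_sum _ fun a _ =>
      (Lp.aestronglyMeasurable (T (cubeL2 N a))).aemeasurable.const_mul _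
  refine ⟨fun x => (ENNReal.ofReal (t ^ 2))⁻¹ *
    ∑ i, ∑ j, ‖∑ a ∈ s, g a i j * T (cubeL2 N a) x‖ₑ ^ 2, ?_, fun x => ?_, ?_⟩
  · exact (Finset.aemeasurable_fun_sum _ fun i _ =>
      Finset.aemeasurable_fun_sum _ fun j _ => hmeas i j).const_mul _
  · dsimp only
    rw [mul_comm, ← div_eq_mul_inv, ENNReal.le_div_iff_mul_le (by simp [ht.ne']) (by simp),
      mul_comm]
    refine (sq_mul_trLevel_le _ ht.le).trans_eq ?_
    rw [hsSq, ENNReal.ofReal_sum_of_nonneg fun i _ => by positivity]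
    refine Finset.sum_congr rfl fun i _ => ?_
    rw [ENNReal.ofReal_sum_of_nonneg fun i _ => by positivity]
    refine Finset.sum_congr rfl fun j _ => ?_
    rw [ENNReal.ofReal_pow (norm_nonneg _), ofReal_norm]
    congr 2
    simp [stepImage, Matrix.sum_apply, mul_comm]
  · rw [lintegral_const_mul' _ _ (by simp [ht.ne'])]
    gcongr
    rw [lintegral_finsetSum' _ fun i _ => Finset.aemeasurable_fun_sum _ fun j _ => hmeas i j]
    calc ∑ i, ∫⁻ x, ∑ j, ‖∑ a ∈ s, g a i j * T (cubeL2 N a) x‖ₑ ^ 2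
        ≤ ∑ i, ∑ j, ‖T‖ₑ ^ 2 * (ENNReal.ofReal (sideLength N ^ d) *
            ∑ a ∈ s, ‖g a i j‖ₑ ^ 2) := by
          refine Finset.sum_le_sum fun i _ => ?_
          rw [lintegral_finsetSum' _ fun j _ => hmeas i j]
          exact Finset.sum_le_sum fun j _ => lintegral_enorm_sum_sq_le T N s fun a => g a i j
      _ = _ := by
          simp_rw [← Finset.mul_sum]
          congr 2
          rw [ENNReal.ofReal_sum_of_nonneg fun a _ => hsSq_nonneg _]
          simp_rw [hsSq]
          rw [Finset.sum_congr rfl fun i _ => Finset.sum_comm, Finset.sum_comm]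
          refine Finset.sum_congr rfl fun a _ => ?_
          rw [ENNReal.ofReal_sum_of_nonneg fun i _ => by positivity]
          refine Finset.sum_congr rfl fun i _ => ?_
          rw [ENNReal.ofReal_sum_of_nonneg fun i _ => by positivity]
          refine Finset.sum_congr rfl fun j _ => ?_
          rw [ENNReal.ofReal_pow (norm_nonneg _), ofReal_norm]

variable {T : L2 d →L[ℂ] L2 d}

/-- There are countably many cubes, so one null set serves them all. -/
lemma ae_forall_farFrom (hT : IsCZOperator T k) (N : ℤ) :
    ∀ᵐ x, ∀ (l : ℕ) (J : Fin d → ℤ), x ∈ farFrom (N - l) J → ∀ b ∈ descendants l J,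
      IntegrableOn (k x) (dyadicCube N b) ∧
        (T (cubeL2 N b) : E d → ℂ) x = ∫ y in dyadicCube N b, k x y := by
  rw [ae_all_iff]; intro l
  rw [ae_all_iff]; intro J
  have h : ∀ b ∈ descendants l J, ∀ᵐ x,
      x ∉ Metric.closedBall (cubeCenter (N - l) J) (d * sideLength (N - l)) →
        IntegrableOn (k x) (dyadicCube N b) ∧
          (T (cubeL2 N b) : E d → ℂ) x = ∫ y in dyadicCube N b, k x y := by
    intro b hb
    refine ae_eq_setIntegral hT N b (isCompact_closedBall _ _) fun y hy => ?_
    have h2 := dyadicCube_subset_anc N l b hy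
    rw [mem_descendants.1 hb] at h2
    rw [Metric.mem_closedBall, dist_eq_norm]
    exact norm_sub_cubeCenter_le h2
  filter_upwards [(Filter.eventually_all_finset (descendants l J)).2 h] with x hx hfar b hb
  exact hx b hb (notMem_closedBall_of_mem_farFrom hfar)

/-- The two off-diagonal bad parts. Here `q` is the projection opposite to the Cuculescu
difference `p`. -/
lemma side_estimate (hd : 0 < d) (hT : IsCZOperator T k) (N : ℤ) {t A : ℝ} (ht : 0 < t)
    (hA : 0 < A) (hH : l2Hormander k ≤ ENNReal.ofReal A)
    {f : (Fin d → ℤ) → Matrix (Fin m) (Fin m) ℂ} (hf : ∀ a, (f a).PosSemidef) {K : ℕ}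
    (h0 : ∀ a v, qf (branch K f a 0) v ≤ t / A * ‖v‖ ^ 2) {s : Finset (Fin d → ℤ)}
    (hs : Saturated K s)
    (Z : ℕ → (Fin d → ℤ) → Matrix (Fin m) (Fin m) ℂ)
    (hZ : (∀ i b, Z i b = cucDiff (t / A) (branch K f b) i * (f b - branch K f b (i + 1)) *
        cucSeq (t / A) (branch K f b) i) ∨
      ∀ i b, Z i b = cucSeq (t / A) (branch K f b) (i + 1) * (f b - branch K f b (i + 1)) *
        cucDiff (t / A) (branch K f b) i) :
    ∃ Φ : E d → ℝ≥0∞, AEMeasurable Φ volume ∧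
      (∀ᵐ x, trLevel t (stepImage T N s (fun a => ∑ i ∈ Finset.range K, Z i a) x) ≤ Φ x) ∧
      ∫⁻ x, Φ x ≤ (ENNReal.ofReal (2 ^ (d * d)) * unitVol d +
        badConst d * ENNReal.ofReal (2 ^ (d + 1))) * ENNReal.ofReal (A / t) *
          (ENNReal.ofReal (sideLength N ^ d) * ENNReal.ofReal (∑ a ∈ s, (f a).trace.re)) := by
  set lam := t / A with hlam
  have hlam0 : 0 < lam := by positivity
  set c := 2 ^ d * lam with hc
  have hc0 : 0 ≤ c := by positivity
  have hbr := posSemidef_branch hf K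
  have hgrow := qf_branch_succ_le hf K
  -- An index is a pair (i, J) with J a cube l generations above N. The difference p and the average
  -- F are constant on the descendants of J, so they are read off at a corner.
  set τ : Finset (Σ _ : ℕ, Fin d → ℤ) :=
    (Finset.range K).sigma fun i => s.image (anc (K - (i + 1))) with hτ
  set l : (Σ _ : ℕ, Fin d → ℤ) → ℕ := fun z => K - (z.1 + 1) with hl
  set p : (Σ _ : ℕ, Fin d → ℤ) → Matrix (Fin m) (Fin m) ℂ := fun z =>
    cucDiff lam (branch K f (corner (l z) z.2)) z.1 with hp
  have hpproj : ∀ z, IsProjection (p z) := fun z => isProjection_cucDiff _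
  set F : (Σ _ : ℕ, Fin d → ℤ) → Matrix (Fin m) (Fin m) ℂ := fun z =>
    avg (l z) f (corner (l z) z.2) with hF
  have hFpos : ∀ z, (F z).PosSemidef := fun z => posSemidef_avg hf _ _
  set M : (Σ _ : ℕ, Fin d → ℤ) → ℝ := fun z => 2 ^ (l z * d) * (2 * c) with hM
  have hM0 : ∀ z, 0 ≤ M z := fun z => by positivity
  set w : (Σ _ : ℕ, Fin d → ℤ) → (Fin d → ℤ) → ℝ := fun z b =>
    M z * (p z * (f b + F z) * p z).trace.re with hw
  have hpF : ∀ z v, qf (F z) (act (p z) v) ≤ c * ‖v‖ ^ 2 := fun z v =>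
    qf_succ_cucDiff_le hlam0.le (hbr _) (h0 _) (by positivity) (hgrow _) z.1 v
  have hdom : ∀ (z : Σ _ : ℕ, Fin d → ℤ), ∀ b ∈ descendants (l z) z.2, ∀ u v,
      ‖inner ℂ u (act (f b - F z) v)‖ ≤
        Real.sqrt (qf (f b + F z) u) * Real.sqrt (qf (f b + F z) v) := fun z b _ u v =>
    norm_inner_act_sub_le (hf b) (hFpos z) u v
  have hGpos : ∀ (z : Σ _ : ℕ, Fin d → ℤ), ∀ b ∈ descendants (l z) z.2,
      (f b + F z).PosSemidef := fun z b _ => (hf b).add (hFpos z)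
  have hw0 : ∀ z ∈ τ, ∀ b ∈ descendants (l z) z.2, 0 ≤ w z b := fun z _ b hb =>
    mul_nonneg (hM0 z) (by
      rw [(hpproj z).trace_conj]; exact (hpproj z).trace_mul_nonneg (hGpos z b hb))
  have hdesc : ∀ (z : Σ _ : ℕ, Fin d → ℤ), ∀ b ∈ descendants (l z) z.2,
      anc (K - (z.1 + 1)) b = anc (K - (z.1 + 1)) (corner (l z) z.2) := fun z b hb =>
    (mem_descendants.1 hb).trans (anc_corner _ _).symm
  have hpb : ∀ (z : Σ _ : ℕ, Fin d → ℤ), ∀ b ∈ descendants (l z) z.2,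
      cucDiff lam (branch K f b) z.1 = p z := fun z b hb => cucDiff_branch_congr (hdesc z b hb)
  have hFb : ∀ (z : Σ _ : ℕ, Fin d → ℤ), ∀ b ∈ descendants (l z) z.2,
      branch K f b (z.1 + 1) = F z := fun z b hb => avg_congr f (hdesc z b hb)
  -- The opposite projection r is q_i or q_{i+1}. For q_{i+1} the bound lam on F is direct; for q_i
  -- it costs the factor 2^d in c.
  have hZr : ∀ z : Σ _ : ℕ, Fin d → ℤ, ∃ r : Matrix (Fin m) (Fin m) ℂ, IsProjection r ∧
      (∀ v, qf (F z) (act r v) ≤ c * ‖v‖ ^ 2) ∧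
      ((∀ b ∈ descendants (l z) z.2, Z z.1 b = p z * (f b - F z) * r) ∨
        ∀ b ∈ descendants (l z) z.2, Z z.1 b = r * (f b - F z) * p z) := by
    intro z
    rcases hZ with hZ | hZ
    · refine ⟨cucSeq lam (branch K f (corner (l z) z.2)) z.1,
        isProjection_cucSeq hlam0.le (hbr _) _,
        qf_succ_cucSeq_le hlam0.le (hbr _) (h0 _) (by positivity) (hgrow _) z.1,
        Or.inl fun b hb => ?_⟩
      rw [hZ, hpb z b hb, hFb z b hb,
        cucSeq_branch_congr (anc_eq_of_le (by omega) (hdesc z b hb))]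
    · refine ⟨cucSeq lam (branch K f (corner (l z) z.2)) (z.1 + 1),
        isProjection_cucSeq hlam0.le (hbr _) _, fun v => ?_, Or.inr fun b hb => ?_⟩
      · refine (qf_cucSeq_le hlam0.le (hbr _) (h0 _) (z.1 + 1) v).trans ?_
        have : lam ≤ c := le_mul_of_one_le_left hlam0.le (one_le_pow₀ one_le_two)
        gcongr
      · rw [hZ, hpb z b hb, hFb z b hb, cucSeq_branch_congr (hdesc z b hb)]
  set X : (Σ _ : ℕ, Fin d → ℤ) → E d → Matrix (Fin m) (Fin m) ℂ := fun z x =>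
    ∑ b ∈ descendants (l z) z.2, (T (cubeL2 N b) : E d → ℂ) x • Z z.1 b with hXdef
  have hsum : ∀ x, stepImage T N s (fun a => ∑ i ∈ Finset.range K, Z i a) x = ∑ z ∈ τ, X z x := by
    intro x
    rw [hτ, Finset.sum_sigma, stepImage]
    simp_rw [Finset.smul_sum]
    rw [Finset.sum_comm]
    refine Finset.sum_congr rfl fun i _ => ?_
    rw [hs.sum_eq (Nat.sub_le K (i + 1))]
  have hX : ∀ᵐ x, ∀ z ∈ τ, ∃ P Q, X z x = P * Q ∧
      ((P * Q).rank : ℝ≥0∞) ≤ ENNReal.ofReal (p z).trace.re ∧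
      (x ∈ farFrom (N - l z) z.2 →
        ENNReal.ofReal (Real.sqrt (hsSq P) * Real.sqrt (hsSq Q)) ≤
          ENNReal.ofReal (Real.sqrt (p z).trace.re) * (ENNReal.ofReal (sideLength N ^ d) *
            ∑ b ∈ descendants (l z) z.2, ENNReal.ofReal (w z b) *
              kernelSq k N b (cubeCenter (N - l z) z.2) x) ^ (1 / 2 : ℝ)) := by
    filter_upwards [ae_forall_farFrom hT N] with x hx z hz
    obtain ⟨r, hr, hrF, hZz⟩ := hZr z
    refine exists_factorization N (descendants (l z) z.2) (Z z.1) (w z) (hw0 z hz)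
      (fun κ => ?_) ?_ (hpproj z) ?_ _ x _ (hx (l z) z.2)
    · rcases hZz with h | h
      · rw [Finset.sum_congr rfl fun b hb => by rw [h b hb]]
        exact hsSq_sum_smul_le _ κ _ _ (hdom z) (hGpos z) (hpproj z).1
          (sum_qf_weights_le (l z) z.2 hrF) (hM0 z)
      · rw [Finset.sum_congr rfl fun b hb => by rw [h b hb]]
        exact hsSq_sum_smul_le' _ κ _ _ (hdom z) (hGpos z) (hpproj z).1 hr.1
          (sum_qf_weights_le (l z) z.2 hrF) (hM0 z)
    · have hz0 := sum_sub_avg_eq_zero f (l z) z.2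
      rcases hZz with h | h
      · rw [Finset.sum_congr rfl h, ← Finset.sum_mul, ← Finset.mul_sum, hz0, mul_zero, zero_mul]
      · rw [Finset.sum_congr rfl h, ← Finset.sum_mul, ← Finset.mul_sum, hz0, mul_zero, zero_mul]
    · rcases hZz with h | h
      · exact Or.inl fun b hb => by rw [h b hb, ← mul_assoc, ← mul_assoc, (hpproj z).2]
      · exact Or.inr fun b hb => by rw [h b hb, mul_assoc, (hpproj z).2]
  obtain ⟨Φ, hΦ1, hΦ2, hΦ3⟩ := bad_estimate hd hT.aestronglyMeasurable
    hT.aestronglyMeasurable_section N τ l (fun z => z.2) (fun z => (p z).trace.re)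
    (fun z => (hpproj z).trace_nonneg) w (β := 2 * c) (by positivity) hw0
    (fun z _ => sum_trace_weights_le (l z) z.2 (hpproj z) hc0 (hpF z)) X hX ht
  refine ⟨Φ, hΦ1, ?_, hΦ3.trans ?_⟩
  · filter_upwards [hΦ2] with x hx
    rwa [hsum]
  · have hS : ∑ z ∈ τ, ENNReal.ofReal (2 ^ (l z * d) * (p z).trace.re) ≤
        ENNReal.ofReal (A / t) * ENNReal.ofReal (∑ a ∈ s, (f a).trace.re) := by
      rw [← ENNReal.ofReal_sum_of_nonneg fun z _ =>
        mul_nonneg (by positivity) (hpproj z).trace_nonneg, ← ENNReal.ofReal_mul (by positivity)]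
      refine ENNReal.ofReal_le_ofReal ?_
      -- A cube has 2^(l d) descendants sharing its p, so the volume-weighted sum over cubes is the
      -- sum over leaves in Cuculescu's inequality.
      have h1 : ∑ z ∈ τ, 2 ^ (l z * d) * (p z).trace.re =
          ∑ i ∈ Finset.range K, ∑ a ∈ s, (cucDiff lam (branch K f a) i).trace.re := by
        rw [hτ, Finset.sum_sigma]
        refine Finset.sum_congr rfl fun i _ => ?_
        rw [hs.sum_eq (Nat.sub_le K (i + 1))]
        refine Finset.sum_congr rfl fun J _ => ?_
        rw [Finset.sum_congr rfl fun b hb => by rw [hpb ⟨i, J⟩ b hb], Finset.sum_const,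
          card_descendants, nsmul_eq_mul]
        push_cast
        rfl
      have h2 := sum_trace_cucDiff_le hlam0.le hf hs
      rw [h1]
      calc _ = A / t * (lam * ∑ i ∈ Finset.range K,
            ∑ a ∈ s, (cucDiff lam (branch K f a) i).trace.re) := by
            rw [hlam]; field_simp
        _ ≤ _ := by gcongr
    -- Here the choice lam = t/A pays: 2c times the Hörmander constant over t is at most 2·2^d.
    have hB : (ENNReal.ofReal t)⁻¹ * (badConst d * (ENNReal.ofReal (2 * c) * l2Hormander k)) ≤
        badConst d * ENNReal.ofReal (2 ^ (d + 1)) := by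
      calc _ ≤ (ENNReal.ofReal t)⁻¹ *
            (badConst d * (ENNReal.ofReal (2 * c) * ENNReal.ofReal A)) := by gcongr
        _ = badConst d * (ENNReal.ofReal (2 * c * A) * (ENNReal.ofReal t)⁻¹) := by
            rw [ENNReal.ofReal_mul (by positivity : 0 ≤ 2 * c)]; ring
        _ = _ := by
            rw [← div_eq_mul_inv, ← ENNReal.ofReal_div_of_pos ht]
            congr 2
            rw [hc, hlam]
            field_simp
            ring
    calc _ ≤ ENNReal.ofReal (sideLength N ^ d) *
          (ENNReal.ofReal (A / t) * ENNReal.ofReal (∑ a ∈ s, (f a).trace.re)) *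
          (ENNReal.ofReal (2 ^ (d * d)) * unitVol d +
            badConst d * ENNReal.ofReal (2 ^ (d + 1))) := by gcongr
      _ = _ := by ring

/-- The weak type estimate for step functions with positive semidefinite values. -/
lemma weakType_of_posSemidef (hd : 0 < d) (hT : IsCZOperator T k) (N : ℤ) {t A : ℝ} (ht : 0 < t)
    (hA : 0 < A) (hTA : ‖T‖ₑ ≤ ENNReal.ofReal A) (hH : l2Hormander k ≤ ENNReal.ofReal A)
    {f : (Fin d → ℤ) → Matrix (Fin m) (Fin m) ℂ} (hf : ∀ a, (f a).PosSemidef)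
    {s : Finset (Fin d → ℤ)} (hs : ∀ a ∉ s, f a = 0) :
    ∃ Φ : E d → ℝ≥0∞, AEMeasurable Φ volume ∧
      (∀ᵐ x, trLevel (3 * t) (stepImage T N s f x) ≤ Φ x) ∧
      ∫⁻ x, Φ x ≤ coreConst d * ENNReal.ofReal (A / t) *
        (ENNReal.ofReal (sideLength N ^ d) * ENNReal.ofReal (∑ a ∈ s, (f a).trace.re)) := by
  set lam := t / A with hlam
  have hlam0 : 0 < lam := by positivity
  obtain ⟨K, h0⟩ := exists_forall_qf_branch_zero_le hd hf hs hlam0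
  -- Since f vanishes off s, enlarging to a union of full families changes nothing but allows
  -- averages to be exchanged with f.
  obtain ⟨s', hss', hs'⟩ := exists_saturated K s
  have htr : ∑ a ∈ s, (f a).trace.re = ∑ a ∈ s', (f a).trace.re :=
    Finset.sum_subset hss' fun a _ ha => by rw [hs a ha]; simp
  have hst : ∀ x, stepImage T N s f x = stepImage T N s' f x := fun x =>
    Finset.sum_subset hss' fun a _ ha => by rw [hs a ha, smul_zero]
  rw [htr]
  simp_rw [hst]
  set S := ∑ a ∈ s', (f a).trace.re with hS
  obtain ⟨Φ₀, m₀, e₀, i₀⟩ := good_estimate T N s' (goodPart lam K f) ht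
  obtain ⟨Φ₁, m₁, e₁, i₁⟩ := side_estimate hd hT N ht hA hH hf h0 hs' _
    (Or.inl fun i b => rfl)
  obtain ⟨Φ₂, m₂, e₂, i₂⟩ := side_estimate hd hT N ht hA hH hf h0 hs' _
    (Or.inr fun i b => rfl)
  refine ⟨fun x => Φ₀ x + (Φ₁ x + Φ₂ x), m₀.add (m₁.add m₂), ?_, ?_⟩
  · filter_upwards [e₁, e₂] with x h₁ h₂
    have hdec : stepImage T N s' f x = stepImage T N s' (goodPart lam K f) x +
        (stepImage T N s' (fun a => ∑ i ∈ Finset.range K,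
          cucDiff lam (branch K f a) i * (f a - branch K f a (i + 1)) *
            cucSeq lam (branch K f a) i) x +
        stepImage T N s' (fun a => ∑ i ∈ Finset.range K,
          cucSeq lam (branch K f a) (i + 1) * (f a - branch K f a (i + 1)) *
            cucDiff lam (branch K f a) i) x) := by
      rw [← stepImage_add, ← stepImage_add]
      refine Finset.sum_congr rfl fun a _ => ?_
      congr 1
      exact cz_decomposition hlam0.le (posSemidef_branch hf K a) (f a) K
    rw [hdec, show 3 * t = t + (t + t) by ring]
    refine (trLevel_add_le _ _ ht.le (by positivity)).trans (add_le_add (e₀ x) ?_)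
    exact (trLevel_add_le _ _ ht.le ht.le).trans (add_le_add h₁ h₂)
  · rw [lintegral_add_left' m₀, lintegral_add_left' m₁]
    have hg : (ENNReal.ofReal (t ^ 2))⁻¹ * (‖T‖ₑ ^ 2 * (ENNReal.ofReal (sideLength N ^ d) *
        ENNReal.ofReal (∑ a ∈ s', hsSq (goodPart lam K f a)))) ≤
        ENNReal.ofReal (2 ^ d) * ENNReal.ofReal (A / t) *
          (ENNReal.ofReal (sideLength N ^ d) * ENNReal.ofReal S) := by
      calc _ ≤ (ENNReal.ofReal (t ^ 2))⁻¹ * (ENNReal.ofReal A ^ 2 *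
            (ENNReal.ofReal (sideLength N ^ d) * ENNReal.ofReal (2 ^ d * lam * S))) := by
            gcongr
            exact sum_hsSq_goodPart_le hlam0.le hf hs' fun a _ => h0 a
        _ = ENNReal.ofReal (A ^ 2) / ENNReal.ofReal (t ^ 2) * ENNReal.ofReal (2 ^ d * lam) *
              (ENNReal.ofReal (sideLength N ^ d) * ENNReal.ofReal S) := by
            rw [ENNReal.ofReal_mul (by positivity : 0 ≤ 2 ^ d * lam), ENNReal.ofReal_pow hA.le,
              div_eq_mul_inv]
            ring
        _ = _ := by
            rw [← ENNReal.ofReal_div_of_pos (by positivity),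
              ← ENNReal.ofReal_mul (q := 2 ^ d * lam) (by positivity),
              ← ENNReal.ofReal_mul (p := 2 ^ d) (by positivity)]
            congr 2
            rw [hlam]
            field_simp
    calc _ ≤ _ := add_le_add (i₀.trans hg) (add_le_add i₁ i₂)
      _ = _ := by rw [coreConst]; ring

end CorePositive

open Filter Topology

/-! ### Approximation by dyadic step functions -/

section Density

variable {d : ℕ}

lemma measurable_comp_cubeIndex {β : Type*} [MeasurableSpace β] (N : ℤ) (c : (Fin d → ℤ) → β) :
    Measurable fun x : E d => c (cubeIndex N x) :=
  (measurable_of_countable c).comp (measurable_cubeIndex N)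

lemma norm_sub_le_of_cubeIndex_eq {N : ℤ} {x y : E d} (h : cubeIndex N x = cubeIndex N y) :
    ‖x - y‖ ≤ 2 * d * sideLength N := by
  have hx := norm_sub_cubeCenter_le (mem_dyadicCube.2 h)
  have hy := norm_sub_cubeCenter_le (mem_dyadicCube.2 (rfl : cubeIndex N y = cubeIndex N y))
  calc ‖x - y‖ = ‖(x - cubeCenter N (cubeIndex N y)) - (y - cubeCenter N (cubeIndex N y))‖ := by
        congr 1; abel
    _ ≤ _ := (norm_sub_le _ _).trans (by linarith)

lemma finite_image_cubeIndex (N : ℤ) {K : Set (E d)} (hK : Bornology.IsBounded K) :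
    (cubeIndex N '' K).Finite := by
  obtain ⟨M, hM⟩ := hK.exists_norm_le
  refine (Set.finite_Icc (fun _ => ⌊-((2 : ℝ) ^ N * M)⌋) fun _ : Fin d => ⌊(2 : ℝ) ^ N * M⌋).subset ?_
  rintro _ ⟨x, hx, rfl⟩
  have h2 : (0 : ℝ) ≤ 2 ^ N := by positivity
  have hxi : ∀ i, |x i| ≤ M := fun i => by
    rw [← Real.norm_eq_abs]
    exact (PiLp.norm_apply_le x i).trans (hM x hx)
  refine ⟨fun i => Int.floor_le_floor ?_, fun i => Int.floor_le_floor ?_⟩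
  · rw [← mul_neg]
    exact mul_le_mul_of_nonneg_left (abs_le.1 (hxi i)).1 h2
  · exact mul_le_mul_of_nonneg_left (abs_le.1 (hxi i)).2 h2

lemma tendsto_sideLength : Tendsto (fun N : ℕ => sideLength N) atTop (𝓝 0) := by
  have := tendsto_pow_atTop_nhds_zero_of_lt_one (r := (1 / 2 : ℝ)) (by norm_num) (by norm_num)
  refine this.congr fun N => ?_
  rw [sideLength, zpow_neg, zpow_natCast, one_div, inv_pow]

/-- A set of finite measure is approximated in measure by finite unions of small dyadic cubes. -/
lemma eventually_exists_measure_symmDiff_le {A : Set (E d)} (hA : MeasurableSet A)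
    (hA' : volume A ≠ ∞) {ε : ℝ≥0∞} (hε : ε ≠ 0) :
    ∀ᶠ N : ℕ in atTop, ∃ s : Finset (Fin d → ℤ),
      volume (symmDiff A {x | cubeIndex N x ∈ s}) ≤ ε := by
  classical
  have hε2 : ε / 2 ≠ 0 := by simp [hε]
  obtain ⟨K, hKA, hK, hAK⟩ := hA.exists_isCompact_sdiff_lt hA' hε2
  have hKtop : volume K ≠ ∞ := ne_top_of_le_ne_top hA' (measure_mono hKA)
  obtain ⟨U, hKU, hU, hUK⟩ := K.exists_isOpen_lt_add hKtop hε2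
  obtain ⟨δ, hδ, hth⟩ := hK.exists_thickening_subset_open hU hKU
  have hlim : Tendsto (fun N : ℕ => 2 * d * sideLength N) atTop (𝓝 0) := by
    simpa using tendsto_sideLength.const_mul (2 * (d : ℝ))
  filter_upwards [hlim.eventually_lt_const hδ] with N hN
  have hfin := finite_image_cubeIndex N hK.isBounded
  -- Take all cubes meeting the compact K: they cover K and, being smaller than δ, stay inside U.
  refine ⟨hfin.toFinset, ?_⟩
  have hKB : K ⊆ {x | cubeIndex N x ∈ hfin.toFinset} := fun x hx => by
    simpa using ⟨x, hx, rfl⟩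
  have hBU : {x | cubeIndex N x ∈ hfin.toFinset} ⊆ U := fun x hx => by
    obtain ⟨y, hy, hxy⟩ : ∃ y ∈ K, cubeIndex N y = cubeIndex N x := by simpa using hx
    refine hth (Metric.mem_thickening_iff.2 ⟨y, hy, ?_⟩)
    rw [dist_eq_norm]
    exact (norm_sub_le_of_cubeIndex_eq hxy.symm).trans_lt hN
  calc _ ≤ volume ((A \ K) ∪ (U \ K)) := measure_mono <| by
        rintro x (⟨h1, h2⟩ | ⟨h1, h2⟩)
        · exact Or.inl ⟨h1, fun h => h2 (hKB h)⟩
        · exact Or.inr ⟨hBU h1, fun h => h2 (hKA h)⟩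
    _ ≤ ε / 2 + ε / 2 := (measure_union_le _ _).trans (add_le_add hAK.le
        (measure_sdiff_lt_of_lt_add hK.nullMeasurableSet hKU hKtop hUK).le)
    _ = ε := ENNReal.add_halves ε

/-- A function which is approximated, in `L_1` and in `L_2` at once, by dyadic step functions of
every large generation. -/
def DyadicApprox (g : E d → ℂ) : Prop :=
  ∀ ε : ℝ≥0∞, ε ≠ 0 → ∀ᶠ N : ℕ in atTop, ∃ (s : Finset (Fin d → ℤ)) (c : (Fin d → ℤ) → ℂ),
    (∀ a ∉ s, c a = 0) ∧ ∀ p : ℝ≥0∞, p = 1 ∨ p = 2 →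
      eLpNorm (fun x => g x - c (cubeIndex N x)) p volume ≤ ε

lemma DyadicApprox.of_forall {g : E d → ℂ} (hg : AEStronglyMeasurable g volume)
    (h : ∀ ε : ℝ≥0∞, ε ≠ 0 → ∃ g' : E d → ℂ, AEStronglyMeasurable g' volume ∧ DyadicApprox g' ∧
      ∀ p : ℝ≥0∞, p = 1 ∨ p = 2 → eLpNorm (fun x => g x - g' x) p volume ≤ ε) :
    DyadicApprox g := by
  intro ε hε
  have hε2 : ε / 2 ≠ 0 := by simp [hε]
  obtain ⟨g', hg'm, hg', hgg'⟩ := h _ hε2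
  filter_upwards [hg' _ hε2] with N ⟨s, c, hc, hN⟩
  refine ⟨s, c, hc, fun p hp => ?_⟩
  have hp1 : 1 ≤ p := by rcases hp with rfl | rfl <;> norm_num
  calc eLpNorm (fun x => g x - c (cubeIndex N x)) p volume
      = eLpNorm ((fun x => g x - g' x) + fun x => g' x - c (cubeIndex N x)) p volume := by
        congr 1; ext x; simp
    _ ≤ ε / 2 + ε / 2 := (eLpNorm_add_le (hg.sub hg'm)
        (hg'm.sub (measurable_comp_cubeIndex (N : ℤ) c).aestronglyMeasurable) hp1).trans
        (add_le_add (hgg' p hp) (hN p hp))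
    _ = ε := ENNReal.add_halves ε

lemma DyadicApprox.zero : DyadicApprox (fun _ : E d => (0 : ℂ)) := fun ε _ =>
  Eventually.of_forall fun N => ⟨∅, 0, by simp, fun p _ => by simp⟩

lemma DyadicApprox.add {g h : E d → ℂ} (hgm : AEStronglyMeasurable g volume)
    (hhm : AEStronglyMeasurable h volume) (hg : DyadicApprox g) (hh : DyadicApprox h) :
    DyadicApprox fun x => g x + h x := by
  classical
  intro ε hε
  have hε2 : ε / 2 ≠ 0 := by simp [hε]
  filter_upwards [hg _ hε2, hh _ hε2] with N ⟨s, c, hc, hN⟩ ⟨s', c', hc', hN'⟩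
  refine ⟨s ∪ s', fun a => c a + c' a, fun a ha => ?_, fun p hp => ?_⟩
  · rw [Finset.mem_union, not_or] at ha
    simp [hc a ha.1, hc' a ha.2]
  have hp1 : 1 ≤ p := by rcases hp with rfl | rfl <;> norm_num
  calc eLpNorm (fun x => g x + h x - (c (cubeIndex N x) + c' (cubeIndex N x))) p volume
      = eLpNorm ((fun x => g x - c (cubeIndex N x)) + fun x => h x - c' (cubeIndex N x))
          p volume := by
        congr 1; ext x; simp only [Pi.add_apply]; ring
    _ ≤ ε / 2 + ε / 2 := (eLpNorm_add_le
        (hgm.sub (measurable_comp_cubeIndex (N : ℤ) c).aestronglyMeasurable)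
        (hhm.sub (measurable_comp_cubeIndex (N : ℤ) c').aestronglyMeasurable) hp1).trans
        (add_le_add (hN p hp) (hN' p hp))
    _ = ε := ENNReal.add_halves ε

lemma DyadicApprox.sum {ι : Type*} (τ : Finset ι) (g : ι → E d → ℂ)
    (hgm : ∀ i, AEStronglyMeasurable (g i) volume) (hg : ∀ i ∈ τ, DyadicApprox (g i)) :
    DyadicApprox fun x => ∑ i ∈ τ, g i x := by
  classical
  induction τ using Finset.induction_on with
  | empty => simpa using DyadicApprox.zero
  | insert a τ ha ih =>
    simp_rw [Finset.sum_insert ha]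
    exact (hg a (Finset.mem_insert_self _ _)).add (hgm a)
      (Finset.aestronglyMeasurable_fun_sum τ fun i _ => hgm i)
      (ih fun i hi => hg i (Finset.mem_insert_of_mem hi))

lemma DyadicApprox.indicator_const {A : Set (E d)} (hA : MeasurableSet A) (hA' : volume A ≠ ∞)
    (y : ℂ) : DyadicApprox (A.indicator fun _ => y) := by
  classical
  intro ε hε
  have hη : ∃ η : ℝ≥0∞, η ≠ 0 ∧ ∀ p : ℝ≥0∞, p = 1 ∨ p = 2 → ‖y‖ₑ * η ^ (1 / p.toReal) ≤ ε := by
    have hlim : ∀ r : ℝ, 0 < r → ∀ᶠ η : ℝ≥0∞ in 𝓝 0, ‖y‖ₑ * η ^ r ≤ ε := fun r hr => by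
      have h1 : Tendsto (fun η : ℝ≥0∞ => ‖y‖ₑ * η ^ r) (𝓝 0) (𝓝 (‖y‖ₑ * 0 ^ r)) :=
        ENNReal.Tendsto.const_mul (ENNReal.continuous_rpow_const.tendsto 0) (Or.inr (by simp))
      rw [ENNReal.zero_rpow_of_pos hr, mul_zero] at h1
      exact h1.eventually_le_const (pos_iff_ne_zero.2 hε)
    have := ((hlim 1 one_pos).and (hlim (1 / 2) (by norm_num))).filter_mono
      (nhdsWithin_le_nhds (s := Set.Ioi 0))
    obtain ⟨η, ⟨h1, h2⟩, h3⟩ := (this.and self_mem_nhdsWithin).exists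
    refine ⟨η, (Set.mem_Ioi.1 h3).ne', ?_⟩
    rintro p (rfl | rfl)
    · simpa using h1
    · simpa using h2
  obtain ⟨η, hη0, hη⟩ := hη
  filter_upwards [eventually_exists_measure_symmDiff_le hA hA' hη0] with N ⟨s, hs⟩
  refine ⟨s, fun a => if a ∈ s then y else 0, fun a ha => by simp [ha], fun p hp => ?_⟩
  have hp0 : (0 : ℝ) ≤ 1 / p.toReal := by positivity
  calc _ ≤ eLpNorm ((symmDiff A {x : E d | cubeIndex N x ∈ s}).indicator fun _ => y) p volume := by
        refine eLpNorm_mono fun x => ?_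
        by_cases h1 : x ∈ A <;> by_cases h2 : cubeIndex N x ∈ s <;>
          simp [Set.mem_symmDiff, h1, h2]
    _ ≤ ‖y‖ₑ * η ^ (1 / p.toReal) := (eLpNorm_indicator_const_le _ _).trans (by gcongr)
    _ ≤ ε := hη p hp

lemma DyadicApprox.simpleFunc (f : SimpleFunc (E d) ℂ)
    (hf : ∀ y, y ≠ 0 → volume (f ⁻¹' {y}) < ∞) : DyadicApprox f := by
  classical
  have h := DyadicApprox.sum (f.range.filter (· ≠ 0))
    (fun y => (f ⁻¹' {y}).indicator fun _ => y)
    (fun y => (stronglyMeasurable_const.indicator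
      (f.measurableSet_preimage {y})).aestronglyMeasurable)
    (fun y hy => DyadicApprox.indicator_const (f.measurableSet_preimage {y})
      (hf y (Finset.mem_filter.1 hy).2).ne y)
  convert! h using 1
  ext x
  simp_rw [Set.indicator_apply, Set.mem_preimage, Set.mem_singleton_iff]
  rw [Finset.sum_ite_eq]
  split_ifs with hx
  · rfl
  · simpa using hx

/-- The simple functions from `approxOn` do not depend on the exponent, so one of them is close in
L_1 and in L_2 simultaneously. -/
theorem dyadicApprox_of_memLp {g : E d → ℂ} (h1 : MemLp g 1 volume) (h2 : MemLp g 2 volume) :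
    DyadicApprox g := by
  refine DyadicApprox.of_forall h1.1 fun ε hε => ?_
  set g' := h1.1.mk g with hg'
  have hgg' : g =ᵐ[volume] g' := h1.1.ae_eq_mk
  have hm : Measurable g' := h1.1.measurable_mk
  have : TopologicalSpace.SeparableSpace (Set.range g' ∪ {0} : Set ℂ) :=
    StronglyMeasurable.separableSpace_range_union_singleton h1.1.stronglyMeasurable_mk
  have hlim : ∀ p : ℝ≥0∞, p ≠ ∞ → MemLp g p volume → ∀ᶠ n in atTop,
      eLpNorm (⇑(SimpleFunc.approxOn g' hm (Set.range g' ∪ {0}) 0 (by simp) n) - g') p volume ≤ ε :=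
    fun p hp hgp => (SimpleFunc.tendsto_approxOn_range_Lp_eLpNorm hp hm
      (hgp.ae_eq hgg').2).eventually_le_const (pos_iff_ne_zero.2 hε)
  obtain ⟨n, hn1, hn2⟩ := ((hlim 1 (by simp) h1).and (hlim 2 (by simp) h2)).exists
  refine ⟨_, SimpleFunc.aestronglyMeasurable _, DyadicApprox.simpleFunc _ fun y hy =>
    SimpleFunc.measure_preimage_lt_top_of_memLp one_ne_zero (by simp) _
      (SimpleFunc.memLp_approxOn_range hm (h1.ae_eq hgg') n) y hy, fun p hp => ?_⟩
  have : eLpNorm (fun x => g x -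
      SimpleFunc.approxOn g' hm (Set.range g' ∪ {0}) 0 (by simp) n x) p volume =
      eLpNorm (⇑(SimpleFunc.approxOn g' hm (Set.range g' ∪ {0}) 0 (by simp) n) - g') p volume := by
    rw [← eLpNorm_neg]
    refine eLpNorm_congr_ae ?_
    filter_upwards [hgg'] with x hx
    simp [hx]
  rw [this]
  rcases hp with rfl | rfl
  exacts [hn1, hn2]

end Density

/-! ### The weak type inequality for matrix-valued dyadic step functions -/

section StepWeakType

variable {d m : ℕ}

/-- The constant in the weak type inequality. -/
noncomputable def weakConst (d : ℕ) : ℝ≥0∞ := 48 * coreConst d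

lemma weakConst_ne_top (d : ℕ) : weakConst d ≠ ∞ :=
  ENNReal.mul_ne_top (by simp) (coreConst_ne_top d)

lemma trAbs_zero : trAbs (0 : Matrix (Fin m) (Fin m) ℂ) = 0 := by
  have := trAbs_le_sum_entries (0 : Matrix (Fin m) (Fin m) ℂ)
  simpa using this

lemma stepImage_sum_smul {ι : Type*} (τ : Finset ι) (T : L2 d →L[ℂ] L2 d) (N : ℤ)
    (s : Finset (Fin d → ℤ)) (c : ι → ℂ) (f : ι → (Fin d → ℤ) → Matrix (Fin m) (Fin m) ℂ)
    (x : E d) : stepImage T N s (fun a => ∑ i ∈ τ, c i • f i a) x =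
      ∑ i ∈ τ, c i • stepImage T N s (f i) x := by
  simp_rw [stepImage, Finset.smul_sum]
  rw [Finset.sum_comm]
  exact Finset.sum_congr rfl fun i _ => Finset.sum_congr rfl fun a _ => smul_comm _ _ _

theorem weakType_step (hd : 0 < d) {T : L2 d →L[ℂ] L2 d} {k : E d → E d → ℂ}
    (hT : IsCZOperator T k) (N : ℤ) {t A : ℝ} (ht : 0 < t) (hA : 0 < A)
    (hTA : ‖T‖ₑ ≤ ENNReal.ofReal A) (hH : l2Hormander k ≤ ENNReal.ofReal A)
    {s : Finset (Fin d → ℤ)} {f : (Fin d → ℤ) → Matrix (Fin m) (Fin m) ℂ}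
    (hs : ∀ a ∉ s, f a = 0) :
    ∃ Φ : E d → ℝ≥0∞, AEMeasurable Φ volume ∧ (∀ᵐ x, trLevel t (stepImage T N s f x) ≤ Φ x) ∧
      ENNReal.ofReal t * ∫⁻ x, Φ x ≤
        weakConst d * ENNReal.ofReal A * ∫⁻ x : E d, trAbs (f (cubeIndex N x)) := by
  classical
  choose P hP hfP htr using fun a => exists_posSemidef_decomposition (f a)
  set Q : Fin 4 → (Fin d → ℤ) → Matrix (Fin m) (Fin m) ℂ :=
    fun k a => if a ∈ s then P a k else 0 with hQ
  have hQp : ∀ k a, (Q k a).PosSemidef := fun k a => by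
    simp only [hQ]; split_ifs
    exacts [hP a k, Matrix.PosSemidef.zero]
  have hQs : ∀ k, ∀ a ∉ s, Q k a = 0 := fun k a ha => if_neg ha
  have hfQ : f = fun a => ∑ k : Fin 4, Complex.I ^ (k : ℕ) • Q k a := by
    ext1 a
    by_cases ha : a ∈ s
    · simp only [hQ, if_pos ha]; exact hfP a
    · simp only [hQ, if_neg ha, smul_zero, Finset.sum_const_zero]; exact hs a ha
  -- Four positive parts at height t/4, each split in three by `weakType_of_posSemidef`. With the
  -- four terms this gives 48 = 4·12.
  have ht12 : 0 < t / 12 := by positivity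
  choose Φ hΦm hΦ hΦi using fun k => weakType_of_posSemidef hd hT N ht12 hA hTA hH (hQp k) (hQs k)
  refine ⟨fun x => ∑ k, Φ k x, Finset.aemeasurable_fun_sum _ fun k _ => hΦm k, ?_, ?_⟩
  · filter_upwards [eventually_countable_forall.2 hΦ] with x hx
    have hk : ∀ k : Fin 4, trLevel (t / 4) (Complex.I ^ (k : ℕ) • stepImage T N s (Q k) x) ≤
        Φ k x := fun k => by
      refine (trLevel_smul (by positivity) (by simp)).trans ?_
      have := hx k
      rwa [show 3 * (t / 12) = t / 4 by ring] at this
    have h4 : (0 : ℝ) ≤ t / 4 := by positivity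
    have hsplit : stepImage T N s f x =
        ((Complex.I ^ ((0 : Fin 4) : ℕ) • stepImage T N s (Q 0) x +
          Complex.I ^ ((1 : Fin 4) : ℕ) • stepImage T N s (Q 1) x) +
        (Complex.I ^ ((2 : Fin 4) : ℕ) • stepImage T N s (Q 2) x +
          Complex.I ^ ((3 : Fin 4) : ℕ) • stepImage T N s (Q 3) x)) := by
      rw [hfQ, stepImage_sum_smul, Fin.sum_univ_four]; abel
    rw [hsplit, Fin.sum_univ_four, add_assoc (Φ 0 x + Φ 1 x),
      show t = (t / 4 + t / 4) + (t / 4 + t / 4) by ring]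
    refine (trLevel_add_le _ _ (by positivity) (by positivity)).trans (add_le_add ?_ ?_)
    · exact (trLevel_add_le _ _ h4 h4).trans (add_le_add (hk 0) (hk 1))
    · exact (trLevel_add_le _ _ h4 h4).trans (add_le_add (hk 2) (hk 3))
  · rw [lintegral_finsetSum' _ fun k _ => hΦm k]
    have hint : ∫⁻ x : E d, trAbs (f (cubeIndex N x)) =
        ENNReal.ofReal (sideLength N ^ d) * ∑ a ∈ s, trAbs (f a) := by
      rw [← lintegral_comp_cubeIndex]
      refine lintegral_congr fun x => ?_
      split_ifs with h
      · rfl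
      · rw [hs _ h, trAbs_zero]
    have htrQ : ∀ k, ENNReal.ofReal (∑ a ∈ s, (Q k a).trace.re) ≤ ∑ a ∈ s, trAbs (f a) := by
      intro k
      rw [ENNReal.ofReal_sum_of_nonneg fun a _ => (Complex.nonneg_iff.1 (hQp k a).trace_nonneg).1]
      refine Finset.sum_le_sum fun a ha => ?_
      simp only [hQ, if_pos ha]
      exact htr a k
    rw [hint]
    calc ENNReal.ofReal t * ∑ k, ∫⁻ x, Φ k x
        ≤ ENNReal.ofReal t * ∑ _k : Fin 4, coreConst d * ENNReal.ofReal (A / (t / 12)) *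
            (ENNReal.ofReal (sideLength N ^ d) * ∑ a ∈ s, trAbs (f a)) := by
          gcongr with k
          exact (hΦi k).trans (by gcongr; exact htrQ k)
      _ = 4 * (ENNReal.ofReal t * ENNReal.ofReal (A / (t / 12))) * coreConst d *
            (ENNReal.ofReal (sideLength N ^ d) * ∑ a ∈ s, trAbs (f a)) := by
          rw [Finset.sum_const, Finset.card_univ, Fintype.card_fin, nsmul_eq_mul]
          push_cast
          ring
      _ = _ := by
          rw [← ENNReal.ofReal_mul ht.le, show t * (A / (t / 12)) = 12 * A by field_simp,
            ENNReal.ofReal_mul (by norm_num), weakConst]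
          simp only [ENNReal.ofReal_ofNat]
          ring

end StepWeakType

/-! ### Limits of images of step functions -/

section StepLimit

variable {d m : ℕ}

/-- The dyadic step function with value `c a` on `dyadicCube N a`, as an element of `L_2`. -/
noncomputable def stepL2 (N : ℤ) (s : Finset (Fin d → ℤ)) (c : (Fin d → ℤ) → ℂ) : L2 d :=
  ∑ a ∈ s, c a • cubeL2 N a

lemma coeFn_stepL2 (N : ℤ) {s : Finset (Fin d → ℤ)} {c : (Fin d → ℤ) → ℂ}
    (hc : ∀ a ∉ s, c a = 0) :
    (stepL2 N s c : E d → ℂ) =ᵐ[volume] fun x => c (cubeIndex N x) := by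
  filter_upwards [coeFn_sum_smul s c fun a => cubeL2 N a,
    (eventually_countable_forall.2 fun a : Fin d → ℤ => coeFn_cubeL2 N a)] with x h1 h2
  rw [stepL2, h1]
  simp_rw [h2]
  rw [sum_mul_indicator_dyadicCube]
  split_ifs with h
  · rfl
  · exact (hc _ h).symm

lemma stepL2_subset (N : ℤ) {s s' : Finset (Fin d → ℤ)} {c : (Fin d → ℤ) → ℂ} (h : s ⊆ s')
    (hc : ∀ a ∉ s, c a = 0) : stepL2 N s' c = stepL2 N s c :=
  (Finset.sum_subset h fun a _ ha => by rw [hc a ha, zero_smul]).symm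

lemma coeFn_map_stepL2 (T : L2 d →L[ℂ] L2 d) (N : ℤ) (s : Finset (Fin d → ℤ))
    (c : (Fin d → ℤ) → ℂ) :
    (T (stepL2 N s c) : E d → ℂ) =ᵐ[volume] fun x => ∑ a ∈ s, c a * T (cubeL2 N a) x := by
  rw [stepL2, map_sum]
  simp_rw [map_smul]
  exact coeFn_sum_smul s c fun a => T (cubeL2 N a)

/-- `h` is the limit in measure of the images under `T` of dyadic step functions of all large
generations which converge to `f` in `L_1`. -/
def StepLimit (T : L2 d →L[ℂ] L2 d) (f h : E d → ℂ) : Prop :=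
  ∀ ε : ℝ, 0 < ε → ∀ᶠ N : ℕ in atTop, ∃ (s : Finset (Fin d → ℤ)) (c : (Fin d → ℤ) → ℂ),
    (∀ a ∉ s, c a = 0) ∧ ∫⁻ x, ‖f x - c (cubeIndex N x)‖ₑ ≤ ENNReal.ofReal ε ∧
      volume {x | ε < ‖h x - T (stepL2 N s c) x‖} ≤ ENNReal.ofReal ε

lemma StepLimit.congr {T : L2 d →L[ℂ] L2 d} {f f' h h' : E d → ℂ} (H : StepLimit T f h)
    (hf : f =ᵐ[volume] f') (hh : h =ᵐ[volume] h') : StepLimit T f' h' := by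
  intro ε hε
  filter_upwards [H ε hε] with N ⟨s, c, hc, h1, h2⟩
  refine ⟨s, c, hc, (lintegral_congr_ae ?_).trans_le h1, (measure_congr ?_).trans_le h2⟩
  · filter_upwards [hf] with x hx
    rw [hx]
  · filter_upwards [hh] with x hx
    refine propext ?_
    change ε < ‖_‖ ↔ ε < ‖_‖
    rw [hx]

lemma measure_lt_norm_add_le (u v : E d → ℂ) (a b : ℝ) :
    volume {x | a + b < ‖u x + v x‖} ≤ volume {x | a < ‖u x‖} + volume {x | b < ‖v x‖} := by
  refine (measure_mono fun x hx => ?_).trans (measure_union_le _ _)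
  by_contra h
  simp only [Set.mem_union, Set.mem_ofPred_eq, not_or, not_lt] at h hx
  linarith [norm_add_le (u x) (v x)]

lemma StepLimit.of_forall {T : L2 d →L[ℂ] L2 d} {f h : E d → ℂ}
    (hf : AEStronglyMeasurable f volume)
    (H : ∀ ε : ℝ, 0 < ε → ∃ f' h' : E d → ℂ, AEStronglyMeasurable f' volume ∧ StepLimit T f' h' ∧
      ∫⁻ x, ‖f x - f' x‖ₑ ≤ ENNReal.ofReal ε ∧
      volume {x | ε < ‖h x - h' x‖} ≤ ENNReal.ofReal ε) : StepLimit T f h := by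
  intro ε hε
  have hε2 : 0 < ε / 2 := by positivity
  have hsum : ENNReal.ofReal (ε / 2) + ENNReal.ofReal (ε / 2) = ENNReal.ofReal ε := by
    rw [← ENNReal.ofReal_add hε2.le hε2.le, add_halves]
  obtain ⟨f', h', hf', H', h1, h2⟩ := H _ hε2
  filter_upwards [H' _ hε2] with N ⟨s, c, hc, h3, h4⟩
  refine ⟨s, c, hc, ?_, ?_⟩
  · calc ∫⁻ x, ‖f x - c (cubeIndex N x)‖ₑ
        ≤ ∫⁻ x, ‖f x - f' x‖ₑ + ‖f' x - c (cubeIndex N x)‖ₑ := lintegral_mono fun x => by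
          rw [show f x - c (cubeIndex N x) = (f x - f' x) + (f' x - c (cubeIndex N x)) by ring]
          exact enorm_add_le _ _
      _ ≤ _ := by
          have hm : AEMeasurable (fun x => ‖f x - f' x‖ₑ) volume := (hf.sub hf').enorm
          rw [lintegral_add_left' hm, ← hsum]
          exact add_le_add h1 h3
  · have := measure_lt_norm_add_le (fun x => h x - h' x) (fun x => h' x - T (stepL2 N s c) x)
      (ε / 2) (ε / 2)
    simp only [sub_add_sub_cancel, add_halves] at this
    exact this.trans ((add_le_add h2 h4).trans_eq hsum)

/-- Requiring every large generation lets both approximations be taken at the same N, over a union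
of index sets. -/
lemma StepLimit.add {T : L2 d →L[ℂ] L2 d} {f h f' h' : E d → ℂ}
    (hf : AEStronglyMeasurable f volume) (H : StepLimit T f h) (H' : StepLimit T f' h') :
    StepLimit T (fun x => f x + f' x) (fun x => h x + h' x) := by
  classical
  intro ε hε
  have hε2 : 0 < ε / 2 := by positivity
  have hsum : ENNReal.ofReal (ε / 2) + ENNReal.ofReal (ε / 2) = ENNReal.ofReal ε := by
    rw [← ENNReal.ofReal_add hε2.le hε2.le, add_halves]
  filter_upwards [H _ hε2, H' _ hε2] with N ⟨s, c, hc, h1, h2⟩ ⟨s', c', hc', h1', h2'⟩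
  have hcc : ∀ a ∉ s ∪ s', c a + c' a = 0 := fun a ha => by
    rw [Finset.mem_union, not_or] at ha
    rw [hc a ha.1, hc' a ha.2, add_zero]
  refine ⟨s ∪ s', fun a => c a + c' a, hcc, ?_, ?_⟩
  · calc ∫⁻ x, ‖f x + f' x - (c (cubeIndex N x) + c' (cubeIndex N x))‖ₑ
        ≤ ∫⁻ x, ‖f x - c (cubeIndex N x)‖ₑ + ‖f' x - c' (cubeIndex N x)‖ₑ :=
          lintegral_mono fun x => by
            rw [add_sub_add_comm]
            exact enorm_add_le _ _
      _ ≤ _ := by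
          have hm : AEMeasurable (fun x => ‖f x - c (cubeIndex N x)‖ₑ) volume :=
            (hf.sub (measurable_comp_cubeIndex (N : ℤ) c).aestronglyMeasurable).enorm
          rw [lintegral_add_left' hm, ← hsum]
          exact add_le_add h1 h1'
  · have hstep : stepL2 N (s ∪ s') (fun a => c a + c' a) = stepL2 N s c + stepL2 N s' c' := by
      rw [← stepL2_subset N (Finset.subset_union_left : s ⊆ s ∪ s') hc,
        ← stepL2_subset N (Finset.subset_union_right : s' ⊆ s ∪ s') hc']
      simp_rw [stepL2, add_smul, Finset.sum_add_distrib]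
    have := measure_lt_norm_add_le (fun x => h x - T (stepL2 N s c) x)
      (fun x => h' x - T (stepL2 N s' c') x) (ε / 2) (ε / 2)
    refine le_trans (measure_congr ?_).le (this.trans ((add_le_add h2 h2').trans_eq hsum))
    rw [hstep, map_add]
    filter_upwards [Lp.coeFn_add (T (stepL2 N s c)) (T (stepL2 N s' c'))] with x hx
    refine propext ?_
    change ε < ‖_‖ ↔ ε / 2 + ε / 2 < ‖_‖
    rw [hx, Pi.add_apply, add_halves, add_sub_add_comm]

lemma StepLimit.smul {T : L2 d →L[ℂ] L2 d} {f h : E d → ℂ} (H : StepLimit T f h) (z : ℂ) :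
    StepLimit T (fun x => z * f x) (fun x => z * h x) := by
  intro ε hε
  -- Adding 1 covers z = 0 and gives r ≥ 1, so the measure bound ε/r is also at most ε.
  set r := ‖z‖ + 1 with hr
  have hr1 : 1 ≤ r := by simp [hr]
  have hr0 : 0 < r := by positivity
  have hzr : ‖z‖ ≤ r := by simp [hr]
  filter_upwards [H (ε / r) (by positivity)] with N ⟨s, c, hc, h1, h2⟩
  refine ⟨s, fun a => z * c a, fun a ha => by simp [hc a ha], ?_, ?_⟩
  · simp_rw [← mul_sub, enorm_mul]
    rw [lintegral_const_mul' _ _ enorm_ne_top]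
    calc ‖z‖ₑ * ∫⁻ x, ‖f x - c (cubeIndex N x)‖ₑ ≤ ENNReal.ofReal r * ENNReal.ofReal (ε / r) := by
          refine mul_le_mul' ?_ h1
          rw [← ofReal_norm]
          exact ENNReal.ofReal_le_ofReal hzr
      _ = _ := by
          rw [← ENNReal.ofReal_mul hr0.le]
          congr 1
          field_simp
  · have hstep : stepL2 N s (fun a => z * c a) = z • stepL2 N s c := by
      simp_rw [stepL2, Finset.smul_sum, mul_smul]
    rw [hstep, map_smul]
    calc _ ≤ volume {x | ε / r < ‖h x - T (stepL2 N s c) x‖} := by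
          refine measure_mono_ae ?_
          filter_upwards [Lp.coeFn_smul z (T (stepL2 N s c))] with x hx
          change ε < ‖_‖ → ε / r < ‖_‖
          rw [hx, Pi.smul_apply, smul_eq_mul, ← mul_sub, norm_mul, div_lt_iff₀ hr0, mul_comm]
          exact fun hlt => hlt.trans_le (by gcongr)
      _ ≤ ENNReal.ofReal (ε / r) := h2
      _ ≤ ENNReal.ofReal ε := ENNReal.ofReal_le_ofReal (div_le_self hε.le hr1)

lemma measure_lt_norm_le (u : L2 d) {ε : ℝ} (hε : 0 < ε) :
    volume {x | ε < ‖u x‖} ≤ ENNReal.ofReal ((‖u‖ / ε) ^ 2) := by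
  have h1 := mul_meas_ge_le_lintegral₀ (μ := volume) (f := fun x => ‖u x‖ₑ ^ 2)
    ((Lp.aestronglyMeasurable u).enorm.pow_const 2) (ENNReal.ofReal (ε ^ 2))
  rw [← enorm_sq_eq_lintegral, ← ofReal_norm, ← ENNReal.ofReal_pow (norm_nonneg _)] at h1
  have h0 : ENNReal.ofReal (ε ^ 2) ≠ 0 := by simp [hε.ne']
  rw [div_pow, ENNReal.ofReal_div_of_pos (by positivity),
    ENNReal.le_div_iff_mul_le (Or.inl h0) (Or.inl (by simp)), mul_comm]
  refine le_trans ?_ h1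
  gcongr with x
  intro hx
  rw [← ofReal_norm, ← ENNReal.ofReal_pow (norm_nonneg _)]
  exact ENNReal.ofReal_le_ofReal (by gcongr)

theorem stepLimit_of_ae_eq (T : L2 d →L[ℂ] L2 d) (g : L1 d) (h : L2 d)
    (hgh : (g : E d → ℂ) =ᵐ[volume] (h : E d → ℂ)) : StepLimit T g (T h) := by
  intro ε hε
  set r := ‖T‖ + 1 with hr
  have hr0 : 0 < r := by positivity
  -- Chosen so that the L_2 error after applying T is at most ε·min(1, ε); Chebyshev then gives
  -- measure at most min(1, ε)² ≤ ε.
  set η := ε * min 1 ε / r with hη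
  have hm0 : 0 < min 1 ε := by positivity
  have hη0 : 0 < η := by positivity
  have happ := dyadicApprox_of_memLp (Lp.memLp g) ((Lp.memLp h).ae_eq hgh.symm)
  filter_upwards [happ (min (ENNReal.ofReal ε) (ENNReal.ofReal η)) (by simp [hε, hη0])]
    with N ⟨s, c, hc, hN⟩
  refine ⟨s, c, hc, ?_, ?_⟩
  · rw [← eLpNorm_one_eq_lintegral_enorm]
    exact (hN 1 (Or.inl rfl)).trans (min_le_left _ _)
  · have h2 : ‖h - stepL2 N s c‖ ≤ η := by
      rw [← ENNReal.ofReal_le_ofReal_iff hη0.le, ofReal_norm, Lp.enorm_def]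
      refine le_trans (eLpNorm_congr_ae ?_).le ((hN 2 (Or.inr rfl)).trans (min_le_right _ _))
      filter_upwards [Lp.coeFn_sub h (stepL2 N s c), coeFn_stepL2 N hc, hgh] with x h1 h2 h3
      rw [h1, Pi.sub_apply, h2, h3]
    have h3 : ‖T (h - stepL2 N s c)‖ ≤ ε * min 1 ε := by
      calc _ ≤ ‖T‖ * ‖h - stepL2 N s c‖ := T.le_opNorm _
        _ ≤ r * η := by gcongr; simp [hr]
        _ = _ := by rw [hη]; field_simp
    calc _ = volume {x | ε < ‖T (h - stepL2 N s c) x‖} := by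
          refine measure_congr ?_
          rw [map_sub]
          filter_upwards [Lp.coeFn_sub (T h) (T (stepL2 N s c))] with x hx
          refine propext ?_
          change ε < ‖_‖ ↔ ε < ‖_‖
          rw [hx, Pi.sub_apply]
      _ ≤ ENNReal.ofReal ((‖T (h - stepL2 N s c)‖ / ε) ^ 2) := measure_lt_norm_le _ hε
      _ ≤ ENNReal.ofReal ε := ENNReal.ofReal_le_ofReal <| by
          have : ‖T (h - stepL2 N s c)‖ / ε ≤ min 1 ε := by
            rw [div_le_iff₀ hε]; linarith
          calc _ ≤ (min 1 ε) ^ 2 := by gcongr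
            _ = min 1 ε * min 1 ε := sq _
            _ ≤ 1 * ε := mul_le_mul (min_le_left _ _) (min_le_right _ _) hm0.le zero_le_one
            _ = ε := one_mul _

lemma le_of_forall_le_add_mul {a b K : ℝ≥0∞} (hK : K ≠ ∞) {ε₀ : ℝ} (hε₀ : 0 < ε₀)
    (h : ∀ ε : ℝ, 0 < ε → ε ≤ ε₀ → a ≤ b + K * ENNReal.ofReal ε) : a ≤ b := by
  have hlim : Tendsto (fun ε : ℝ => b + K * ENNReal.ofReal ε) (𝓝[>] 0) (𝓝 (b + K * 0)) := by
    refine Tendsto.const_add b (ENNReal.Tendsto.const_mul ?_ (Or.inr hK))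
    have := (ENNReal.continuous_ofReal.tendsto 0).mono_left (nhdsWithin_le_nhds (s := Set.Ioi 0))
    simpa using this
  rw [mul_zero, add_zero] at hlim
  refine ge_of_tendsto hlim ?_
  filter_upwards [Ioc_mem_nhdsGT hε₀] with ε hε
  exact h ε hε.1 hε.2

/-- All entries are approximated at one generation. Off a small set the error has no singular value
above t/2, and on that set it costs at most m. These errors depend on m but vanish with ε, so the
constant only doubles, from halving t. -/
theorem weakType_of_stepLimit (hd : 0 < d) {T : L2 d →L[ℂ] L2 d} {k : E d → E d → ℂ}
    (hT : IsCZOperator T k) {t A : ℝ} (ht : 0 < t) (hA : 0 < A)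
    (hTA : ‖T‖ₑ ≤ ENNReal.ofReal A) (hH : l2Hormander k ≤ ENNReal.ofReal A)
    {f h : Fin m → Fin m → E d → ℂ} (hf : ∀ i j, AEStronglyMeasurable (f i j) volume)
    (H : ∀ i j, StepLimit T (f i j) (h i j)) :
    ENNReal.ofReal t * ∫⁻ x, trLevel t (Matrix.of fun i j => h i j x) ≤
      2 * weakConst d * ENNReal.ofReal A * ∫⁻ x, trAbs (Matrix.of fun i j => f i j x) := by
  classical
  -- Entries of size at most (t/2)/m have no singular value above t/2; m + 1 avoids dividing by
  -- zero.
  set ε₀ := t / 2 / (m + 1) with hε₀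
  have hε₀0 : 0 < ε₀ := by positivity
  set K : ℝ≥0∞ := ENNReal.ofReal t * (m * (m * m)) +
    2 * weakConst d * ENNReal.ofReal A * (m * (m * m)) with hK
  have hKtop : K ≠ ∞ := by
    have := weakConst_ne_top d
    finiteness
  refine le_of_forall_le_add_mul hKtop hε₀0 fun ε hε hεε₀ => ?_
  have hev : ∀ᶠ N : ℕ in atTop, ∀ i j, ∃ (s : Finset (Fin d → ℤ)) (c : (Fin d → ℤ) → ℂ),
      (∀ a ∉ s, c a = 0) ∧ ∫⁻ x, ‖f i j x - c (cubeIndex N x)‖ₑ ≤ ENNReal.ofReal ε ∧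
        volume {x | ε < ‖h i j x - T (stepL2 N s c) x‖} ≤ ENNReal.ofReal ε :=
    eventually_all.2 fun i => eventually_all.2 fun j => H i j ε hε
  obtain ⟨N, hN⟩ := hev.exists
  choose s c hc h1 h2 using hN
  set σ : Finset (Fin d → ℤ) := Finset.univ.biUnion fun i => Finset.univ.biUnion fun j => s i j
    with hσ
  have hsσ : ∀ i j, s i j ⊆ σ := fun i j a ha => by
    simp only [hσ, Finset.mem_biUnion, Finset.mem_univ, true_and]
    exact ⟨i, j, ha⟩
  set F : (Fin d → ℤ) → Matrix (Fin m) (Fin m) ℂ := fun a => Matrix.of fun i j => c i j a with hF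
  have hFσ : ∀ a ∉ σ, F a = 0 := fun a ha => by
    ext i j
    exact hc i j a fun hmem => ha (hsσ i j hmem)
  obtain ⟨Φ, hΦm, hΦ, hΦi⟩ := weakType_step hd hT N (half_pos ht) hA hTA hH hFσ
  set B : Set (E d) := ⋃ i, ⋃ j, {x | ε < ‖h i j x - T (stepL2 N (s i j) (c i j)) x‖} with hB
  have hBm : volume B ≤ m * m * ENNReal.ofReal ε := by
    calc volume B ≤ ∑ i, ∑ j, volume {x | ε < ‖h i j x - T (stepL2 N (s i j) (c i j)) x‖} :=
          (measure_iUnion_fintype_le _ _).trans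
            (Finset.sum_le_sum fun i _ => measure_iUnion_fintype_le _ _)
      _ ≤ ∑ _i : Fin m, ∑ _j : Fin m, ENNReal.ofReal ε :=
          Finset.sum_le_sum fun i _ => Finset.sum_le_sum fun j _ => h2 i j
      _ = _ := by simp [mul_assoc]
  have hentry : ∀ᵐ x, ∀ i j, T (stepL2 N (s i j) (c i j)) x = stepImage T N σ F x i j := by
    refine eventually_all.2 fun i => eventually_all.2 fun j => ?_
    filter_upwards [coeFn_map_stepL2 T N σ (c i j)] with x hx
    rw [← stepL2_subset N (hsσ i j) (hc i j), hx]
    simp [stepImage, Matrix.sum_apply, hF, mul_comm]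
  have hlevel : ∀ᵐ x, trLevel t (Matrix.of fun i j => h i j x) ≤
      Φ x + B.indicator (fun _ => (m : ℝ≥0∞)) x := by
    filter_upwards [hΦ, hentry] with x hx hx'
    rw [show (Matrix.of fun i j => h i j x) = stepImage T N σ F x +
      ((Matrix.of fun i j => h i j x) - stepImage T N σ F x) by abel]
    nth_rewrite 1 [← add_halves t]
    refine (trLevel_add_le _ _ (half_pos ht).le (half_pos ht).le).trans (add_le_add hx ?_)
    by_cases hxB : x ∈ B
    · rw [Set.indicator_of_mem hxB]
      exact trLevel_le _ _
    · rw [Set.indicator_of_notMem hxB, trLevel_eq_zero_of_entries (half_pos ht).le]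
      intro i j
      simp only [hB, Set.mem_iUnion, Set.mem_ofPred_eq, not_exists, not_lt] at hxB
      have hm : (0 : ℝ) < m := by exact_mod_cast i.pos
      rw [Matrix.sub_apply, Matrix.of_apply, ← hx' i j]
      refine ((hxB i j).trans hεε₀).trans ?_
      rw [hε₀]
      gcongr
      linarith
  have htrace : ∫⁻ x : E d, trAbs (F (cubeIndex N x)) ≤
      (∫⁻ x, trAbs (Matrix.of fun i j => f i j x)) + m * (m * m) * ENNReal.ofReal ε := by
    have hmeas : ∀ i j, AEMeasurable (fun x => ‖f i j x - c i j (cubeIndex N x)‖ₑ) volume :=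
      fun i j => ((hf i j).sub
        (measurable_comp_cubeIndex (N : ℤ) (c i j)).aestronglyMeasurable).enorm
    have hmeas' : AEMeasurable (fun x => (m : ℝ≥0∞) *
        ∑ i, ∑ j, ‖f i j x - c i j (cubeIndex N x)‖ₑ) volume :=
      (Finset.aemeasurable_fun_sum _ fun i _ => Finset.aemeasurable_fun_sum _ fun j _ =>
        hmeas i j).const_mul _
    calc ∫⁻ x : E d, trAbs (F (cubeIndex N x))
        ≤ ∫⁻ x, trAbs (Matrix.of fun i j => f i j x) +
            m * ∑ i, ∑ j, ‖f i j x - c i j (cubeIndex N x)‖ₑ := lintegral_mono fun x => by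
          rw [show F (cubeIndex N x) = (Matrix.of fun i j => f i j x) +
            (F (cubeIndex N x) - Matrix.of fun i j => f i j x) by abel]
          refine (trAbs_add_le _ _).trans (add_le_add le_rfl ?_)
          refine (trAbs_le_sum_entries _).trans_eq ?_
          simp_rw [Matrix.sub_apply, Matrix.of_apply, hF, Matrix.of_apply, enorm_sub_rev (c _ _ _)]
      _ = (∫⁻ x, trAbs (Matrix.of fun i j => f i j x)) +
            m * ∑ i, ∑ j, ∫⁻ x, ‖f i j x - c i j (cubeIndex N x)‖ₑ := by
          rw [lintegral_add_right' _ hmeas', lintegral_const_mul' _ _ (by simp),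
            lintegral_finsetSum' _ fun i _ => Finset.aemeasurable_fun_sum _ fun j _ => hmeas i j]
          simp_rw [lintegral_finsetSum' _ fun j _ => hmeas _ j]
      _ ≤ (∫⁻ x, trAbs (Matrix.of fun i j => f i j x)) +
            m * ∑ _i : Fin m, ∑ _j : Fin m, ENNReal.ofReal ε := by
          gcongr with i _ j _
          exact h1 i j
      _ = _ := by simp [mul_assoc]
  have htt : ENNReal.ofReal t = 2 * ENNReal.ofReal (t / 2) := by
    rw [← ENNReal.ofReal_ofNat, ← ENNReal.ofReal_mul (by norm_num)]
    congr 1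
    ring
  calc ENNReal.ofReal t * ∫⁻ x, trLevel t (Matrix.of fun i j => h i j x)
      ≤ ENNReal.ofReal t * ∫⁻ x, (Φ x + B.indicator (fun _ => (m : ℝ≥0∞)) x) :=
        mul_le_mul_right (lintegral_mono_ae hlevel) _
    _ ≤ ENNReal.ofReal t * ((∫⁻ x, Φ x) + m * (m * m * ENNReal.ofReal ε)) := by
        rw [lintegral_add_left' hΦm]
        gcongr
        exact (lintegral_indicator_const_le _ _).trans (by gcongr)
    _ = 2 * (ENNReal.ofReal (t / 2) * ∫⁻ x, Φ x) +
          ENNReal.ofReal t * (m * (m * m)) * ENNReal.ofReal ε := by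
        rw [mul_add]
        nth_rewrite 1 [htt]
        ring
    _ ≤ 2 * (weakConst d * ENNReal.ofReal A *
          ((∫⁻ x, trAbs (Matrix.of fun i j => f i j x)) + m * (m * m) * ENNReal.ofReal ε)) +
          ENNReal.ofReal t * (m * (m * m)) * ENNReal.ofReal ε := by
        refine add_le_add (mul_le_mul' le_rfl (hΦi.trans ?_)) le_rfl
        gcongr
    _ = _ := by rw [hK]; ring

end StepLimit

/-! ### Extension to `L_1` -/

section Extension

variable {d : ℕ}

lemma lintegral_trLevel_one_by_one {u : E d → ℂ} (hu : AEStronglyMeasurable u volume) (t : ℝ) :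
    ∫⁻ x, trLevel t (Matrix.of fun _ _ : Fin 1 => u x) = volume {x | t < ‖u x‖} := by
  classical
  have hS : NullMeasurableSet {x | t < ‖u x‖} volume :=
    nullMeasurableSet_lt aemeasurable_const hu.norm.aemeasurable
  calc _ = ∫⁻ x, {x | t < ‖u x‖}.indicator (fun _ => (1 : ℝ≥0∞)) x := by
        refine lintegral_congr fun x => ?_
        rw [trLevel_one_by_one, Set.indicator_apply]
        rfl
    _ = _ := by rw [lintegral_indicator_const₀ hS, one_mul]

lemma mul_measure_le_of_stepLimit (hd : 0 < d) {T : L2 d →L[ℂ] L2 d} {k : E d → E d → ℂ}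
    (hT : IsCZOperator T k) {t A : ℝ} (ht : 0 < t) (hA : 0 < A)
    (hTA : ‖T‖ₑ ≤ ENNReal.ofReal A) (hH : l2Hormander k ≤ ENNReal.ofReal A)
    {f h : E d → ℂ} (hf : AEStronglyMeasurable f volume) (hh : AEStronglyMeasurable h volume)
    (H : StepLimit T f h) :
    ENNReal.ofReal t * volume {x | t < ‖h x‖} ≤
      2 * weakConst d * ENNReal.ofReal A * ∫⁻ x, ‖f x‖ₑ := by
  have := weakType_of_stepLimit hd hT ht hA hTA hH (f := fun _ _ : Fin 1 => f)
    (h := fun _ _ => h) (fun _ _ => hf) fun _ _ => H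
  rw [lintegral_trLevel_one_by_one hh] at this
  simpa only [trAbs_one_by_one, Matrix.of_apply] using this

lemma StepLimit.sub {T : L2 d →L[ℂ] L2 d} {f h f' h' : E d → ℂ}
    (hf : AEStronglyMeasurable f volume) (H : StepLimit T f h) (H' : StepLimit T f' h') :
    StepLimit T (fun x => f x - f' x) (fun x => h x - h' x) := by
  simpa [sub_eq_add_neg] using H.add hf (H'.smul (-1))

/-- The difference of two limits is a step limit of the zero function, so the scalar inequality
makes all its level sets null. -/
theorem StepLimit.unique (hd : 0 < d) {T : L2 d →L[ℂ] L2 d} {k : E d → E d → ℂ}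
    (hT : IsCZOperator T k) {A : ℝ} (hA : 0 < A)
    (hTA : ‖T‖ₑ ≤ ENNReal.ofReal A) (hH : l2Hormander k ≤ ENNReal.ofReal A)
    {f h h' : E d → ℂ} (hf : AEStronglyMeasurable f volume)
    (hh : AEStronglyMeasurable h volume) (hh' : AEStronglyMeasurable h' volume)
    (H : StepLimit T f h) (H' : StepLimit T f h') : h =ᵐ[volume] h' := by
  have hsmall : ∀ n : ℕ, ∀ᵐ x, ‖h x - h' x‖ ≤ 1 / ((n : ℝ) + 1) := fun n => by
    have ht : 0 < 1 / ((n : ℝ) + 1) := by positivity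
    have := mul_measure_le_of_stepLimit hd hT ht hA hTA hH (hf.sub hf) (hh.sub hh')
      (H.sub hf H')
    simp only [Pi.sub_apply, sub_self, enorm_zero, lintegral_zero, mul_zero, nonpos_iff_eq_zero,
      mul_eq_zero] at this
    have h0 := this.resolve_left (by simpa using ht)
    rw [ae_iff]
    simpa only [not_le] using h0
  filter_upwards [ae_all_iff.2 hsmall] with x hx
  refine sub_eq_zero.1 (norm_le_zero_iff.1 ?_)
  exact ge_of_tendsto' tendsto_one_div_add_atTop_nhds_zero_nat hx

lemma exists_L1_L2_approx (f : L1 d) {ε : ℝ} (hε : 0 < ε) :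
    ∃ (g : L1 d) (h : L2 d), (g : E d → ℂ) =ᵐ[volume] (h : E d → ℂ) ∧
      ∫⁻ x, ‖f x - g x‖ₑ ≤ ENNReal.ofReal ε := by
  obtain ⟨g, hg, hg1⟩ := (Lp.memLp f).exists_simpleFunc_eLpNorm_sub_lt (by simp)
    (ε := ENNReal.ofReal ε) (by simpa using hε)
  have hg2 : MemLp g 2 volume := (SimpleFunc.memLp_iff_integrable (by simp) (by simp)).2
    (memLp_one_iff_integrable.1 hg1)
  refine ⟨hg1.toLp g, hg2.toLp g, hg1.coeFn_toLp.trans hg2.coeFn_toLp.symm, ?_⟩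
  rw [eLpNorm_one_eq_lintegral_enorm] at hg
  refine le_trans (lintegral_congr_ae ?_).le hg.le
  filter_upwards [hg1.coeFn_toLp] with x hx
  rw [hx, Pi.sub_apply]

/-- A sequence which is rapidly Cauchy in measure converges in measure. -/
lemma exists_limit_of_measure_le {u : ℕ → E d → ℂ}
    (hu : ∀ n, AEStronglyMeasurable (u n) volume)
    (hcau : ∀ n, volume {x | (1 / 2 : ℝ) ^ n < ‖u n x - u (n + 1) x‖} ≤ 2⁻¹ ^ n) :
    ∃ h : E d → ℂ, AEStronglyMeasurable h volume ∧
      ∀ n, volume {x | 2 * (1 / 2 : ℝ) ^ n < ‖h x - u n x‖} ≤ 2⁻¹ ^ n * 2 := by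
  set S : ℕ → Set (E d) := fun n => {x | (1 / 2 : ℝ) ^ n < ‖u n x - u (n + 1) x‖} with hS
  have hdist : ∀ x n, (∀ j, x ∉ S (n + j)) →
      ∀ j, dist (u (n + j) x) (u (n + (j + 1)) x) ≤ 2 * (1 / 2 : ℝ) ^ n / 2 / 2 ^ j := by
    intro x n hx j
    have := hx j
    simp only [hS, Set.mem_ofPred_eq, not_lt] at this
    rw [dist_eq_norm, ← add_assoc]
    refine this.trans_eq ?_
    rw [pow_add, one_div_pow (2 : ℝ) j]
    ring
  -- Borel-Cantelli: almost every point lies in only finitely many S n, beyond which the increments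
  -- are geometric.
  have hsum : ∑' n, volume (S n) ≠ ∞ := by
    refine ne_top_of_le_ne_top ?_ (ENNReal.tsum_le_tsum hcau)
    rw [ENNReal.tsum_geometric_two]
    simp
  have hlim : ∀ᵐ x, ∃ l, Tendsto (fun n => u n x) atTop (𝓝 l) := by
    filter_upwards [ae_eventually_notMem hsum] with x hx
    obtain ⟨n, hn⟩ := eventually_atTop.1 hx
    have hc : CauchySeq fun j => u (n + j) x :=
      cauchySeq_of_le_geometric_two (hdist x n fun j => hn _ (Nat.le_add_right n j))
    obtain ⟨l, hl⟩ := cauchySeq_tendsto_of_complete hc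
    refine ⟨l, (tendsto_add_atTop_iff_nat n).1 ?_⟩
    simpa only [add_comm n] using hl
  obtain ⟨h, hhm, hh⟩ := exists_stronglyMeasurable_limit_of_tendsto_ae hu hlim
  refine ⟨h, hhm.aestronglyMeasurable, fun n => ?_⟩
  calc _ ≤ volume (⋃ j, S (n + j)) := by
        refine measure_mono_ae ?_
        filter_upwards [hh] with x hx
        intro hlt
        by_contra hmem
        have hmem' : ∀ j, x ∉ S (n + j) := fun j hj => hmem (Set.mem_iUnion.2 ⟨j, hj⟩)
        have hl : Tendsto (fun j => u (n + j) x) atTop (𝓝 (h x)) := by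
          simpa only [add_comm n] using (tendsto_add_atTop_iff_nat n).2 hx
        have := dist_le_of_le_geometric_two_of_tendsto₀ (hdist x n hmem') hl
        rw [dist_comm, dist_eq_norm] at this
        exact absurd hlt (not_lt.2 this)
    _ ≤ ∑' j, volume (S (n + j)) := measure_iUnion_le _
    _ ≤ ∑' j, 2⁻¹ ^ (n + j) := ENNReal.tsum_le_tsum fun j => hcau _
    _ = _ := by
        simp_rw [pow_add]
        rw [ENNReal.tsum_mul_left, ENNReal.tsum_geometric_two]

lemma ofReal_half_pow (n : ℕ) : ENNReal.ofReal ((1 / 2 : ℝ) ^ n) = 2⁻¹ ^ n := by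
  rw [ENNReal.ofReal_pow (by norm_num), one_div, ENNReal.ofReal_inv_of_pos (by norm_num),
    ENNReal.ofReal_ofNat]

theorem exists_stepLimit (hd : 0 < d) {T : L2 d →L[ℂ] L2 d} {k : E d → E d → ℂ}
    (hT : IsCZOperator T k) {A : ℝ} (hA : 0 < A)
    (hTA : ‖T‖ₑ ≤ ENNReal.ofReal A) (hH : l2Hormander k ≤ ENNReal.ofReal A) (f : L1 d) :
    ∃ h : L0 d, StepLimit T f h := by
  set K := 2 * weakConst d * ENNReal.ofReal A with hK
  have hKtop : K ≠ ∞ := by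
    have := weakConst_ne_top d
    finiteness
  set r := K.toReal + 1 with hr
  have hr1 : 1 ≤ r := by simp [hr]
  have hr0 : 0 < r := by positivity
  have hKr : K ≤ ENNReal.ofReal r := by
    rw [← ENNReal.ofReal_toReal hKtop]
    exact ENNReal.ofReal_le_ofReal (by simp [hr])
  -- With L_1 increments at most 2 δ n, the weak inequality at height 2^(-n) gives measure at most
  -- 2^(-n), since r dominates its constant.
  set δ : ℕ → ℝ := fun n => (1 / 2) ^ n * (1 / 2) ^ n / (2 * r) with hδ
  have hδ0 : ∀ n, 0 < δ n := fun n => by positivity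
  have hp1 : ∀ n : ℕ, (1 / 2 : ℝ) ^ n ≤ 1 := fun n => pow_le_one₀ (by norm_num) (by norm_num)
  have hδs : ∀ n, δ (n + 1) ≤ δ n := fun n => by
    simp only [hδ]
    have : (1 / 2 : ℝ) ^ (n + 1) ≤ (1 / 2) ^ n :=
      pow_le_pow_of_le_one (by norm_num) (by norm_num) (Nat.le_succ n)
    gcongr
  have hδp : ∀ n, δ n ≤ (1 / 2) ^ n := fun n => by
    rw [hδ, div_le_iff₀ (by positivity)]
    have : (0 : ℝ) < (1 / 2) ^ n := by positivity
    exact mul_le_mul_of_nonneg_left ((hp1 n).trans (by linarith)) this.le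
  choose g h hgh hg using fun n => exists_L1_L2_approx f (hδ0 n)
  have hstep := fun n => stepLimit_of_ae_eq T (g n) (h n) (hgh n)
  have hcau : ∀ n, volume {x | (1 / 2 : ℝ) ^ n < ‖T (h n) x - T (h (n + 1)) x‖} ≤ 2⁻¹ ^ n := by
    intro n
    have hp : (0 : ℝ) < (1 / 2) ^ n := by positivity
    have hmeas : AEMeasurable (fun x => ‖f x - g n x‖ₑ) volume :=
      ((Lp.aestronglyMeasurable f).sub (Lp.aestronglyMeasurable (g n))).enorm
    have hnorm : ∫⁻ x, ‖g n x - g (n + 1) x‖ₑ ≤ ENNReal.ofReal (2 * δ n) := by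
      calc _ ≤ ∫⁻ x, ‖f x - g n x‖ₑ + ‖f x - g (n + 1) x‖ₑ := lintegral_mono fun x => by
            rw [enorm_sub_rev (f x) (g n x),
              show g n x - g (n + 1) x = (g n x - f x) + (f x - g (n + 1) x) by ring]
            exact enorm_add_le _ _
        _ ≤ ENNReal.ofReal (δ n) + ENNReal.ofReal (δ n) := by
            rw [lintegral_add_left' hmeas]
            exact add_le_add (hg n)
              ((hg (n + 1)).trans (ENNReal.ofReal_le_ofReal (hδs n)))
        _ = _ := by rw [← ENNReal.ofReal_add (hδ0 n).le (hδ0 n).le, two_mul]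
    have h1 := mul_measure_le_of_stepLimit hd hT hp hA hTA hH
      ((Lp.aestronglyMeasurable (g n)).sub (Lp.aestronglyMeasurable (g (n + 1))))
      ((Lp.aestronglyMeasurable (T (h n))).sub (Lp.aestronglyMeasurable (T (h (n + 1)))))
      ((hstep n).sub (Lp.aestronglyMeasurable (g n)) (hstep (n + 1)))
    have h2 : ENNReal.ofReal ((1 / 2) ^ n) *
        volume {x | (1 / 2 : ℝ) ^ n < ‖T (h n) x - T (h (n + 1)) x‖} ≤
        ENNReal.ofReal ((1 / 2) ^ n) * ENNReal.ofReal ((1 / 2) ^ n) := by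
      calc _ ≤ K * ∫⁻ x, ‖g n x - g (n + 1) x‖ₑ := h1
        _ ≤ ENNReal.ofReal r * ENNReal.ofReal (2 * δ n) := mul_le_mul' hKr hnorm
        _ = _ := by
          rw [← ENNReal.ofReal_mul hr0.le, ← ENNReal.ofReal_mul hp.le]
          congr 1
          simp only [hδ]
          field_simp
    rw [← ofReal_half_pow]
    exact (ENNReal.mul_le_mul_iff_right (by simp) (by simp)).1 h2
  obtain ⟨u, hum, hu⟩ := exists_limit_of_measure_le
    (fun n => Lp.aestronglyMeasurable (T (h n))) hcau
  refine ⟨AEEqFun.mk u hum, ?_⟩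
  have hlim : StepLimit T f u := by
    refine StepLimit.of_forall (Lp.aestronglyMeasurable f) fun ε hε => ?_
    obtain ⟨n, hn⟩ := exists_pow_lt_of_lt_one (half_pos hε) (by norm_num : (1 / 2 : ℝ) < 1)
    refine ⟨g n, T (h n), Lp.aestronglyMeasurable _, hstep n, (hg n).trans ?_, ?_⟩
    · exact ENNReal.ofReal_le_ofReal ((hδp n).trans (by linarith))
    · refine le_trans (measure_mono fun x hx => ?_) ((hu n).trans ?_)
      · change ε < _ at hx
        exact lt_of_le_of_lt (by linarith) hx
      · rw [← ofReal_half_pow, ← ENNReal.ofReal_ofNat, ← ENNReal.ofReal_mul (by positivity)]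
        exact ENNReal.ofReal_le_ofReal (by linarith)
  exact hlim.congr (ae_eq_refl _) (AEEqFun.coeFn_mk u hum).symm

/-- Limits are chosen function by function; additivity and homogeneity follow from their uniqueness.
-/
theorem exists_linearMap_stepLimit (hd : 0 < d) {T : L2 d →L[ℂ] L2 d} {k : E d → E d → ℂ}
    (hT : IsCZOperator T k) {A : ℝ} (hA : 0 < A)
    (hTA : ‖T‖ₑ ≤ ENNReal.ofReal A) (hH : l2Hormander k ≤ ENNReal.ofReal A) :
    ∃ S : L1 d →ₗ[ℂ] L0 d, ∀ f : L1 d, StepLimit T f (S f) := by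
  choose S hS using exists_stepLimit hd hT hA hTA hH
  refine ⟨{ toFun := S, map_add' := fun f g => ?_, map_smul' := fun z f => ?_ }, hS⟩
  · refine AEEqFun.ext (StepLimit.unique hd hT hA hTA hH (Lp.aestronglyMeasurable (f + g))
      (S (f + g)).aestronglyMeasurable (S f + S g).aestronglyMeasurable (hS (f + g)) ?_)
    exact ((hS f).add (Lp.aestronglyMeasurable f) (hS g)).congr (Lp.coeFn_add f g).symm
      (AEEqFun.coeFn_add (S f) (S g)).symm
  · refine AEEqFun.ext (StepLimit.unique hd hT hA hTA hH (Lp.aestronglyMeasurable (z • f))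
      (S (z • f)).aestronglyMeasurable (z • S f).aestronglyMeasurable (hS (z • f)) ?_)
    exact ((hS f).smul z).congr (Lp.coeFn_smul z f).symm (AEEqFun.coeFn_smul z (S f)).symm

lemma lintegral_trAbs_ne_top {m : ℕ} (f : Matrix (Fin m) (Fin m) (L1 d)) :
    ∫⁻ x : E d, trAbs (f.map fun g => (g : E d → ℂ) x) ≠ ∞ := by
  have hmeas : ∀ i j, AEMeasurable (fun x => ‖f i j x‖ₑ) volume :=
    fun i j => (Lp.aestronglyMeasurable (f i j)).enorm
  refine ne_top_of_le_ne_top ?_ (lintegral_mono fun x =>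
    trAbs_le_sum_entries (f.map fun g => (g : E d → ℂ) x))
  simp only [Matrix.map_apply]
  rw [lintegral_const_mul' _ _ (by simp),
    lintegral_finsetSum' _ fun i _ => Finset.aemeasurable_fun_sum _ fun j _ => hmeas i j]
  simp_rw [lintegral_finsetSum' _ fun j _ => hmeas _ j]
  refine ENNReal.mul_ne_top (by simp) (ENNReal.sum_ne_top.2 fun i _ =>
    ENNReal.sum_ne_top.2 fun j _ => ?_)
  rw [← eLpNorm_one_eq_lintegral_enorm]
  exact Lp.eLpNorm_ne_top _

/-- The preceding estimates need A > 0, while the sum of norm and Hörmander constant may vanish. So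
A is taken larger by ε, and ε tends to 0, which is harmless because the trace norm of f has finite
integral. -/
theorem weakTypeOneOne_of_stepLimit (hd : 0 < d) {T : L2 d →L[ℂ] L2 d} {k : E d → E d → ℂ}
    (hT : IsCZOperator T k) (hH : l2Hormander k < ∞) {S : L1 d →ₗ[ℂ] L0 d}
    (hS : ∀ f : L1 d, StepLimit T f (S f)) (m : ℕ) :
    WeakTypeOneOne m S (2 * weakConst d * (‖T‖ₑ + l2Hormander k)) := by
  intro f t ht
  set B := ‖T‖ₑ + l2Hormander k with hB
  have hBtop : B ≠ ∞ := ENNReal.add_ne_top.2 ⟨enorm_ne_top, hH.ne⟩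
  set X := ∫⁻ x : E d, trAbs (f.map fun g => (g : E d → ℂ) x) with hX
  have hK : 2 * weakConst d * X ≠ ∞ := ENNReal.mul_ne_top
    (ENNReal.mul_ne_top (by simp) (weakConst_ne_top d)) (lintegral_trAbs_ne_top f)
  refine le_of_forall_le_add_mul hK one_pos fun ε hε _ => ?_
  have hBA : ENNReal.ofReal (B.toReal + ε) = B + ENNReal.ofReal ε := by
    rw [ENNReal.ofReal_add ENNReal.toReal_nonneg hε.le, ENNReal.ofReal_toReal hBtop]
  have hle : B ≤ ENNReal.ofReal (B.toReal + ε) := hBA ▸ le_self_add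
  have := weakType_of_stepLimit hd hT ht (A := B.toReal + ε) (by positivity)
    (le_self_add.trans hle) (le_add_self.trans hle)
    (f := fun i j => f i j) (h := fun i j => S (f i j))
    (fun i j => Lp.aestronglyMeasurable _) fun i j => hS _
  refine this.trans_eq ?_
  rw [hBA, show ∫⁻ x : E d, trAbs (Matrix.of fun i j => f i j x) = X from rfl]
  ring

/-- The scalar inequality makes S continuous from L_1 into convergence in measure, and S agrees with
T on the dense subspace L_1 ∩ L_2, where images are step limits. Hence any admissible extension is
determined. -/
theorem stepLimit_of_weakTypeOneOne {T : L2 d →L[ℂ] L2 d} {S : L1 d →ₗ[ℂ] L0 d}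
    (hS : Extends S T) {K : ℝ≥0∞} (hK : K ≠ ∞) (hw : WeakTypeOneOne 1 S K) (f : L1 d) :
    StepLimit T f (S f) := by
  refine StepLimit.of_forall (Lp.aestronglyMeasurable f) fun ε hε => ?_
  set r := K.toReal + 1 with hr
  have hr0 : 0 < r := by positivity
  have hKr : K ≤ ENNReal.ofReal r := by
    rw [← ENNReal.ofReal_toReal hK]
    exact ENNReal.ofReal_le_ofReal (by simp [hr])
  obtain ⟨g, h, hgh, hg⟩ := exists_L1_L2_approx f (ε := min ε (ε * ε / r)) (by positivity)
  refine ⟨g, T h, Lp.aestronglyMeasurable g, stepLimit_of_ae_eq T g h hgh,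
    hg.trans (ENNReal.ofReal_le_ofReal (min_le_left _ _)), ?_⟩
  have h1 := hw (Matrix.of fun _ _ => f - g) ε hε
  have h2 : ∫⁻ x : E d, trLevel ε ((Matrix.of fun _ _ : Fin 1 => f - g).map
      fun u => (S u : E d → ℂ) x) = volume {x | ε < ‖S (f - g) x‖} :=
    lintegral_trLevel_one_by_one (S (f - g)).aestronglyMeasurable ε
  have h3 : ∫⁻ x : E d, trAbs ((Matrix.of fun _ _ : Fin 1 => f - g).map
      fun u => (u : E d → ℂ) x) = ∫⁻ x, ‖f x - g x‖ₑ := by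
    refine lintegral_congr_ae ?_
    filter_upwards [Lp.coeFn_sub f g] with x hx
    rw [trAbs_one_by_one, Matrix.map_apply, Matrix.of_apply, hx, Pi.sub_apply]
  rw [h2, h3] at h1
  have h4 : volume {x | ε < ‖S f x - T h x‖} = volume {x | ε < ‖S (f - g) x‖} := by
    refine measure_congr ?_
    rw [map_sub]
    filter_upwards [AEEqFun.coeFn_sub (S f) (S g), hS g h hgh] with x hx hx'
    refine propext ?_
    change ε < ‖_‖ ↔ ε < ‖_‖
    rw [hx, Pi.sub_apply, hx']
  rw [h4]
  refine (ENNReal.mul_le_mul_iff_right (a := ENNReal.ofReal ε) (by simpa using hε)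
    (by simp)).1 (h1.trans ?_)
  calc _ ≤ ENNReal.ofReal r * ENNReal.ofReal (ε * ε / r) :=
        mul_le_mul' hKr (hg.trans (ENNReal.ofReal_le_ofReal (min_le_right _ _)))
    _ = _ := by
        rw [← ENNReal.ofReal_mul hr0.le, ← ENNReal.ofReal_mul hε.le]
        congr 1
        field_simp

end Extension

end MatrixCZ

/-! ### The main theorem -/

theorem theoremA (d : ℕ) (hd : 0 < d) :
    ∃ C : ℝ≥0, ∀ (T : MatrixCZ.L2 d →L[ℂ] MatrixCZ.L2 d)
      (k : MatrixCZ.E d → MatrixCZ.E d → ℂ),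
      MatrixCZ.IsCZOperator T k → MatrixCZ.l2Hormander k < ∞ →
        ∃! S : MatrixCZ.L1 d →ₗ[ℂ] MatrixCZ.L0 d,
          MatrixCZ.Extends S T ∧
            ∀ m : ℕ, MatrixCZ.WeakTypeOneOne m S (C * (‖T‖ₑ + MatrixCZ.l2Hormander k)) := by
  have hC : 2 * MatrixCZ.weakConst d ≠ ∞ := ENNReal.mul_ne_top (by simp) (MatrixCZ.weakConst_ne_top d)
  refine ⟨(2 * MatrixCZ.weakConst d).toNNReal, fun T k hT hH => ?_⟩
  rw [ENNReal.coe_toNNReal hC]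
  have hB : ‖T‖ₑ + MatrixCZ.l2Hormander k ≠ ∞ := ENNReal.add_ne_top.2 ⟨enorm_ne_top, hH.ne⟩
  -- The added 1 only makes A positive for constructing S. It does not enter the final constant,
  -- which `weakTypeOneOne_of_stepLimit` derives again from the step limit property.
  set A := (‖T‖ₑ + MatrixCZ.l2Hormander k).toReal + 1 with hA
  have hA0 : 0 < A := by positivity
  have hle : ‖T‖ₑ + MatrixCZ.l2Hormander k ≤ ENNReal.ofReal A := by
    rw [← ENNReal.ofReal_toReal hB]
    exact ENNReal.ofReal_le_ofReal (by simp [hA])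
  have hTA := le_self_add.trans hle
  have hHA := le_add_self.trans hle
  obtain ⟨S, hS⟩ := MatrixCZ.exists_linearMap_stepLimit hd hT hA0 hTA hHA
  refine ⟨S, ⟨fun g h hgh => ?_, MatrixCZ.weakTypeOneOne_of_stepLimit hd hT hH hS⟩, fun S' hS' => ?_⟩
  · exact MatrixCZ.StepLimit.unique hd hT hA0 hTA hHA (Lp.aestronglyMeasurable g)
      (S g).aestronglyMeasurable (Lp.aestronglyMeasurable (T h)) (hS g)
      (MatrixCZ.stepLimit_of_ae_eq T g h hgh)
  · refine LinearMap.ext fun f => AEEqFun.ext ?_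
    exact MatrixCZ.StepLimit.unique hd hT hA0 hTA hHA (Lp.aestronglyMeasurable f)
      (S' f).aestronglyMeasurable (S f).aestronglyMeasurable
      (MatrixCZ.stepLimit_of_weakTypeOneOne hS'.1 (ENNReal.mul_ne_top hC hB) (hS'.2 1) f) (hS f)
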